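/- **Diagrams.** Let $d\ge 3$ be an integer and $k$ a commutative ring. A *$T_*$-diagram* consists of $n\ge 0$ points $t_1<\dots<t_n$ on the line (active points), a set of oriented chords, each joining two distinct active points, with at most one chord between any two of them, and a set of active points marked by an asterisk, such that every active point is marked or adjacent to a chord and such that the graph formed by the chords is a forest. A diagram is oriented by a monomial in which each of the following elements occurs exactly once: the points $t_i$, of degree $-1$; $\alpha_{ij}$ for each chord from $t_i$ to $t_j$, and $\alpha_i^*$ for each asterisk at $t_i$, all of degree $d-1$. Let $T_*$ be the $k$-module generated by oriented diagrams modulo graded commutativity of the orienting monomial, $\alpha_{ij}=(-1)^d\alpha_{ji}$, and $\alpha_{ij}\alpha_{jl}+\alpha_{jl}\alpha_{li}+\alpha_{li}\alpha_{ij}=0$ for distinct $i,j,l$. It is graded by the total degree of the orienting monomial. **Differential.** $\partial D=\sum_{i=1}^{n-1}\partial_iD$, where $\partial_i$ glues $t_i$ with $t_{i+1}$: one moves $t_i$ to the first place of the orienting monomial (with the corresponding sign), removes it, renames $t_{i+1}$ to $t_i$, and replaces $\alpha_{i,i+1}$ by $\alpha_i^*$ and $\alpha_{i+1,i}$ by $(-1)^d\alpha_i^*$;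 the gluing is zero if an asterisk would occur twice at a point or if the resulting chords do not form a forest. Let $T$ be the quotient complex of $T_*$ by the span of the diagrams having at least one asterisk. **Divided powers.** For diagrams $D_1,\dots,D_\ell$ let $\langle D_1,\dots,D_\ell\rangle$ be the sum of all diagrams obtained by shuffling the active points of the $D_i$ (the order of the points of each $D_i$ is kept, the orienting monomials are concatenated in the order $D_1,\dots,D_\ell$) in which, for all $i<j$ such that $D_i$ and $D_j$ have active points, the left-most point of $D_i$ is on the left of the left-most point of $D_j$. Extend this multilinearly to $T_*$ and to $T$, and put $x^{\langle\ell\rangle}=\langle x,\dots,x\rangle$ ($\ell$ times), $\ell\ge 0$. **Theorem 11.1.** Let $C$ be $T_*$ or $T$, over any commutative ring $k$. The divided powers are homology operations for $C$. That is, for every $\ell\ge 0$ and every $q$ such that $q$ is even or $k$ has characteristic $2$, $x^{\langle\ell\rangle}$ is a cycle of degree $\ell q$ for every cycle $x$ of degree $q$, and $[x]\mapsto[x^{\langle\ell\rangle}]$ is a well-defined map $H_q(C)\to H_{\ell q}(C)$ on the homology of $(C,\partial)$. More generally, $[x]\mapsto[x^{\langle\ell\rangle}]$ is well defined on the homology classes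 of cycles that are sums of homogeneous elements of even degrees (with values in classes of the same kind) and, if $k$ has characteristic $2$, on the whole homology of $C$. In particular, for $\ell\ge1$, if $x$ is a boundary which is a sum of homogeneous elements of even degrees (or any boundary, if $k$ has characteristic $2$), then $x^{\langle\ell\rangle}$ is a boundary. -/

import Mathlib

open scoped BigOperators

noncomputable section

namespace KnotDiagram

/-- The elements of the orienting set of a diagram whose active points are labelled by `α`:
an active point `t_a`, an oriented chord `α_{ab}` from `t_a` to `t_b`,
an asterisk `α_a^*` placed at the active point `t_a`. -/
inductive Letter (α : Type) : Type where
  | pt (a : α) : Letter α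
  | chord (a b : α) : Letter α
  | ast (a : α) : Letter α

namespace Letter

/-- Relabelling of the active points. -/
def map {α β : Type} (f : α → β) : Letter α → Letter β
  | pt a => pt (f a)
  | chord a b => chord (f a) (f b)
  | ast a => ast (f a)

/-- Active points have degree `-1`, chords and asterisks have degree `d - 1`. -/
def deg (d : ℕ) {α : Type} : Letter α → ℤ
  | pt _ => -1
  | chord _ _ => (d : ℤ) - 1
  | ast _ => (d : ℤ) - 1

end Letter

open Letter

/-- A monomial in the elements of the orienting set; the active points are
`t_0 < t_1 < ... < t_{n-1}`. -/
abbrev Word (n : ℕ) : Type := List (Letter (Fin n))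

/-- The total degree of a monomial. -/
def Word.deg (d : ℕ) {n : ℕ} (w : Word n) : ℤ := (w.map (Letter.deg d)).sum

/-- The graph formed by the active points and the chords. -/
def chordGraph {n : ℕ} (w : Word n) : SimpleGraph (Fin n) :=
  SimpleGraph.fromRel fun a b => chord a b ∈ w

/-- The monomial `w` is the orienting monomial of a `T_*`-diagram with `n` active points. -/
structure IsDiagram {n : ℕ} (w : Word n) : Prop where
  /-- every active point occurs in the monomial -/
  pt_mem : ∀ a, pt a ∈ w
  /-- every element of the orienting set occurs once
  (in particular there is at most one asterisk at each active point) -/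
  nodup : w.Nodup
  /-- a chord joins two distinct active points -/
  chord_ne : ∀ a b, chord a b ∈ w → a ≠ b
  /-- two active points are joined by at most one chord -/
  chord_simple : ∀ a b, chord a b ∈ w → chord b a ∉ w
  /-- each active point contains an asterisk or is adjacent to a chord -/
  touched : ∀ a, ast a ∈ w ∨ ∃ b, chord a b ∈ w ∨ chord b a ∈ w
  /-- the chords form a forest -/
  forest : (chordGraph w).IsAcyclic

/-- An oriented `T_*`-diagram: a number `n` of active points and an orienting monomial. -/
structure Diagram : Type where
  n : ℕ
  word : Word n
  isDiagram : IsDiagram word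

/-- The cohomological degree `i (d - 1) - j` of a diagram, where `i` is the number of chords and
asterisks and `j` the number of active points: the total degree of the orienting monomial. -/
def Diagram.deg (d : ℕ) (D : Diagram) : ℤ := D.word.deg d

/-- The diagram has at least one asterisk. -/
def Diagram.HasAsterisk (D : Diagram) : Prop := ∃ a, ast a ∈ D.word

section Free

variable (k : Type*) [CommRing k]

/-- The free module on oriented diagrams. -/
abbrev Free : Type _ := Diagram →₀ k

open Classical in
/-- The diagram with the given orienting monomial; zero if there is no such diagram. -/
def ofWord {n : ℕ} (w : Word n) : Free k :=
  if h : IsDiagram w then Finsupp.single ⟨n, w, h⟩ 1 else 0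

/-- The relations between oriented diagrams with `n` active points. -/
inductive Relation (d : ℕ) (n : ℕ) : Free k → Prop where
  /-- graded commutativity of the orienting monomial -/
  | swap (u v : Word n) (a b : Letter (Fin n)) :
      Relation d n (ofWord k (u ++ [a, b] ++ v)
        - (a.deg d * b.deg d).negOnePow • ofWord k (u ++ [b, a] ++ v))
  /-- `α_{ab} = (-1)^d α_{ba}` -/
  | reverse (u v : Word n) (a b : Fin n) :
      Relation d n (ofWord k (u ++ [chord a b] ++ v)
        - (d : ℤ).negOnePow • ofWord k (u ++ [chord b a] ++ v))
  /-- `α_{ab} α_{bc} + α_{bc} α_{ca} + α_{ca} α_{ab} = 0` -/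
  | arnold (u v : Word n) (a b c : Fin n) (hab : a ≠ b) (hbc : b ≠ c) (hca : c ≠ a) :
      Relation d n (ofWord k (u ++ [chord a b, chord b c] ++ v)
        + ofWord k (u ++ [chord b c, chord c a] ++ v)
        + ofWord k (u ++ [chord c a, chord a b] ++ v))

/-- The submodule of all relations. -/
def relations (d : ℕ) : Submodule k (Free k) :=
  Submodule.span k {x | ∃ n, Relation k d n x}

/-- The space of the complex `T_*`: oriented `T_*`-diagrams modulo the relations. -/
abbrev TStar (d : ℕ) : Type _ := Free k ⧸ relations k d

/-- The class of a diagram in `T_*`. -/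
def TStar.ofDiagram (d : ℕ) (D : Diagram) : TStar k d :=
  (relations k d).mkQ (Finsupp.single D 1)

end Free

/-! ### Gluing of neighbour active points -/

/-- The effect of gluing the neighbour active points `t_i` and `t_{i+1}` on the other elements of the
orienting set; `i.predAbove` identifies `i` with `i + 1` and preserves the order.
A chord joining the two points becomes an asterisk. -/
def glueLetter {n : ℕ} (i : Fin n) : Letter (Fin (n + 1)) → Letter (Fin n)
  | pt a => pt (i.predAbove a)
  | ast a => ast (i.predAbove a)
  | chord a b =>
      if i.predAbove a = i.predAbove b then ast (i.predAbove a)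
      else chord (i.predAbove a) (i.predAbove b)

/-- The chord `α_{i,i+1}` becomes `α_i^*` and the chord `α_{i+1,i}` becomes `(-1)^d α_i^*`. -/
def glueSign (d : ℕ) {n : ℕ} (i : Fin n) : Letter (Fin (n + 1)) → ℤˣ
  | chord a b => if a = i.succ ∧ b = i.castSucc then (d : ℤ).negOnePow else 1
  | _ => 1

open Classical in
/-- The letters standing in front of `t_a`. -/
def before {n : ℕ} (a : Fin n) (w : Word n) : Word n := w.takeWhile fun l => l ≠ pt a

open Classical in
/-- Remove `t_a` from the monomial. -/
def removePt {n : ℕ} (a : Fin n) (w : Word n) : Word n := w.filter fun l => l ≠ pt a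

section Boundary

variable (k : Type*) [CommRing k] (d : ℕ)

/-- The diagram obtained by gluing `t_i` with `t_{i+1}`: move `t_i` to the first place of the
orienting monomial (this gives a sign), remove it, and replace the other elements by their images.
The result is zero if the obtained monomial is not that of a diagram, that is, if it contains
an asterisk twice or its chords do not form a forest. -/
def glue {n : ℕ} (i : Fin n) (w : Word (n + 1)) : Free k :=
  (((before i.castSucc w).deg d).negOnePow * (w.map (glueSign d i)).prod) •
    ofWord k ((removePt i.castSucc w).map (glueLetter i))

/-- The sum over all gluings of neighbour active points. -/
def boundaryWord : {n : ℕ} → Word n → Free k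
  | 0, _ => 0
  | _ + 1, w => ∑ i, glue k d i w

/-- The differential on the free module. -/
def boundaryFree : Free k →ₗ[k] Free k :=
  Finsupp.linearCombination k fun D : Diagram => boundaryWord k d D.word

end Boundary

/-! ### Divided products -/

/-- A shuffle of the active points of several diagrams, the `i`-th of which has `n i` points, is a
bijection onto the set of points of the new diagram preserving the order of the points of each
diagram. It contributes to the divided product if the left-most point of each diagram is placed on
the left from the left-most point of the next ones (the trivial diagram, without active points,
gives no condition). -/
def IsDividedShuffle {ℓ : ℕ} (n : Fin ℓ → ℕ) (e : (Σ i, Fin (n i)) ≃ Fin (∑ i, n i)) : Prop :=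
  (∀ i, StrictMono fun a => e ⟨i, a⟩) ∧
  ∀ i j, i < j → ∀ (hi : 0 < n i) (hj : 0 < n j), e ⟨i, ⟨0, hi⟩⟩ < e ⟨j, ⟨0, hj⟩⟩

/-- The term of the shuffle product given by `e`: its orienting monomial is the
concatenation of those of the factors. -/
def shuffleWord {ℓ : ℕ} {n : Fin ℓ → ℕ} (w : ∀ i, Word (n i))
    (e : (Σ i, Fin (n i)) ≃ Fin (∑ i, n i)) : Word (∑ i, n i) :=
  (List.ofFn fun i => (w i).map (Letter.map fun a => e ⟨i, a⟩)).flatten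

section Divided

variable (k : Type*) [CommRing k] (d : ℕ)

open Classical in
/-- The divided product `⟨D_1, ..., D_ℓ⟩` of diagrams. -/
def dividedWord {ℓ : ℕ} {n : Fin ℓ → ℕ} (w : ∀ i, Word (n i)) : Free k :=
  ∑ e : (Σ i, Fin (n i)) ≃ Fin (∑ i, n i) with IsDividedShuffle n e, ofWord k (shuffleWord w e)

open Classical in
/-- The multilinear extension of the divided product to the free module. -/
def dividedFree (ℓ : ℕ) : MultilinearMap k (fun _ : Fin ℓ => Free k) (Free k) :=
  ((Finsupp.linearCombination k fun D : Fin ℓ → Diagram => dividedWord k fun i => (D i).word) ∘ₗ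
    (PiTensorProduct.ofFinsuppEquiv' (R := k) (ι := Fin ℓ) (κ := fun _ => Diagram)).toLinearMap).compMultilinearMap
    (PiTensorProduct.tprod k)

end Divided

/-! ### The relations are respected -/

section Descent

theorem isDiagram_of_perm {n : ℕ} {w w' : Word n} (hp : w.Perm w') (h : IsDiagram w) :
    IsDiagram w' := by
  have hm : ∀ l, l ∈ w' ↔ l ∈ w := fun l => hp.mem_iff.symm
  have hg : chordGraph w' = chordGraph w := by
    ext a b
    simp [chordGraph, hm]
  refine ⟨fun a => (hm _).2 (h.pt_mem a), hp.nodup_iff.1 h.nodup, fun a b hab => ?_,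
    fun a b hab => ?_, fun a => ?_, hg ▸ h.forest⟩
  · exact h.chord_ne a b ((hm _).1 hab)
  · rw [hm] at hab ⊢
    exact h.chord_simple a b hab
  · simp only [hm]
    exact h.touched a

theorem isDiagram_perm_iff {n : ℕ} {w w' : Word n} (hp : w.Perm w') :
    IsDiagram w ↔ IsDiagram w' :=
  ⟨isDiagram_of_perm hp, isDiagram_of_perm hp.symm⟩

theorem isDiagram_swap {n : ℕ} (u v : Word n) (a b : Letter (Fin n)) :
    IsDiagram (u ++ [a, b] ++ v) ↔ IsDiagram (u ++ [b, a] ++ v) :=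
  isDiagram_perm_iff (((List.Perm.swap b a []).append_left u).append_right v)

theorem isDiagram_reverse_aux {n : ℕ} (u v : Word n) (a b : Fin n)
    (h : IsDiagram (u ++ [chord a b] ++ v)) : IsDiagram (u ++ [chord b a] ++ v) := by
  have h1 : IsDiagram (chord a b :: (u ++ v)) :=
    isDiagram_of_perm (by simp) h
  refine isDiagram_of_perm (w := chord b a :: (u ++ v)) (by simpa using List.perm_middle.symm) ?_
  have hne : a ≠ b := h1.chord_ne a b (by simp)
  have hba : chord b a ∉ u ++ v := fun hm =>
    h1.chord_simple a b (by simp) (List.mem_cons_of_mem _ hm)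
  have hab : chord a b ∉ u ++ v := (List.nodup_cons.1 h1.nodup).1
  generalize u ++ v = w at *
  refine ⟨fun c => ?_, ?_, fun c e hc => ?_, fun c e hc => ?_, fun c => ?_, ?_⟩
  · simpa using h1.pt_mem c
  · exact List.nodup_cons.2 ⟨hba, (List.nodup_cons.1 h1.nodup).2⟩
  · have := h1.chord_ne c e
    have := h1.chord_ne e c
    grind
  · have := h1.chord_simple c e
    have := h1.chord_simple e c
    grind
  · have := h1.touched c
    grind
  · have : chordGraph (chord b a :: w) = chordGraph (chord a b :: w) := by
      ext c e
      simp [chordGraph]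
      grind
    rw [this]
    exact h1.forest

theorem isDiagram_reverse {n : ℕ} (u v : Word n) (a b : Fin n) :
    IsDiagram (u ++ [chord a b] ++ v) ↔ IsDiagram (u ++ [chord b a] ++ v) :=
  ⟨isDiagram_reverse_aux u v a b, isDiagram_reverse_aux u v b a⟩

theorem chordGraph_cons {n : ℕ} (w : Word n) (a b : Fin n) :
    chordGraph (chord a b :: w) = chordGraph w ⊔ SimpleGraph.edge a b := by
  ext c e
  simp [chordGraph, SimpleGraph.edge_adj]
  grind

theorem not_reachable_of_cons {n : ℕ} (w : Word n) (a b : Fin n) (hne : a ≠ b)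
    (hab : chord a b ∉ w) (hba : chord b a ∉ w)
    (h : (chordGraph (chord a b :: w)).IsAcyclic) : ¬ (chordGraph w).Reachable a b := by
  rw [chordGraph_cons, SimpleGraph.isAcyclic_sup_fromEdgeSet_iff] at h
  intro hr
  rcases h.2 hr with h' | h'
  · exact hne h'
  · simp [chordGraph] at h'
    grind

theorem isDiagram_arnold_aux {n : ℕ} (u v : Word n) (a b c : Fin n) (hab : a ≠ b) (hbc : b ≠ c)
    (hca : c ≠ a) (h : IsDiagram (u ++ [chord a b, chord b c] ++ v)) :
    IsDiagram (u ++ [chord b c, chord c a] ++ v) := by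
  have h1 : IsDiagram (chord a b :: chord b c :: (u ++ v)) := isDiagram_of_perm (by
    rw [List.append_assoc]
    exact (List.perm_append_comm_assoc u _ v)) h
  refine isDiagram_of_perm (w := chord c a :: chord b c :: (u ++ v)) ?_ ?_
  · rw [List.append_assoc]
    exact (List.Perm.swap _ _ _).trans (List.perm_append_comm_assoc u [chord b c, chord c a] v).symm
  have n1 := h1.nodup
  have s1 := h1.chord_simple
  have e1 : ¬ (chordGraph (chord b c :: (u ++ v))).Reachable a b := by
    refine not_reachable_of_cons _ a b hab ?_ ?_ h1.forest
    · grind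
    · have := s1 a b
      grind
  generalize u ++ v = w at *
  have hadj : (chordGraph (chord b c :: w)).Adj b c := by
    simp [chordGraph, hbc]
  have e2 : ¬ (chordGraph (chord b c :: w)).Reachable c a := fun hr =>
    e1 (hadj.reachable.trans hr).symm
  have hac' : chord a c ∉ w := fun hm => e2 (SimpleGraph.Adj.reachable (by
    simp [chordGraph, hm, hca]))
  have hca' : chord c a ∉ w := fun hm => e2 (SimpleGraph.Adj.reachable (by
    simp [chordGraph, hm, hca]))
  refine ⟨fun x => ?_, ?_, fun x y hx => ?_, fun x y hx => ?_, fun x => ?_, ?_⟩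
  · simpa using h1.pt_mem x
  · grind
  · have := h1.chord_ne x y
    grind
  · have := s1 x y
    have := s1 y x
    grind
  · have := h1.touched x
    grind
  · rw [chordGraph_cons]
    refine SimpleGraph.IsAcyclic.sup_edge_of_not_reachable e2 ?_
    have := h1.forest
    rw [chordGraph_cons] at this
    exact this.anti le_sup_left

theorem isDiagram_arnold {n : ℕ} (u v : Word n) (a b c : Fin n) (hab : a ≠ b) (hbc : b ≠ c)
    (hca : c ≠ a) : (IsDiagram (u ++ [chord a b, chord b c] ++ v) ↔
      IsDiagram (u ++ [chord b c, chord c a] ++ v)) ∧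
      (IsDiagram (u ++ [chord b c, chord c a] ++ v) ↔
      IsDiagram (u ++ [chord c a, chord a b] ++ v)) := by
  have h1 := isDiagram_arnold_aux u v a b c hab hbc hca
  have h2 := isDiagram_arnold_aux u v b c a hbc hca hab
  have h3 := isDiagram_arnold_aux u v c a b hca hab hbc
  tauto

variable (k : Type*) [CommRing k] (d : ℕ)

/-- The class in `T_*` of the diagram with the given orienting monomial. -/
def cls {n : ℕ} (w : Word n) : TStar k d := (relations k d).mkQ (ofWord k w)

theorem mkQ_relation {n : ℕ} {x : Free k} (hx : Relation k d n x) :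
    (relations k d).mkQ x = 0 :=
  (Submodule.Quotient.mk_eq_zero _).2 (Submodule.subset_span ⟨n, hx⟩)

theorem map_sign_smul {M N : Type*} [AddCommGroup M] [Module k M] [AddCommGroup N] [Module k N]
    (f : M →ₗ[k] N) (s : ℤˣ) (x : M) : f (s • x) = s • f x := by
  rw [Units.smul_def, Units.smul_def, map_zsmul]

theorem cls_swap {n : ℕ} (u v : Word n) (a b : Letter (Fin n)) :
    cls k d (u ++ [a, b] ++ v) = (a.deg d * b.deg d).negOnePow • cls k d (u ++ [b, a] ++ v) := by
  have := mkQ_relation k d (Relation.swap u v a b)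
  rwa [map_sub, map_sign_smul, sub_eq_zero] at this

theorem cls_reverse {n : ℕ} (u v : Word n) (a b : Fin n) :
    cls k d (u ++ [chord a b] ++ v) = (d : ℤ).negOnePow • cls k d (u ++ [chord b a] ++ v) := by
  have := mkQ_relation k d (Relation.reverse u v a b)
  rwa [map_sub, map_sign_smul, sub_eq_zero] at this

theorem cls_arnold {n : ℕ} (u v : Word n) (a b c : Fin n) (hab : a ≠ b) (hbc : b ≠ c)
    (hca : c ≠ a) : cls k d (u ++ [chord a b, chord b c] ++ v)
      + cls k d (u ++ [chord b c, chord c a] ++ v)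
      + cls k d (u ++ [chord c a, chord a b] ++ v) = 0 := by
  have := mkQ_relation k d (Relation.arnold u v a b c hab hbc hca)
  rwa [map_add, map_add] at this

theorem ofWord_of_not {n : ℕ} {w : Word n} (h : ¬ IsDiagram w) : ofWord k w = 0 := by
  simp [ofWord, h]

theorem ofWord_diagram (D : Diagram) : ofWord k D.word = Finsupp.single D 1 := by
  simp [ofWord, D.isDiagram]

theorem cls_of_not {n : ℕ} {w : Word n} (h : ¬ IsDiagram w) : cls k d w = 0 := by
  simp [cls, ofWord_of_not k h]

/-- A linear map kills the relations as soon as its values on diagrams satisfy them. -/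
theorem map_relation_eq_zero {M : Type*} [AddCommGroup M] [Module k M] {n : ℕ}
    (φ : Free k →ₗ[k] M) (Φ : Word n → M)
    (hφ : ∀ w, IsDiagram w → φ (ofWord k w) = Φ w)
    (swap : ∀ u v a b, IsDiagram (u ++ [a, b] ++ v) →
      Φ (u ++ [a, b] ++ v) = (a.deg d * b.deg d).negOnePow • Φ (u ++ [b, a] ++ v))
    (reverse : ∀ u v a b, a ≠ b →
      Φ (u ++ [chord a b] ++ v) = (d : ℤ).negOnePow • Φ (u ++ [chord b a] ++ v))
    (arnold : ∀ u v a b c, a ≠ b → b ≠ c → c ≠ a →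
      Φ (u ++ [chord a b, chord b c] ++ v) + Φ (u ++ [chord b c, chord c a] ++ v)
        + Φ (u ++ [chord c a, chord a b] ++ v) = 0)
    {x : Free k} (hx : Relation k d n x) : φ x = 0 := by
  cases hx with
  | swap u v a b =>
    rw [map_sub, map_sign_smul, sub_eq_zero]
    by_cases h : IsDiagram (u ++ [a, b] ++ v)
    · rw [hφ _ h, hφ _ ((isDiagram_swap u v a b).1 h), swap u v a b h]
    · rw [ofWord_of_not k h, ofWord_of_not k (mt (isDiagram_swap u v a b).2 h)]
      simp
  | reverse u v a b =>
    rw [map_sub, map_sign_smul, sub_eq_zero]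
    by_cases h : IsDiagram (u ++ [chord a b] ++ v)
    · rw [hφ _ h, hφ _ ((isDiagram_reverse u v a b).1 h), reverse u v a b (h.chord_ne a b (by simp))]
    · rw [ofWord_of_not k h, ofWord_of_not k (mt (isDiagram_reverse u v a b).2 h)]
      simp
  | arnold u v a b c hab hbc hca =>
    obtain ⟨h1, h2⟩ := isDiagram_arnold u v a b c hab hbc hca
    rw [map_add, map_add]
    by_cases h : IsDiagram (u ++ [chord a b, chord b c] ++ v)
    · rw [hφ _ h, hφ _ (h1.1 h), hφ _ (h2.1 (h1.1 h)), arnold u v a b c hab hbc hca]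
    · rw [ofWord_of_not k h, ofWord_of_not k (mt h1.2 h), ofWord_of_not k (fun h' => h (h1.2 (h2.2 h')))]
      simp


theorem predAbove_eq {n : ℕ} (i : Fin n) {a b : Fin (n + 1)} (hne : a ≠ b)
    (h : i.predAbove a = i.predAbove b) :
    (a = i.castSucc ∧ b = i.succ) ∨ (a = i.succ ∧ b = i.castSucc) := by
  have key : ∀ x : Fin (n + 1),
      (i.predAbove x).val = if i.val < x.val then x.val - 1 else x.val := by
    intro x
    simp only [Fin.predAbove, Fin.lt_def, Fin.val_castSucc]
    split_ifs <;> simp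
  have h' := congrArg Fin.val h
  rw [key, key] at h'
  simp only [ne_eq, Fin.ext_iff, Fin.val_castSucc, Fin.val_succ] at hne ⊢
  split_ifs at h' <;> omega

theorem predAbove_castSucc_eq_succ {n : ℕ} (i : Fin n) :
    i.predAbove i.castSucc = i.predAbove i.succ := by
  simp

theorem glueSign_of_ne {n : ℕ} (i : Fin n) (a b : Fin (n + 1))
    (h : i.predAbove a ≠ i.predAbove b) : glueSign d i (chord a b) = 1 := by
  simp only [glueSign]
  rw [if_neg]
  rintro ⟨rfl, rfl⟩
  exact h (predAbove_castSucc_eq_succ i).symm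

theorem glueSign_mul {n : ℕ} (i : Fin n) (a b : Fin (n + 1)) (hne : a ≠ b)
    (h : i.predAbove a = i.predAbove b) :
    glueSign d i (chord a b) = (d : ℤ).negOnePow * glueSign d i (chord b a) := by
  have hlt : i.castSucc ≠ i.succ := (Fin.castSucc_lt_succ).ne
  rcases predAbove_eq i hne h with ⟨rfl, rfl⟩ | ⟨rfl, rfl⟩
  · simp [glueSign, hlt, Int.units_mul_self]
  · simp [glueSign, hlt]

theorem deg_glueLetter {n : ℕ} (i : Fin n) (l : Letter (Fin (n + 1))) :
    (glueLetter i l).deg d = l.deg d := by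
  cases l with
  | pt a => rfl
  | ast a => rfl
  | chord a b =>
    simp only [glueLetter]
    split_ifs <;> rfl

theorem before_append_of_mem {n : ℕ} {a : Fin n} {u : Word n} (h : pt a ∈ u) (v : Word n) :
    before a (u ++ v) = before a u := by
  induction u with
  | nil => simp at h
  | cons l u ih =>
    by_cases hl : l = pt a
    · simp [before, hl]
    · have : pt a ∈ u := by
        rcases List.mem_cons.1 h with h | h
        · exact absurd h.symm hl
        · exact h
      have := ih this
      simp only [before] at this ⊢
      rw [List.cons_append, List.takeWhile_cons, List.takeWhile_cons, this]

theorem before_append_of_not_mem {n : ℕ} {a : Fin n} {u : Word n} (h : pt a ∉ u) (v : Word n) :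
    before a (u ++ v) = u ++ before a v := by
  induction u with
  | nil => rfl
  | cons l u ih =>
    have hl : l ≠ pt a := fun h' => h (by simp [h'])
    have := ih (fun h' => h (List.mem_cons_of_mem _ h'))
    simp only [before] at this ⊢
    rw [List.cons_append, List.takeWhile_cons, this]
    simp [hl]

theorem removePt_append {n : ℕ} (a : Fin n) (u v : Word n) :
    removePt a (u ++ v) = removePt a u ++ removePt a v := by
  simp [removePt]

theorem removePt_of_not_mem {n : ℕ} {a : Fin n} {u : Word n} (h : pt a ∉ u) :
    removePt a u = u := by
  simp only [removePt, List.filter_eq_self]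
  intro l hl
  have : l ≠ pt a := fun h' => h (h' ▸ hl)
  simpa using this

theorem Word.deg_append {n : ℕ} (u v : Word n) :
    Word.deg d (u ++ v) = Word.deg d u + Word.deg d v := by
  simp [Word.deg]

theorem exists_glue_append {n : ℕ} (i : Fin n) (u v : Word (n + 1)) :
    ∃ (U V : Word n) (s : ℤˣ) (ε : ℤ), ∀ m : Word (n + 1), pt i.castSucc ∉ m →
      (relations k d).mkQ (glue k d i (u ++ m ++ v)) =
        (s * (ε * m.deg d).negOnePow * (m.map (glueSign d i)).prod) •
          cls k d (U ++ m.map (glueLetter i) ++ V) := by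
  by_cases hu : pt i.castSucc ∈ u
  · refine ⟨(removePt i.castSucc u).map (glueLetter i), (removePt i.castSucc v).map (glueLetter i),
      ((before i.castSucc u).deg d).negOnePow * (u.map (glueSign d i)).prod *
        (v.map (glueSign d i)).prod, 0, fun m hm => ?_⟩
    rw [glue, map_sign_smul, List.append_assoc, before_append_of_mem hu, removePt_append,
      removePt_append, removePt_of_not_mem hm, cls]
    congr 1
    · simp
      ac_rfl
    · simp
  · refine ⟨u.map (glueLetter i), (removePt i.castSucc v).map (glueLetter i),
      (u.deg d).negOnePow * ((before i.castSucc v).deg d).negOnePow * (u.map (glueSign d i)).prod *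
        (v.map (glueSign d i)).prod, 1, fun m hm => ?_⟩
    rw [glue, map_sign_smul, List.append_assoc, before_append_of_not_mem hu,
      before_append_of_not_mem hm, removePt_append,
      removePt_append, removePt_of_not_mem hm, removePt_of_not_mem hu, cls]
    congr 1
    · simp [Word.deg_append, Int.negOnePow_add]
      ac_rfl
    · simp

theorem glue_swap_pt {n : ℕ} (i : Fin n) (u v : Word (n + 1)) (l : Letter (Fin (n + 1)))
    (h : IsDiagram (u ++ [pt i.castSucc, l] ++ v)) :
    (relations k d).mkQ (glue k d i (u ++ [pt i.castSucc, l] ++ v)) =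
      (l.deg d).negOnePow • (relations k d).mkQ (glue k d i (u ++ [l, pt i.castSucc] ++ v)) := by
  have hn := h.nodup
  have hu : pt i.castSucc ∉ u := by grind
  have hl : l ≠ pt i.castSucc := by grind
  rw [glue, glue, map_sign_smul, map_sign_smul, smul_smul, List.append_assoc, List.append_assoc,
    before_append_of_not_mem hu, before_append_of_not_mem hu]
  congr 1
  · have : ∀ s t : ℤˣ, s * (s * t) = t := fun s t => by rw [← mul_assoc, Int.units_mul_self, one_mul]
    simp [before, hl, Word.deg, Int.negOnePow_add]
    rw [mul_comm (List.map (Letter.deg d) u).sum.negOnePow (l.deg d).negOnePow, mul_assoc, this]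
    ac_rfl
  · simp [removePt, hl]

theorem glue_swap {n : ℕ} (i : Fin n) (u v : Word (n + 1)) (a b : Letter (Fin (n + 1)))
    (h : IsDiagram (u ++ [a, b] ++ v)) :
    (relations k d).mkQ (glue k d i (u ++ [a, b] ++ v)) =
      (a.deg d * b.deg d).negOnePow • (relations k d).mkQ (glue k d i (u ++ [b, a] ++ v)) := by
  by_cases ha : a = pt i.castSucc
  · subst ha
    rw [glue_swap_pt k d i u v b h]
    simp [Letter.deg]
  by_cases hb : b = pt i.castSucc
  · subst hb
    rw [glue_swap_pt k d i u v a ((isDiagram_swap u v _ _).1 h), smul_smul]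
    simp [Letter.deg, Int.units_mul_self]
  obtain ⟨U, V, s, ε, H⟩ := exists_glue_append k d i u v
  rw [H _ (by simp [Ne.symm ha, Ne.symm hb]), H _ (by simp [Ne.symm ha, Ne.symm hb])]
  simp only [List.map_cons, List.map_nil]
  rw [cls_swap, deg_glueLetter, deg_glueLetter, smul_smul, smul_smul]
  congr 1
  simp [Word.deg, add_comm]
  ac_rfl

theorem glue_reverse {n : ℕ} (i : Fin n) (u v : Word (n + 1)) (a b : Fin (n + 1)) (hab : a ≠ b) :
    (relations k d).mkQ (glue k d i (u ++ [chord a b] ++ v)) =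
      (d : ℤ).negOnePow • (relations k d).mkQ (glue k d i (u ++ [chord b a] ++ v)) := by
  obtain ⟨U, V, s, ε, H⟩ := exists_glue_append k d i u v
  rw [H _ (by simp), H _ (by simp)]
  simp only [List.map_cons, List.map_nil, Word.deg, Letter.deg]
  by_cases h : i.predAbove a = i.predAbove b
  · simp only [glueLetter, h, if_true, smul_smul]
    congr 1
    simp [glueSign_mul d i a b hab h]
    ac_rfl
  · have h' : i.predAbove b ≠ i.predAbove a := Ne.symm h
    simp only [glueLetter, h, h', if_false]
    rw [cls_reverse, smul_smul, smul_smul]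
    congr 1
    simp [glueSign_of_ne d i _ _ h, glueSign_of_ne d i _ _ h']
    ac_rfl

theorem glue_arnold_aux {n : ℕ} (i : Fin n) (u v : Word (n + 1)) (a b c : Fin (n + 1))
    (hab : a ≠ b) (hbc : b ≠ c) (hca : c ≠ a) (h : i.predAbove a = i.predAbove b) :
    (relations k d).mkQ (glue k d i (u ++ [chord a b, chord b c] ++ v))
      + (relations k d).mkQ (glue k d i (u ++ [chord b c, chord c a] ++ v))
      + (relations k d).mkQ (glue k d i (u ++ [chord c a, chord a b] ++ v)) = 0 := by
  obtain ⟨U, V, s, ε, H⟩ := exists_glue_append k d i u v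
  have hbc' : i.predAbove b ≠ i.predAbove c := fun h' => by
    have := predAbove_eq i hab h
    have := predAbove_eq i hbc h'
    grind
  rw [H _ (by simp), H _ (by simp), H _ (by simp)]
  simp only [List.map_cons, List.map_nil, Word.deg, Letter.deg, glueLetter, h, hbc', hbc'.symm,
    if_true, if_false]
  rw [cls_of_not k d (w := U ++ [chord (i.predAbove b) (i.predAbove c),
    chord (i.predAbove c) (i.predAbove b)] ++ V)
    (fun hd => hd.chord_simple (i.predAbove b) (i.predAbove c) (by simp) (by simp))]
  have e1 := cls_swap k d U V (chord (i.predAbove c) (i.predAbove b)) (ast (i.predAbove b))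
  have e2 := cls_reverse k d (U ++ [ast (i.predAbove b)]) V (i.predAbove c) (i.predAbove b)
  simp only [List.append_assoc, List.cons_append, List.nil_append] at e1 e2 ⊢
  rw [e1, e2]
  have hca' : i.predAbove c ≠ i.predAbove a := by rw [h]; exact hbc'.symm
  rw [smul_zero, add_zero, smul_smul, smul_smul]
  have hs : (((d : ℤ) - 1) * ((d : ℤ) - 1)).negOnePow * (d : ℤ).negOnePow = -1 := by
    rw [Int.negOnePow_mul_self, Int.negOnePow_sub]
    simp [Int.units_mul_self]
  have hp : [glueSign d i (chord c a), glueSign d i (chord a b)].prod =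
      [glueSign d i (chord a b), glueSign d i (chord b c)].prod := by
    simp [glueSign_of_ne d i _ _ hca', glueSign_of_ne d i _ _ hbc']
  rw [hp]
  simp only [Letter.deg]
  rw [mul_assoc _ _ (d : ℤ).negOnePow, hs, mul_neg_one, Units.neg_smul, add_neg_cancel]

theorem glue_arnold {n : ℕ} (i : Fin n) (u v : Word (n + 1)) (a b c : Fin (n + 1))
    (hab : a ≠ b) (hbc : b ≠ c) (hca : c ≠ a) :
    (relations k d).mkQ (glue k d i (u ++ [chord a b, chord b c] ++ v))
      + (relations k d).mkQ (glue k d i (u ++ [chord b c, chord c a] ++ v))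
      + (relations k d).mkQ (glue k d i (u ++ [chord c a, chord a b] ++ v)) = 0 := by
  by_cases h1 : i.predAbove a = i.predAbove b
  · exact glue_arnold_aux k d i u v a b c hab hbc hca h1
  by_cases h2 : i.predAbove b = i.predAbove c
  · rw [← glue_arnold_aux k d i u v b c a hbc hca hab h2]
    abel
  by_cases h3 : i.predAbove c = i.predAbove a
  · rw [← glue_arnold_aux k d i u v c a b hca hab hbc h3]
    abel
  obtain ⟨U, V, s, ε, H⟩ := exists_glue_append k d i u v
  rw [H _ (by simp), H _ (by simp), H _ (by simp)]
  simp only [List.map_cons, List.map_nil, Word.deg, Letter.deg, glueLetter, h1, h2, h3, if_false,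
    glueSign_of_ne d i _ _ h1, glueSign_of_ne d i _ _ h2, glueSign_of_ne d i _ _ h3]
  rw [← smul_add, ← smul_add, cls_arnold k d U V _ _ _ h1 h2 h3, smul_zero]

theorem boundaryFree_ofWord {n : ℕ} {w : Word n} (h : IsDiagram w) :
    boundaryFree k d (ofWord k w) = boundaryWord k d w := by
  simp [ofWord, h, boundaryFree]

theorem boundaryFree_relations :
    relations k d ≤ (relations k d).comap (boundaryFree k d) := by
  refine Submodule.span_le.2 ?_
  rintro x ⟨n, hx⟩
  refine (Submodule.Quotient.mk_eq_zero (relations k d) (x := boundaryFree k d x)).1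
    (map_relation_eq_zero k d ((relations k d).mkQ ∘ₗ boundaryFree k d)
    (fun w => (relations k d).mkQ (boundaryWord k d w)) (fun w hw => ?_) (fun u v a b h => ?_)
    (fun u v a b h => ?_) (fun u v a b c h1 h2 h3 => ?_) hx)
  · simp [boundaryFree_ofWord k d hw]
  · cases n with
    | zero => simp [boundaryWord]
    | succ n =>
      simp only [boundaryWord, map_sum, Finset.smul_sum]
      exact Finset.sum_congr rfl fun i _ => glue_swap k d i u v a b h
  · cases n with
    | zero => simp [boundaryWord]
    | succ n =>
      simp only [boundaryWord, map_sum, Finset.smul_sum]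
      exact Finset.sum_congr rfl fun i _ => glue_reverse k d i u v a b h
  · cases n with
    | zero => simp [boundaryWord]
    | succ n =>
      simp only [boundaryWord, map_sum, ← Finset.sum_add_distrib]
      exact Finset.sum_eq_zero fun i _ => glue_arnold k d i u v a b c h1 h2 h3

theorem dividedFree_single {ℓ : ℕ} (D : Fin ℓ → Diagram) :
    dividedFree k ℓ (fun i => Finsupp.single (D i) 1) = dividedWord k fun i => (D i).word := by
  classical
  simp only [dividedFree, LinearMap.compMultilinearMap_apply, LinearMap.comp_apply,
    LinearEquiv.coe_coe]
  rw [PiTensorProduct.ofFinsuppEquiv'_tprod_single]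
  simp

theorem dividedFree_ofWord {ℓ : ℕ} {n : Fin ℓ → ℕ} (w : ∀ i, Word (n i))
    (h : ∀ i, IsDiagram (w i)) : dividedFree k ℓ (fun i => ofWord k (w i)) = dividedWord k w := by
  have := dividedFree_single k fun i => (⟨n i, w i, h i⟩ : Diagram)
  simpa [ofWord, h] using this

theorem exists_flatten_update {β : Type*} {ℓ : ℕ} {A : Fin ℓ → Type*} (h : ∀ j, A j → List β)
    (w : ∀ j, A j) (i : Fin ℓ) : ∃ U V : List β, ∀ x,
      (List.ofFn fun j => h j (Function.update w i x j)).flatten = U ++ h i x ++ V := by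
  induction ℓ with
  | zero => exact i.elim0
  | succ ℓ ih =>
    refine Fin.cases ?_ (fun i => ?_) i
    · refine ⟨[], (List.ofFn fun j : Fin ℓ => h j.succ (w j.succ)).flatten, fun x => ?_⟩
      simp [List.ofFn_succ]
    · obtain ⟨U, V, H⟩ := ih (fun j => h j.succ) (fun j => w j.succ) i
      refine ⟨h 0 (w 0) ++ U, V, fun x => ?_⟩
      rw [List.ofFn_succ, List.flatten_cons, List.append_assoc, List.append_assoc,
        ← List.append_assoc U, ← H x, Function.update_of_ne (Fin.succ_ne_zero i).symm]
      congr 2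
      refine congrArg _ (funext fun j => ?_)
      congr 1
      by_cases hj : j = i
      · subst hj
        simp
      · rw [Function.update_of_ne hj, Function.update_of_ne (by simpa using hj)]

theorem exists_shuffle_append {ℓ : ℕ} {n : Fin ℓ → ℕ} (w : ∀ i, Word (n i)) (i : Fin ℓ)
    (u v : Word (n i)) (e : (Σ i, Fin (n i)) ≃ Fin (∑ i, n i)) :
    ∃ U V : Word (∑ i, n i), ∀ m : Word (n i),
      shuffleWord (Function.update w i (u ++ m ++ v)) e =
        U ++ m.map (Letter.map fun a => e ⟨i, a⟩) ++ V := by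
  obtain ⟨U, V, H⟩ := exists_flatten_update
    (fun j (x : Word (n j)) => x.map (Letter.map fun a => e ⟨j, a⟩)) w i
  refine ⟨U ++ u.map (Letter.map fun a => e ⟨i, a⟩), v.map (Letter.map fun a => e ⟨i, a⟩) ++ V,
    fun m => ?_⟩
  rw [shuffleWord, H]
  simp

theorem deg_map {α β : Type} (f : α → β) (l : Letter α) : (l.map f).deg d = l.deg d := by
  cases l <;> rfl

theorem injective_shuffle {ℓ : ℕ} {n : Fin ℓ → ℕ} (e : (Σ i, Fin (n i)) ≃ Fin (∑ i, n i))
    (i : Fin ℓ) : Function.Injective fun a => e ⟨i, a⟩ := fun a b h => by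
  simpa using e.injective h

theorem dividedFree_relation {ℓ : ℕ} {n : Fin ℓ → ℕ} (w : ∀ i, Word (n i)) (i : Fin ℓ)
    {r : Free k} (hr : Relation k d (n i) r) :
    (relations k d).mkQ
      (dividedFree k ℓ (Function.update (fun j => ofWord k (w j)) i r)) = 0 := by
  classical
  by_cases hw : ∀ j, j ≠ i → IsDiagram (w j)
  swap
  · push Not at hw
    obtain ⟨j, hj, hjw⟩ := hw
    rw [(dividedFree k ℓ).map_coord_zero j, map_zero]
    rw [Function.update_of_ne hj, ofWord_of_not k hjw]
  refine map_relation_eq_zero k d ((relations k d).mkQ ∘ₗ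
    (dividedFree k ℓ).toLinearMap (fun j => ofWord k (w j)) i)
    (fun x => (relations k d).mkQ (dividedWord k (Function.update w i x)))
    (fun x hx => ?_) (fun u v a b _ => ?_) (fun u v a b h => ?_) (fun u v a b c h1 h2 h3 => ?_) hr
  · have harg : (Function.update (fun j => ofWord k (w j)) i (ofWord k x) : Fin ℓ → Free k) =
        fun j => ofWord k (Function.update w i x j) := by
      funext j
      by_cases hj : j = i
      · subst hj
        simp
      · simp [hj]
    rw [LinearMap.comp_apply, MultilinearMap.toLinearMap_apply, harg, dividedFree_ofWord]
    · intro j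
      by_cases hj : j = i
      · subst hj
        simpa using hx
      · simpa [hj] using hw j hj
  · simp only [dividedWord, map_sum, Finset.smul_sum]
    refine Finset.sum_congr rfl fun e _ => ?_
    obtain ⟨U, V, H⟩ := exists_shuffle_append w i u v e
    rw [H, H]
    exact (cls_swap k d U V _ _).trans (by rw [deg_map, deg_map]; rfl)
  · simp only [dividedWord, map_sum, Finset.smul_sum]
    refine Finset.sum_congr rfl fun e _ => ?_
    obtain ⟨U, V, H⟩ := exists_shuffle_append w i u v e
    rw [H, H]
    exact cls_reverse k d U V _ _
  · simp only [dividedWord, map_sum, ← Finset.sum_add_distrib]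
    refine Finset.sum_eq_zero fun e _ => ?_
    obtain ⟨U, V, H⟩ := exists_shuffle_append w i u v e
    have hi := injective_shuffle e i
    rw [H, H, H]
    exact cls_arnold k d U V _ _ _ (hi.ne h1) (hi.ne h2) (hi.ne h3)

theorem exists_words {ℓ : ℕ} (D : Fin ℓ → Diagram) (i : Fin ℓ) (m : ℕ) :
    ∃ (n : Fin ℓ → ℕ) (w : ∀ j, Word (n j)), n i = m ∧
      ∀ j, j ≠ i → ofWord k (w j) = Finsupp.single (D j) 1 := by
  let E : Fin ℓ → Σ n, Word n := Function.update (fun j => ⟨(D j).n, (D j).word⟩) i ⟨m, []⟩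
  refine ⟨fun j => (E j).1, fun j => (E j).2, by simp [E], fun j hj => ?_⟩
  have : E j = ⟨(D j).n, (D j).word⟩ := by simp [E, hj]
  change ofWord k (E j).2 = _
  rw [this]
  exact ofWord_diagram k (D j)

/-- A multilinear map on a free module vanishes when its `i`-th argument is `r` as soon as
it does so when the other arguments are basis vectors. -/
theorem multilinear_update_eq_zero {ι X M : Type*} [Finite ι] [DecidableEq ι] [Nonempty X]
    [AddCommGroup M] [Module k M] (g : MultilinearMap k (fun _ : ι => X →₀ k) M) (i : ι)
    (r : X →₀ k)
    (h : ∀ p : ι → X, g (Function.update (fun j => Finsupp.single (p j) 1) i r) = 0)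
    (x : ι → X →₀ k) : g (Function.update x i r) = 0 := by
  classical
  let φ : ι → (X →₀ k) →ₗ[k] (X →₀ k) :=
    Function.update (fun _ => LinearMap.id) i (Finsupp.linearCombination k fun _ => r)
  have hφ : g.compLinearMap φ = 0 := by
    refine Module.Basis.ext_multilinear (fun _ => Finsupp.basisSingleOne) fun p => ?_
    rw [MultilinearMap.compLinearMap_apply, zero_apply, ← h p]
    congr 1
    funext j
    by_cases hj : j = i
    · subst hj
      simp [φ]
    · simp [φ, hj]
  obtain ⟨y⟩ := ‹Nonempty X›
  have := congrArg (fun f => f (Function.update x i (Finsupp.single y 1))) hφ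
  simp only [MultilinearMap.compLinearMap_apply, zero_apply] at this
  rw [← this]
  congr 1
  funext j
  by_cases hj : j = i
  · subst hj
    simp [φ]
  · simp [φ, hj]

theorem isDiagram_nil : IsDiagram ([] : Word 0) where
  pt_mem a := a.elim0
  nodup := List.nodup_nil
  chord_ne a := a.elim0
  chord_simple a := a.elim0
  touched a := a.elim0
  forest := SimpleGraph.IsAcyclic.of_subsingleton

instance : Nonempty Diagram := ⟨⟨0, [], isDiagram_nil⟩⟩

theorem dividedFree_relations {ℓ : ℕ} (x : Fin ℓ → Free k) (i : Fin ℓ) (r : Free k)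
    (hr : r ∈ relations k d) : dividedFree k ℓ (Function.update x i r) ∈ relations k d := by
  have : relations k d ≤ LinearMap.ker ((relations k d).mkQ ∘ₗ
      (dividedFree k ℓ).toLinearMap x i) := by
    refine Submodule.span_le.2 ?_
    rintro r ⟨m, hr⟩
    rw [SetLike.mem_coe, LinearMap.mem_ker, LinearMap.comp_apply,
      MultilinearMap.toLinearMap_apply]
    refine multilinear_update_eq_zero k ((relations k d).mkQ.compMultilinearMap (dividedFree k ℓ))
      i r (fun p => ?_) x
    obtain ⟨n, w, rfl, hw⟩ := exists_words k p i m
    have harg : (Function.update (fun j => Finsupp.single (p j) 1) i r : Fin ℓ → Free k) =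
        Function.update (fun j => ofWord k (w j)) i r := by
      funext j
      by_cases hj : j = i
      · subst hj
        simp
      · simp [hj, hw j hj]
    rw [harg, LinearMap.compMultilinearMap_apply]
    exact dividedFree_relation k d w i hr
  simpa using this hr

end Descent

section Quotient

variable {k : Type*} [CommRing k] {ι M N : Type*} [Finite ι] [DecidableEq ι]
  [AddCommGroup M] [Module k M] [AddCommGroup N] [Module k N]

theorem multilinear_congr (P : Submodule k M) (Q : Submodule k N)
    (m : MultilinearMap k (fun _ : ι => M) N)
    (h : ∀ x i, ∀ r ∈ P, m (Function.update x i r) ∈ Q) {x y : ι → M}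
    (hxy : ∀ i, P.mkQ (x i) = P.mkQ (y i)) : Q.mkQ (m x) = Q.mkQ (m y) := by
  classical
  have := Fintype.ofFinite ι
  have key : ∀ s : Finset ι, Q.mkQ (m (s.piecewise x y)) = Q.mkQ (m y) := by
    intro s
    induction s using Finset.induction_on with
    | empty => simp
    | insert j s hj ih =>
      rw [Finset.piecewise_insert, ← ih, ← sub_eq_zero, ← map_sub]
      have hz : s.piecewise x y = Function.update (s.piecewise x y) j (y j) := by
        simp [hj]
      conv_lhs => rw [hz, Function.update_idem]
      rw [← MultilinearMap.map_update_sub]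
      refine (Submodule.Quotient.mk_eq_zero _).2 (h _ _ _ ?_)
      exact (Submodule.Quotient.eq P).1 (hxy j)
  simpa using key Finset.univ

/-- The multilinear map induced on the quotients by a multilinear map preserving the submodules. -/
def multilinearMapQ (P : Submodule k M) (Q : Submodule k N)
    (m : MultilinearMap k (fun _ : ι => M) N)
    (h : ∀ x i, ∀ r ∈ P, m (Function.update x i r) ∈ Q) :
    MultilinearMap k (fun _ : ι => M ⧸ P) (N ⧸ Q) :=
  MultilinearMap.mk' (fun x => Q.mkQ (m fun i => Function.surjInv P.mkQ_surjective (x i)))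
    (fun x i a b => by
      have e : ∀ c, Q.mkQ (m fun j => Function.surjInv P.mkQ_surjective (Function.update x i c j)) =
          Q.mkQ (m (Function.update (fun j => Function.surjInv P.mkQ_surjective (x j)) i
            (Function.surjInv P.mkQ_surjective c))) := by
        intro c
        congr 2
        funext j
        by_cases hj : j = i
        · subst hj
          simp
        · simp [hj]
      rw [e, e, e, ← map_add, ← MultilinearMap.map_update_add]
      refine multilinear_congr P Q m h fun j => ?_
      by_cases hj : j = i
      · subst hj
        simp only [Function.update_self, map_add]
        simp only [Function.surjInv_eq]
      · simp [hj])
    (fun x i c a => by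
      have e : ∀ c, Q.mkQ (m fun j => Function.surjInv P.mkQ_surjective (Function.update x i c j)) =
          Q.mkQ (m (Function.update (fun j => Function.surjInv P.mkQ_surjective (x j)) i
            (Function.surjInv P.mkQ_surjective c))) := by
        intro c
        congr 2
        funext j
        by_cases hj : j = i
        · subst hj
          simp
        · simp [hj]
      rw [e, e, ← map_smul, ← MultilinearMap.map_update_smul]
      refine multilinear_congr P Q m h fun j => ?_
      by_cases hj : j = i
      · subst hj
        simp only [Function.update_self, map_smul]
        simp only [Function.surjInv_eq]
      · simp [hj])

/-- The defining property of the induced multilinear map. -/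
theorem multilinearMapQ_mkQ (P : Submodule k M) (Q : Submodule k N)
    (m : MultilinearMap k (fun _ : ι => M) N)
    (h : ∀ x i, ∀ r ∈ P, m (Function.update x i r) ∈ Q) (x : ι → M) :
    multilinearMapQ P Q m h (fun i => P.mkQ (x i)) = Q.mkQ (m x) :=
  multilinear_congr P Q m h fun _ => Function.surjInv_eq P.mkQ_surjective _

end Quotient

/-! ### The complex `T_*` -/

section TStar

variable (k : Type*) [CommRing k] (d : ℕ)

/-- The differential of `T_*`: the sum over all gluings of neighbour active points. -/
def TStar.boundary : TStar k d →ₗ[k] TStar k d :=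
  (relations k d).mapQ (relations k d) (boundaryFree k d) (boundaryFree_relations k d)

/-- The divided product `⟨x_1, ..., x_ℓ⟩` on `T_*`. -/
def TStar.dividedProduct (ℓ : ℕ) : MultilinearMap k (fun _ : Fin ℓ => TStar k d) (TStar k d) :=
  multilinearMapQ (relations k d) (relations k d) (dividedFree k ℓ) (dividedFree_relations k d)

/-- The divided power `x^{⟨ℓ⟩} = ⟨x, ..., x⟩` on `T_*`. -/
def TStar.dividedPower (ℓ : ℕ) (x : TStar k d) : TStar k d :=
  TStar.dividedProduct k d ℓ fun _ => x

/-- The elements of `T_*` which are homogeneous of degree `q`. -/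
def TStar.degreePart (q : ℤ) : Submodule k (TStar k d) :=
  Submodule.span k {x | ∃ D : Diagram, D.deg d = q ∧ x = TStar.ofDiagram k d D}

/-- The sums of homogeneous elements of `T_*` of even degrees. -/
def TStar.evenPart : Submodule k (TStar k d) :=
  ⨆ q : {q : ℤ // Even q}, TStar.degreePart k d q

/-- The submodule of `T_*` spanned by the diagrams having at least one asterisk. -/
def asteriskPart : Submodule k (TStar k d) :=
  Submodule.span k {x | ∃ D : Diagram, D.HasAsterisk ∧ x = TStar.ofDiagram k d D}

theorem cls_mem_asteriskPart {n : ℕ} (w : Word n) (a : Fin n) (ha : ast a ∈ w) :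
    cls k d w ∈ asteriskPart k d := by
  by_cases h : IsDiagram w
  · refine Submodule.subset_span ⟨⟨n, w, h⟩, ⟨a, ha⟩, ?_⟩
    simp [cls, TStar.ofDiagram, ofWord, h]
  · rw [cls_of_not k d h]
    exact zero_mem _

theorem boundary_asteriskPart :
    asteriskPart k d ≤ (asteriskPart k d).comap (TStar.boundary k d) := by
  refine Submodule.span_le.2 ?_
  rintro x ⟨⟨n, w, hw⟩, ⟨a, ha⟩, rfl⟩
  have : TStar.boundary k d (TStar.ofDiagram k d ⟨n, w, hw⟩) =
      (relations k d).mkQ (boundaryWord k d w) := by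
    simp [TStar.boundary, TStar.ofDiagram, boundaryFree]
  rw [SetLike.mem_coe, Submodule.mem_comap, this]
  cases n with
  | zero => exact a.elim0
  | succ n =>
    rw [boundaryWord, map_sum]
    refine sum_mem fun i _ => ?_
    rw [glue, map_sign_smul, Units.smul_def]
    refine zsmul_mem (cls_mem_asteriskPart k d _ (i.predAbove a) ?_) _
    refine List.mem_map.2 ⟨ast a, ?_, rfl⟩
    simp only [removePt, List.mem_filter]
    exact ⟨ha, by simp⟩

theorem dividedProduct_asteriskPart {ℓ : ℕ} (x : Fin ℓ → TStar k d) (i : Fin ℓ) (r : TStar k d)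
    (hr : r ∈ asteriskPart k d) :
    TStar.dividedProduct k d ℓ (Function.update x i r) ∈ asteriskPart k d := by
  have : asteriskPart k d ≤
      (asteriskPart k d).comap ((TStar.dividedProduct k d ℓ).toLinearMap x i) := by
    refine Submodule.span_le.2 ?_
    rintro r ⟨D, ⟨a, ha⟩, rfl⟩
    rw [SetLike.mem_coe, Submodule.mem_comap, MultilinearMap.toLinearMap_apply]
    choose y hy using fun j => (relations k d).mkQ_surjective (x j)
    have harg : Function.update x i (TStar.ofDiagram k d D) = fun j => (relations k d).mkQ
        ((Function.update y i (Finsupp.single D 1) : Fin ℓ → Free k) j) := by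
      funext j
      by_cases hj : j = i
      · subst hj
        simp [TStar.ofDiagram]
      · rw [Function.update_of_ne hj, Function.update_of_ne hj, hy]
    rw [harg, TStar.dividedProduct, multilinearMapQ_mkQ]
    refine (Submodule.Quotient.mk_eq_zero _).1 (multilinear_update_eq_zero k
      ((asteriskPart k d).mkQ.compMultilinearMap
        ((relations k d).mkQ.compMultilinearMap (dividedFree k ℓ)))
      i (Finsupp.single D 1) (fun p => ?_) y)
    have hp : (Function.update (fun j => Finsupp.single (p j) 1) i (Finsupp.single D 1) :
        Fin ℓ → Free k) = fun j => Finsupp.single (Function.update p i D j) 1 := by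
      funext j
      by_cases hj : j = i
      · subst hj
        simp
      · simp [hj]
    rw [hp, LinearMap.compMultilinearMap_apply, LinearMap.compMultilinearMap_apply,
      dividedFree_single, dividedWord, map_sum]
    refine (Submodule.Quotient.mk_eq_zero _).2 (sum_mem fun e _ => ?_)
    have hq : ∃ b, ast b ∈ (Function.update p i D i).word := by
      rw [Function.update_self]
      exact ⟨a, ha⟩
    obtain ⟨b, hb⟩ := hq
    refine cls_mem_asteriskPart k d _ (e ⟨i, b⟩) ?_
    rw [shuffleWord, List.mem_flatten]
    exact ⟨_, (List.mem_ofFn' _ _).2 ⟨i, rfl⟩, List.mem_map.2 ⟨_, hb, rfl⟩⟩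
  exact this hr

end TStar

/-! ### The complex `T` -/

section T

variable (k : Type*) [CommRing k] (d : ℕ)

/-- The space of the complex `T`: the quotient of `T_*` by all diagrams having an asterisk. -/
abbrev T : Type _ := TStar k d ⧸ asteriskPart k d

instance : AddCommGroup (T k d) := Submodule.Quotient.addCommGroup _

instance : Module k (T k d) := Submodule.Quotient.module _

/-- The differential of `T`. -/
def T.boundary : T k d →ₗ[k] T k d :=
  (asteriskPart k d).mapQ (asteriskPart k d) (TStar.boundary k d) (boundary_asteriskPart k d)

/-- The divided product `⟨x_1, ..., x_ℓ⟩` on `T`. -/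
def T.dividedProduct (ℓ : ℕ) :
    MultilinearMap k (fun _ : Fin ℓ => T k d) (T k d) :=
  multilinearMapQ (asteriskPart k d) (asteriskPart k d) (TStar.dividedProduct k d ℓ)
    (dividedProduct_asteriskPart k d)

/-- The divided power `x^{⟨ℓ⟩} = ⟨x, ..., x⟩` on `T`. -/
def T.dividedPower (ℓ : ℕ) (x : T k d) : T k d := T.dividedProduct k d ℓ fun _ => x

/-- The elements of `T` which are homogeneous of degree `q`. -/
def T.degreePart (q : ℤ) : Submodule k (T k d) :=
  (TStar.degreePart k d q).map (asteriskPart k d).mkQ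

/-- The sums of homogeneous elements of `T` of even degrees. -/
def T.evenPart : Submodule k (T k d) :=
  ⨆ q : {q : ℤ // Even q}, T.degreePart k d q

end T

/-! ### Operations on homology -/

section Homology

variable {k M : Type*} [CommRing k] [AddCommGroup M] [Module k M]

/-- The homology of a differential `δ`: cycles modulo boundaries. -/
abbrev Homology (δ : M →ₗ[k] M) : Type _ :=
  LinearMap.ker δ ⧸ (LinearMap.range δ).comap (LinearMap.ker δ).subtype

/-- The homology class of a cycle. -/
def homologyClass (δ : M →ₗ[k] M) (x : M) (hx : δ x = 0) : Homology δ :=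
  Submodule.Quotient.mk ⟨x, hx⟩

/-- The homology classes represented by cycles which lie in the submodule `S`. -/
def homologyPart (δ : M →ₗ[k] M) (S : Submodule k M) : Set (Homology δ) :=
  {c | ∃ x, ∃ hx : δ x = 0, x ∈ S ∧ c = homologyClass δ x hx}

/-- The map `φ : S → S'` of chains descends to an operation on homology: it maps cycles to cycles,
and there is a well-defined map of homology `[x] ↦ [φ x]`. -/
def DescendsToHomology (δ : M →ₗ[k] M) (φ : M → M) (S S' : Submodule k M) : Prop :=
  ∃ Φ : homologyPart δ S → homologyPart δ S', ∀ (x : M) (hS : x ∈ S) (hx : δ x = 0),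
    ∃ (_ : φ x ∈ S') (hx' : δ (φ x) = 0),
      (Φ ⟨homologyClass δ x hx, x, hx, hS, rfl⟩ : Homology δ) = homologyClass δ (φ x) hx'

end Homology

end KnotDiagram

end

/-! Three bilinear operations on `T_*` carry the proof. The half shuffle product x ≺ y
(`TStar.half`) is the sum over the shuffles whose left-most point is that of x. The product x ∘ y
(`TStar.join`) sums over the shuffles in which the two left-most points come first and glues these
two points. The product x ∗ y (`TStar.joinHalf`) keeps those terms of x ∘ y in which the point
following the joined one is the second point of x.

The order condition on left-most points means that x^⟨ℓ+1⟩ = x ≺ x^⟨ℓ⟩ (`dividedPower_succ`). In the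
differential of x ≺ y, gluings of points of different factors cancel in pairs, except for the gluing
of the two left-most points, whose opposite order does not occur: ∂(x ≺ y) = ∂x ≺ y + (-1)^|x| x ≺
∂y + x ∘ y (`boundary_half`). Moreover x ∘ (y ≺ z) = (x ∘ y) ≺ z (`join_half`), and x ∘ x = 0 if x
is even or 2 = 0 (`join_self`). Hence x ∘ x^⟨ℓ⟩ = 0, and the divided powers of such a cycle x are
cycles.

Now replace x by x + ∂y with y odd. Put w_0 = y and w_{m+1} = y ∗ w_m. If y is a multiple of one
diagram, then ∂w_{m+1} = w_m ∘ ∂y (`boundary_iterJoinHalf`). With Γ_l = (x + ∂y)^⟨l⟩, the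
alternating sums H_m^{l+1} = w_m ≺ Γ_l − w_{m+1} ≺ Γ_{l-1} + … telescope to ∂H_m^{l+1} = ∂w_m ≺ Γ_l
− x ∘ H_m^l, and the recursion K_{l+1} = x ≺ K_l + H_0^{l+1} gives ∂K_l = Γ_l − x^⟨l⟩
(`boundary_homotopy`). A general y is added one diagram at a time.

Three reductions remain. The trivial diagram is a left unit of ≺, so a multiple of it is split off
by a binomial expansion (`dividedPower_trivial_add`). A chain bounding an even cycle may be replaced
by its odd part (`exists_odd_boundary`). The complexes `T_*` and `T` are treated together by
computing modulo a submodule stable under ≺, namely 0 or the span of the diagrams with asterisks.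

The identities are verified on diagrams whose points are disjoint blocks of labels and whose edges
join labels, an edge inside one block being an asterisk. Gluing is then the union of neighbouring
blocks and leaves the edges alone, so the differential becomes the bar differential of lists in a
semilattice (`boundary_blockCls`). Writing the points in their order turns the concatenation of
monomials into signed shuffles (`sum_shuffles`), and the identities reduce to `sh_assoc`, `hs_hs`
and `hs_bd`. In a self-product the second factor is a relabelled copy; exchanging the two sets of
labels pairs terms of opposite signs (`sh_copy_eq_zero`), and if no points are left to shuffle, all
edges are doubled and the diagram vanishes (`blockCls_double`). No division by 2 occurs, which is
why every ring `k` is allowed. -/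

noncomputable section

namespace KnotDiagram

open Letter

/-! ### Signed shuffles of lists -/

section Shuffles

variable {α β M N : Type*} [AddCommGroup M] [AddCommGroup N]

/-- All shuffles of two lists. -/
def shuffles : List α → List α → List (List α)
  | [], w => [w]
  | a :: u, [] => [a :: u]
  | a :: u, b :: w => (shuffles u (b :: w)).map (a :: ·) ++ (shuffles (a :: u) w).map (b :: ·)
termination_by u w => u.length + w.length

/-- The sum of a function over the shuffles of two lists, with the signs of the shuffles. -/
def sh : List α → List α → (List α → M) → M
  | [], w, φ => φ w
  | a :: u, [], φ => φ (a :: u)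
  | a :: u, b :: w, φ => sh u (b :: w) (fun L => φ (a :: L)) +
      (-1 : ℤ) ^ (u.length + 1) • sh (a :: u) w (fun L => φ (b :: L))
termination_by u w => u.length + w.length

/-- The shuffles of two lists starting with the head of the first one. -/
def halfShuffles : List α → List α → List (List α)
  | [], w => [w]
  | a :: u, w => (shuffles u w).map (a :: ·)

/-- The signed sum over the shuffles of two lists starting with the head of the first one. -/
def hs : List α → List α → (List α → M) → M
  | [], w, φ => φ w
  | a :: u, w, φ => sh u w (fun L => φ (a :: L))

@[simp] theorem shuffles_nil_left (w : List α) : shuffles [] w = [w] := by simp [shuffles]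

@[simp] theorem shuffles_nil_right (u : List α) : shuffles u [] = [u] := by
  cases u <;> simp [shuffles]

theorem shuffles_cons_cons (a b : α) (u w : List α) : shuffles (a :: u) (b :: w) =
    (shuffles u (b :: w)).map (a :: ·) ++ (shuffles (a :: u) w).map (b :: ·) := by
  rw [shuffles]

@[simp] theorem sh_nil_left (w : List α) (φ : List α → M) : sh [] w φ = φ w := by simp [sh]

@[simp] theorem sh_nil_right (u : List α) (φ : List α → M) : sh u [] φ = φ u := by
  cases u <;> simp [sh]

theorem sh_cons_cons (a b : α) (u w : List α) (φ : List α → M) : sh (a :: u) (b :: w) φ =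
    sh u (b :: w) (fun L => φ (a :: L)) +
      (-1 : ℤ) ^ (u.length + 1) • sh (a :: u) w (fun L => φ (b :: L)) := by
  rw [sh]

/-- Induction over pairs of lists. -/
theorem shuffle_induction {p : List α → List α → Prop} (left : ∀ w, p [] w) (right : ∀ u, p u [])
    (cons : ∀ a b u w, p u (b :: w) → p (a :: u) w → p (a :: u) (b :: w)) : ∀ u w, p u w
  | [], w => left w
  | a :: u, [] => right _
  | a :: u, b :: w => cons a b u w (shuffle_induction left right cons u (b :: w))
      (shuffle_induction left right cons (a :: u) w)
termination_by u w => u.length + w.length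

theorem perm_of_mem_shuffles {u w L : List α} (h : L ∈ shuffles u w) : L.Perm (u ++ w) := by
  induction u, w using shuffle_induction generalizing L with
  | left w => simp_all
  | right u => simp_all
  | cons a b u w h1 h2 =>
    rw [shuffles_cons_cons, List.mem_append, List.mem_map, List.mem_map] at h
    obtain ⟨L, h, rfl⟩ | ⟨L, h, rfl⟩ := h
    · exact (h1 h).cons a
    · exact ((h2 h).cons b).trans (List.perm_middle (l₁ := a :: u)).symm

theorem length_of_mem_shuffles {u w L : List α} (h : L ∈ shuffles u w) :
    L.length = u.length + w.length := by
  simpa using (perm_of_mem_shuffles h).length_eq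

theorem sublist_of_mem_shuffles {u w L : List α} (h : L ∈ shuffles u w) :
    u.Sublist L ∧ w.Sublist L := by
  induction u, w using shuffle_induction generalizing L with
  | left w => simp_all
  | right u => simp_all
  | cons a b u w h1 h2 =>
    rw [shuffles_cons_cons, List.mem_append, List.mem_map, List.mem_map] at h
    obtain ⟨L, h, rfl⟩ | ⟨L, h, rfl⟩ := h
    · exact ⟨(h1 h).1.cons_cons a, (h1 h).2.cons a⟩
    · exact ⟨(h2 h).1.cons b, (h2 h).2.cons_cons b⟩

/-- The first entry of `L` lies in `u` or in `w`; since that list is a sublist of `L` and entries do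
not repeat, it must start with this entry. Removing it leaves a smaller instance. -/
theorem mem_shuffles {u w L : List α} (hn : (u ++ w).Nodup) (hp : L.Perm (u ++ w))
    (hu : u.Sublist L) (hw : w.Sublist L) : L ∈ shuffles u w := by
  induction L generalizing u w with
  | nil =>
    obtain ⟨rfl, rfl⟩ := List.append_eq_nil_iff.1 (List.nil_perm.1 hp)
    simp
  | cons c L ih =>
    cases u with
    | nil =>
      rw [shuffles_nil_left, List.mem_singleton]
      exact (hw.eq_of_length (by simpa using hp.length_eq.symm)).symm
    | cons a u =>
      cases w with
      | nil =>
        rw [shuffles_nil_right, List.mem_singleton]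
        exact (hu.eq_of_length (by simpa using hp.length_eq.symm)).symm
      | cons b w =>
        rw [shuffles_cons_cons, List.mem_append, List.mem_map, List.mem_map]
        have hc : c ∈ (a :: u) ++ (b :: w) := hp.mem_iff.1 (by simp)
        have hL : (c :: L).Nodup := hp.nodup_iff.2 hn
        by_cases hca : c = a
        · subst hca
          left
          refine ⟨L, ih (List.Nodup.of_cons hn) (List.perm_cons c |>.1 hp) ?_ ?_, rfl⟩
          · simpa using hu
          · refine (List.sublist_cons_iff.1 hw).resolve_right ?_
            rintro ⟨r, h, -⟩
            obtain ⟨rfl, -⟩ := List.cons_eq_cons.1 h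
            simp at hn
        · right
          have hu' : (a :: u).Sublist L := (List.sublist_cons_iff.1 hu).resolve_right (by
            rintro ⟨r, h, -⟩
            exact hca (List.cons_eq_cons.1 h).1.symm)
          have hcb : c = b := by
            rcases List.sublist_cons_iff.1 hw with h | ⟨r, h, -⟩
            · exfalso
              have hcL : c ∉ L := (List.nodup_cons.1 hL).1
              rcases List.mem_append.1 hc with h' | h'
              · exact hcL (hu'.subset h')
              · exact hcL (h.subset h')
            · exact (List.cons_eq_cons.1 h).1.symm
          subst hcb
          refine ⟨L, ih ?_ ?_ hu' (by simpa using hw), rfl⟩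
          · exact hn.sublist ((List.sublist_cons_self c w).append_left (a :: u))
          · exact (List.perm_cons c).1 (hp.trans (List.perm_middle (l₁ := a :: u)))

theorem nodup_shuffles {u w : List α} (hn : (u ++ w).Nodup) : (shuffles u w).Nodup := by
  induction u, w using shuffle_induction with
  | left w => simp
  | right u => simp
  | cons a b u w h1 h2 =>
    rw [shuffles_cons_cons, List.nodup_append]
    refine ⟨(h1 (List.Nodup.of_cons hn)).map (List.cons_injective), (h2 ?_).map
      (List.cons_injective), ?_⟩
    · exact hn.sublist ((List.sublist_cons_self b w).append_left (a :: u))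
    · rintro x hx y hy rfl
      obtain ⟨L, -, rfl⟩ := List.mem_map.1 hx
      obtain ⟨L', -, h⟩ := List.mem_map.1 hy
      obtain ⟨rfl, -⟩ := List.cons_eq_cons.1 h
      simp at hn

theorem shuffles_map (f : α → β) (u w : List α) :
    shuffles (u.map f) (w.map f) = (shuffles u w).map (List.map f) := by
  induction u, w using shuffle_induction with
  | left w => simp
  | right u => simp
  | cons a b u w h1 h2 =>
    rw [List.map_cons, List.map_cons, shuffles_cons_cons, shuffles_cons_cons, ← List.map_cons,
      ← List.map_cons, h1, h2]
    simp [Function.comp_def]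

theorem halfShuffles_map (f : α → β) (u w : List α) :
    halfShuffles (u.map f) (w.map f) = (halfShuffles u w).map (List.map f) := by
  cases u <;> simp [halfShuffles, shuffles_map, Function.comp_def]

theorem perm_of_mem_halfShuffles {u w L : List α} (h : L ∈ halfShuffles u w) :
    L.Perm (u ++ w) := by
  cases u with
  | nil => simp_all [halfShuffles]
  | cons a u =>
    obtain ⟨L, h', rfl⟩ := List.mem_map.1 h
    exact (perm_of_mem_shuffles h').cons a

theorem sublist_of_mem_halfShuffles {u w L : List α} (h : L ∈ halfShuffles u w) :
    u.Sublist L ∧ w.Sublist L := by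
  cases u with
  | nil => simp_all [halfShuffles]
  | cons a u =>
    obtain ⟨L, h', rfl⟩ := List.mem_map.1 h
    exact ⟨(sublist_of_mem_shuffles h').1.cons_cons a, (sublist_of_mem_shuffles h').2.cons a⟩

theorem sh_congr {u w : List α} {φ ψ : List α → M} (h : ∀ L ∈ shuffles u w, φ L = ψ L) :
    sh u w φ = sh u w ψ := by
  induction u, w using shuffle_induction generalizing φ ψ with
  | left w => simp_all
  | right u => simp_all
  | cons a b u w h1 h2 =>
    rw [sh_cons_cons, sh_cons_cons, h1, h2]
    · intro L hL
      exact h _ (by simp [shuffles_cons_cons, hL])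
    · intro L hL
      exact h _ (by simp [shuffles_cons_cons, hL])

theorem hs_congr {u w : List α} {φ ψ : List α → M} (h : ∀ L ∈ halfShuffles u w, φ L = ψ L) :
    hs u w φ = hs u w ψ := by
  cases u with
  | nil => exact h _ (by simp [halfShuffles])
  | cons a u => exact sh_congr fun L hL => h _ (List.mem_map.2 ⟨L, hL, rfl⟩)

theorem map_sh (f : M →+ N) (u w : List α) (φ : List α → M) :
    f (sh u w φ) = sh u w fun L => f (φ L) := by
  induction u, w using shuffle_induction generalizing φ with
  | left w => simp
  | right u => simp
  | cons a b u w h1 h2 => rw [sh_cons_cons, sh_cons_cons, map_add, map_zsmul, h1, h2]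

theorem map_hs (f : M →+ N) (u w : List α) (φ : List α → M) :
    f (hs u w φ) = hs u w fun L => f (φ L) := by
  cases u with
  | nil => rfl
  | cons a u => exact map_sh f _ _ _

theorem sh_smul (c : ℤ) (u w : List α) (φ : List α → M) :
    sh u w (fun L => c • φ L) = c • sh u w φ :=
  (map_sh (zsmulAddGroupHom c) u w φ).symm

theorem hs_smul (c : ℤ) (u w : List α) (φ : List α → M) :
    hs u w (fun L => c • φ L) = c • hs u w φ :=
  (map_hs (zsmulAddGroupHom c) u w φ).symm

theorem sh_add (u w : List α) (φ ψ : List α → M) :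
    sh u w (fun L => φ L + ψ L) = sh u w φ + sh u w ψ := by
  induction u, w using shuffle_induction generalizing φ ψ with
  | left w => simp
  | right u => simp
  | cons a b u w h1 h2 =>
    rw [sh_cons_cons, sh_cons_cons, sh_cons_cons, h1, h2]
    module

theorem sh_neg (u w : List α) (φ : List α → M) : sh u w (fun L => -φ L) = -sh u w φ :=
  (map_sh (negAddMonoidHom) u w φ).symm

theorem sh_sub (u w : List α) (φ ψ : List α → M) :
    sh u w (fun L => φ L - ψ L) = sh u w φ - sh u w ψ := by
  simp only [sub_eq_add_neg, sh_add, sh_neg]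

theorem sh_map (f : α → β) (u w : List α) (φ : List β → M) :
    sh (u.map f) (w.map f) φ = sh u w fun L => φ (L.map f) := by
  induction u, w using shuffle_induction generalizing φ with
  | left w => simp
  | right u => simp
  | cons a b u w h1 h2 =>
    rw [List.map_cons, List.map_cons, sh_cons_cons, sh_cons_cons, ← List.map_cons,
      ← List.map_cons, h1, h2]
    simp

theorem hs_map (f : α → β) (u w : List α) (φ : List β → M) :
    hs (u.map f) (w.map f) φ = hs u w fun L => φ (L.map f) := by
  cases u with
  | nil => rfl
  | cons a u => exact sh_map f _ _ _

theorem neg_one_pow_eq {m n : ℕ} (h : m % 2 = n % 2) : (-1 : ℤ) ^ m = (-1) ^ n := by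
  rw [neg_one_pow_eq_pow_mod_two, h, ← neg_one_pow_eq_pow_mod_two]

theorem neg_one_pow_eq_neg {m n : ℕ} (h : m % 2 = (n + 1) % 2) : (-1 : ℤ) ^ m = -(-1) ^ n := by
  rw [neg_one_pow_eq h, pow_succ, mul_neg_one]

/-- Exchanging the lists interchanges the two terms of the recursion; the exponent is the number of
pairs of odd letters that pass each other. -/
theorem sh_comm (u w : List α) (φ : List α → M) :
    sh u w φ = (-1 : ℤ) ^ (u.length * w.length) • sh w u φ := by
  induction u, w using shuffle_induction generalizing φ with
  | left w => simp
  | right u => simp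
  | cons a b u w h1 h2 =>
    rw [sh_cons_cons, sh_cons_cons, h1, h2, add_comm, smul_add, smul_smul, smul_smul,
      ← pow_add, ← pow_add]
    simp only [List.length_cons]
    congr 2
    · refine neg_one_pow_eq ?_
      rw [Nat.mul_add, Nat.mul_one]
      omega
    · refine neg_one_pow_eq ?_
      have : (u.length + 1) * (w.length + 1) + (w.length + 1) =
        u.length * (w.length + 1) + 2 * (w.length + 1) := by ring
      omega

/-- A shuffle of nonempty lists starts with one of the two heads. The terms starting with the head
of `w` become a half shuffle after the lists are exchanged, which costs the sign of `sh_comm`. -/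
theorem sh_eq_hs_add_hs {u w : List α} (hu : u ≠ []) (hw : w ≠ []) (φ : List α → M) :
    sh u w φ = hs u w φ + (-1 : ℤ) ^ (u.length * w.length) • hs w u φ := by
  obtain ⟨a, u, rfl⟩ := List.exists_cons_of_ne_nil hu
  obtain ⟨b, w, rfl⟩ := List.exists_cons_of_ne_nil hw
  rw [sh_cons_cons, hs, hs, sh_comm (a :: u) w, smul_smul, ← pow_add]
  simp only [List.length_cons]
  congr 2
  refine neg_one_pow_eq ?_
  have : (u.length + 1) * (w.length + 1) = (u.length + 1) * w.length + (u.length + 1) := by ring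
  omega

/-- Both sides split according to which of `a`, `b`, `c` comes first, and the three parts agree by
induction. On the left the part starting with `c` arises in two pieces, one for each head of the
inner shuffle; expanding `i3` once collects them. -/
theorem sh_assoc (u v w : List α) (φ : List α → M) :
    sh u v (fun L => sh L w φ) = sh v w (fun L => sh u L φ) := by
  match u, v, w with
  | [], v, w => simp
  | u, [], w => simp
  | u, v, [] => simp
  | a :: u, b :: v, c :: w =>
    have e1 : ∀ L ∈ shuffles u (b :: v), sh (a :: L) (c :: w) φ =
        sh L (c :: w) (fun L => φ (a :: L)) + (-1 : ℤ) ^ (u.length + v.length + 2) •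
          sh (a :: L) w (fun L => φ (c :: L)) := fun L hL => by
      rw [sh_cons_cons, length_of_mem_shuffles hL]
      rfl
    have e2 : ∀ L ∈ shuffles (a :: u) v, sh (b :: L) (c :: w) φ =
        sh L (c :: w) (fun L => φ (b :: L)) + (-1 : ℤ) ^ (u.length + v.length + 2) •
          sh (b :: L) w (fun L => φ (c :: L)) := fun L hL => by
      rw [sh_cons_cons, length_of_mem_shuffles hL, List.length_cons]
      congr 3
      omega
    have i1 := sh_assoc u (b :: v) (c :: w) (fun L => φ (a :: L))
    have i2 := sh_assoc (a :: u) v (c :: w) (fun L => φ (b :: L))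
    have i3 := sh_assoc (a :: u) (b :: v) w (fun L => φ (c :: L))
    rw [sh_cons_cons] at i3
    rw [sh_cons_cons, sh_congr e1, sh_congr e2, sh_add, sh_add, sh_smul, sh_smul, i1, i2]
    conv_rhs =>
      rw [sh_cons_cons]
      simp only [sh_cons_cons a, sh_add, sh_smul]
    rw [← i3, sh_cons_cons b c v w]
    module
termination_by u.length + v.length + w.length

/-- The Zinbiel identity (u ≺ v) ≺ w = u ≺ (v ⧢ w): the head of `u` stays in front on both sides, so
this is associativity for the tail of `u`. -/
theorem hs_hs {u : List α} (hu : u ≠ []) (v w : List α) (φ : List α → M) :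
    hs u v (fun L => hs L w φ) = sh v w (fun L => hs u L φ) := by
  obtain ⟨a, u, rfl⟩ := List.exists_cons_of_ne_nil hu
  exact sh_assoc _ _ _ _

/-- The shuffles of a list with its copy cancel each other under an antisymmetric function. -/
theorem sh_copy_eq_zero (τ : α → α) (hτ : ∀ a, τ (τ a) = a) {u : List α} (hu : u ≠ [])
    (φ : List α → M) (hφ : ∀ L, φ (L.map τ) = -(-1 : ℤ) ^ u.length • φ L) :
    sh u (u.map τ) φ = 0 := by
  -- Since `τ` is an involution, it carries the shuffles starting in `u` to those starting in the
  -- copy.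
  have h1 : hs (u.map τ) u φ = -(-1 : ℤ) ^ u.length • hs u (u.map τ) φ := by
    have : hs (u.map τ) ((u.map τ).map τ) φ = hs u (u.map τ) fun L => φ (L.map τ) := hs_map τ _ _ _
    rw [List.map_map, show τ ∘ τ = id from funext hτ, List.map_id] at this
    rw [this]
    simp only [hφ, hs_smul]
  rw [sh_eq_hs_add_hs hu (by simpa using hu), h1, smul_smul, List.length_map]
  -- As n² + n is even, the two halves of the shuffle sum are opposite.
  have : (-1 : ℤ) ^ (u.length * u.length) * -(-1) ^ u.length = -1 := by
    rw [mul_neg, ← pow_add, Even.neg_one_pow]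
    have := Nat.even_mul_succ_self u.length
    rwa [Nat.mul_succ] at this
  rw [this]
  simp

end Shuffles

/-! ### The bar differential -/

section Bar

variable {R M N : Type*} [SemilatticeSup R] [AddCommGroup M] [AddCommGroup N]

/-- The bar differential: the alternating sum over all joins of neighbour entries. -/
def bd : List R → (List R → M) → M
  | [], _ => 0
  | [_], _ => 0
  | a :: b :: u, φ => φ ((a ⊔ b) :: u) - bd (b :: u) (fun L => φ (a :: L))

/-- Join an element with the head of a list. -/
def joinHead (a : R) : List R → (List R → M) → M
  | [], _ => 0
  | b :: u, φ => φ ((a ⊔ b) :: u)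

theorem bd_cons (a : R) (u : List R) (φ : List R → M) :
    bd (a :: u) φ = joinHead a u φ - bd u (fun L => φ (a :: L)) := by
  cases u <;> simp [bd, joinHead]

/-- Every term of `bd` is evaluated at a nonempty list that is one entry shorter. Keeping both facts
allows signs depending on the length to be pulled out, and `sh_eq_hs_add_hs` to be used under `bd`.
-/
theorem bd_congr {u : List R} {φ ψ : List R → M}
    (h : ∀ L, L.length + 1 = u.length → L ≠ [] → φ L = ψ L) : bd u φ = bd u ψ := by
  induction u generalizing φ ψ with
  | nil => rfl
  | cons a u ih =>
    rw [bd_cons, bd_cons, ih (φ := fun L => φ (a :: L)) (ψ := fun L => ψ (a :: L))]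
    · cases u with
      | nil => rfl
      | cons b u => rw [joinHead, joinHead, h _ (by simp) (by simp)]
    · intro L hL _
      exact h _ (by simpa using hL) (by simp)

theorem map_bd (f : M →+ N) (u : List R) (φ : List R → M) :
    f (bd u φ) = bd u fun L => f (φ L) := by
  induction u generalizing φ with
  | nil => exact map_zero f
  | cons a u ih =>
    rw [bd_cons, bd_cons, map_sub, ih]
    cases u <;> simp [joinHead]

theorem bd_smul (c : ℤ) (u : List R) (φ : List R → M) :
    bd u (fun L => c • φ L) = c • bd u φ :=
  (map_bd (zsmulAddGroupHom c) u φ).symm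

theorem bd_add (u : List R) (φ ψ : List R → M) :
    bd u (fun L => φ L + ψ L) = bd u φ + bd u ψ := by
  induction u generalizing φ ψ with
  | nil => simp [bd]
  | cons a u ih =>
    rw [bd_cons, bd_cons, bd_cons, ih]
    cases u
    · simp only [joinHead]
      abel
    · simp only [joinHead]
      abel

/-- The part of the differential of a half shuffle which joins the two heads. -/
def joinHeads : List R → List R → (List R → M) → M
  | a :: u, b :: w, φ => (-1 : ℤ) ^ u.length • sh u w (fun L => φ ((a ⊔ b) :: L))
  | _, _, _ => 0

/-- In a shuffle of `u` and `w`, the entry joined to `a` is the head of `u` or the head of `w`. The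
second case is the part that has no counterpart in the Leibniz rule. -/
theorem sh_joinHead (a : R) (u w : List R) (φ : List R → M) :
    sh u w (fun L => joinHead a L φ) =
      joinHead a u (fun v => hs v w φ) + joinHeads (a :: u) w φ := by
  cases u with
  | nil =>
    cases w <;> simp [joinHead, joinHeads]
  | cons b u =>
    cases w with
    | nil => simp [joinHead, joinHeads, hs]
    | cons c w =>
      rw [sh_cons_cons]
      simp [joinHead, joinHeads, hs]

/-- The derivation rule for the tail `u` is a hypothesis because this step is used inside the
induction that proves the rule, and again afterwards. -/
theorem hs_bd_of_sh_bd (a : R) (u w : List R) (φ : List R → M)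
    (h : ∀ ψ : List R → M, sh u w (fun L => bd L ψ) = bd u (fun v => sh v w ψ) +
      (-1 : ℤ) ^ u.length • bd w (fun v => sh u v ψ)) :
    hs (a :: u) w (fun L => bd L φ) = bd (a :: u) (fun v => hs v w φ) +
      (-1 : ℤ) ^ (u.length + 1) • bd w (fun v => hs (a :: u) v φ) + joinHeads (a :: u) w φ := by
  simp only [hs, bd_cons, sh_sub, h, sh_joinHead]
  module

/-- The bar differential is a derivation of the shuffle product. -/
theorem sh_bd (u w : List R) (φ : List R → M) :
    sh u w (fun L => bd L φ) = bd u (fun v => sh v w φ) +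
      (-1 : ℤ) ^ u.length • bd w (fun v => sh u v φ) := by
  induction u, w using shuffle_induction generalizing φ with
  | left w => simp [bd]
  | right u => simp [bd]
  | cons a b u w h1 h2 =>
    have g1 := hs_bd_of_sh_bd a u (b :: w) φ h1
    -- The half shuffle headed by `b` needs the derivation rule with the factors in the opposite
    -- order; it follows from `h2` by commutativity.
    have g2 := hs_bd_of_sh_bd b w (a :: u) φ (fun ψ => by
      rw [sh_comm]
      simp only [h2 ψ, sh_comm (a :: u)]
      have e1 : bd (a :: u) (fun v => sh v w ψ) =
          (-1 : ℤ) ^ (u.length * w.length) • bd (a :: u) fun v => sh w v ψ := by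
        rw [← bd_smul]
        refine bd_congr fun L hL _ => ?_
        rw [sh_comm]
        simp only [List.length_cons] at hL
        rw [show L.length = u.length by omega]
      have e2 : bd w (fun v => (-1 : ℤ) ^ ((a :: u).length * v.length) • sh v (a :: u) ψ) =
          (-1 : ℤ) ^ ((u.length + 1) * (w.length + 1)) • bd w fun v => sh v (a :: u) ψ := by
        rw [← bd_smul]
        refine bd_congr fun L hL _ => ?_
        congr 1
        refine neg_one_pow_eq ?_
        rw [← hL, List.length_cons]
        have : (u.length + 1) * (L.length + 1 + 1) = (u.length + 1) * L.length +
          2 * (u.length + 1) := by ring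
        omega
      rw [e1, e2, smul_add, smul_smul, smul_smul, smul_smul, ← pow_add, ← pow_add, ← pow_add,
        add_comm]
      simp only [List.length_cons]
      congr 1
      · rw [Even.neg_one_pow, one_smul]
        have : w.length * (u.length + 1) + (u.length + 1) + (u.length + 1) * (w.length + 1) =
          2 * ((w.length + 1) * (u.length + 1)) := by ring
        rw [this]
        exact even_two_mul _
      · congr 1
        refine neg_one_pow_eq ?_
        have : w.length * (u.length + 1) + u.length * w.length =
          2 * (w.length * u.length) + w.length := by ring
        omega)
    have hsplit := sh_eq_hs_add_hs (List.cons_ne_nil a u) (List.cons_ne_nil b w)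
      (fun L => bd L φ)
    have k1 : bd (a :: u) (fun v => sh v (b :: w) φ) = bd (a :: u) (fun v => hs v (b :: w) φ) +
        (-1 : ℤ) ^ (u.length * (w.length + 1)) • bd (a :: u) (fun v => hs (b :: w) v φ) := by
      rw [← bd_smul, ← bd_add]
      refine bd_congr fun L hL hL' => ?_
      rw [sh_eq_hs_add_hs hL' (List.cons_ne_nil b w)]
      simp only [List.length_cons] at hL ⊢
      rw [show L.length = u.length by omega]
    have k2 : bd (b :: w) (fun v => sh (a :: u) v φ) = bd (b :: w) (fun v => hs (a :: u) v φ) +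
        (-1 : ℤ) ^ ((u.length + 1) * w.length) • bd (b :: w) (fun v => hs v (a :: u) φ) := by
      rw [← bd_smul, ← bd_add]
      refine bd_congr fun L hL hL' => ?_
      rw [sh_eq_hs_add_hs (List.cons_ne_nil a u) hL']
      simp only [List.length_cons] at hL ⊢
      rw [show L.length = w.length by omega]
    -- The join of the two heads does not depend on their order, so the two exceptional terms agree
    -- up to a sign; with the sign of the splitting they cancel.
    have k3 : joinHeads (b :: w) (a :: u) φ =
        (-1 : ℤ) ^ (w.length + u.length + u.length * w.length) • joinHeads (a :: u) (b :: w) φ := by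
      simp only [joinHeads]
      rw [sh_comm w u, sup_comm b a, smul_smul, smul_smul, ← pow_add, ← pow_add]
      congr 1
      refine neg_one_pow_eq ?_
      rw [mul_comm w.length]
      omega
    rw [hsplit, g1, g2, k1, k2, k3]
    simp only [List.length_cons]
    have s1 : (-1 : ℤ) ^ ((u.length + 1) * (w.length + 1)) =
        (-1) ^ (u.length * w.length) * (-1) ^ u.length * (-1) ^ w.length * (-1) := by
      ring
    have s2 : (-1 : ℤ) ^ (u.length * (w.length + 1)) =
        (-1) ^ (u.length * w.length) * (-1) ^ u.length := by ring
    have s3 : (-1 : ℤ) ^ ((u.length + 1) * w.length) =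
        (-1) ^ (u.length * w.length) * (-1) ^ w.length := by ring
    have s4 : (-1 : ℤ) ^ (w.length + u.length + u.length * w.length) =
        (-1) ^ (u.length * w.length) * (-1) ^ u.length * (-1) ^ w.length := by ring
    rw [s1, s2, s3, s4, pow_succ, pow_succ]
    have q : ∀ n : ℕ, ((-1 : ℤ) ^ n) * (-1) ^ n = 1 := fun n => by
      rw [← mul_pow]
      simp
    have q1 := q u.length
    have q2 := q w.length
    have q3 := q (u.length * w.length)
    generalize (-1 : ℤ) ^ u.length = p1 at *
    generalize (-1 : ℤ) ^ w.length = p2 at *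
    generalize (-1 : ℤ) ^ (u.length * w.length) = p3 at *
    simp only [smul_add, smul_smul]
    have r1 : p3 * p1 * p2 * -1 * (p2 * -1) = p3 * p1 := by linear_combination p3 * p1 * q2
    have r2 : p3 * p1 * p2 * -1 * (p3 * p1 * p2) = -1 := by
      linear_combination (-p1 * p1 * p2 * p2) * q3 - p2 * p2 * q1 - q2
    rw [r1, r2]
    module

/-- The differential of a half shuffle. -/
theorem hs_bd {u : List R} (hu : u ≠ []) (w : List R) (φ : List R → M) :
    hs u w (fun L => bd L φ) = bd u (fun v => hs v w φ) +
      (-1 : ℤ) ^ u.length • bd w (fun v => hs u v φ) + joinHeads u w φ := by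
  obtain ⟨a, u, rfl⟩ := List.exists_cons_of_ne_nil hu
  exact hs_bd_of_sh_bd a u w φ (sh_bd u w)

end Bar

end KnotDiagram

end

noncomputable section

namespace KnotDiagram

open Letter

/-! ### Normal forms of orienting monomials -/

section NormalForm

/-- A pair of points as an element of the orienting set: a chord, or an asterisk if the two points
coincide. -/
def edge {α : Type} [DecidableEq α] (e : α × α) : Letter α :=
  if e.1 = e.2 then ast e.1 else chord e.1 e.2

theorem edge_injective {α : Type} [DecidableEq α] : Function.Injective (edge : α × α → Letter α) := by
  rintro ⟨a, b⟩ ⟨a', b'⟩ h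
  simp only [edge] at h
  split_ifs at h <;> simp_all

theorem edge_map {α β : Type} [DecidableEq α] [DecidableEq β] (f : α → β) (e : α × α)
    (h : f e.1 = f e.2 → e.1 = e.2) : (edge e).map f = edge (e.map f f) := by
  obtain ⟨a, b⟩ := e
  by_cases hab : a = b
  · simp [edge, hab, Letter.map]
  · have : f a ≠ f b := fun h' => hab (h h')
    simp [edge, hab, this, Letter.map]

theorem edge_eq_chord {α : Type} [DecidableEq α] {e : α × α} {a b : α} :
    edge e = chord a b ↔ e = (a, b) ∧ a ≠ b := by
  obtain ⟨x, y⟩ := e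
  simp only [edge]
  split_ifs <;> grind

theorem edge_eq_ast {α : Type} [DecidableEq α] {e : α × α} {a : α} :
    edge e = ast a ↔ e = (a, a) := by
  obtain ⟨x, y⟩ := e
  simp only [edge]
  split_ifs <;> grind

theorem edge_ne_pt {α : Type} [DecidableEq α] (e : α × α) (a : α) : edge e ≠ pt a := by
  simp only [edge]
  split_ifs <;> simp

theorem deg_edge (d : ℕ) {α : Type} [DecidableEq α] (e : α × α) :
    (edge e).deg d = (d : ℤ) - 1 := by
  simp only [edge]
  split_ifs <;> rfl

/-- All active points in their order. -/
def pts (n : ℕ) : Word n := (List.finRange n).map pt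

/-- The monomial consisting of all active points in their order and of the given edges. -/
def nf {n : ℕ} (v : List (Fin n × Fin n)) : Word n := pts n ++ v.map edge

theorem chord_mem_map_edge {n : ℕ} {v : List (Fin n × Fin n)} {a b : Fin n} :
    chord a b ∈ v.map edge ↔ (a, b) ∈ v ∧ a ≠ b := by
  simp only [List.mem_map, edge_eq_chord]
  grind

theorem ast_mem_map_edge {n : ℕ} {v : List (Fin n × Fin n)} {a : Fin n} :
    ast a ∈ v.map edge ↔ (a, a) ∈ v := by
  simp only [List.mem_map, edge_eq_ast]
  grind

theorem chord_mem_nf {n : ℕ} {v : List (Fin n × Fin n)} {a b : Fin n} :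
    chord a b ∈ nf v ↔ (a, b) ∈ v ∧ a ≠ b := by
  rw [nf, List.mem_append, chord_mem_map_edge]
  simp [pts]

theorem ast_mem_nf {n : ℕ} {v : List (Fin n × Fin n)} {a : Fin n} :
    ast a ∈ nf v ↔ (a, a) ∈ v := by
  rw [nf, List.mem_append, ast_mem_map_edge]
  simp [pts]

theorem chordGraph_adj {n : ℕ} (w : Word n) (a b : Fin n) :
    (chordGraph w).Adj a b ↔ a ≠ b ∧ (chord a b ∈ w ∨ chord b a ∈ w) := by
  simp [chordGraph]

theorem chordGraph_mono {n : ℕ} {w w' : Word n} (h : ∀ a b, chord a b ∈ w → chord a b ∈ w') :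
    chordGraph w ≤ chordGraph w' := by
  intro a b hab
  rw [chordGraph_adj] at hab ⊢
  exact ⟨hab.1, hab.2.imp (h _ _) (h _ _)⟩

theorem chordGraph_nf {n : ℕ} (v : List (Fin n × Fin n)) :
    chordGraph (nf v) = chordGraph (v.map edge) := by
  ext a b
  rw [chordGraph_adj, chordGraph_adj]
  simp only [chord_mem_nf, chord_mem_map_edge]

/-- The edges are oriented from the left to the right. -/
def Oriented {n : ℕ} (v : List (Fin n × Fin n)) : Prop := ∀ e ∈ v, e.1 ≤ e.2

/-- Every point is the end of an edge. -/
def Covering {n : ℕ} (v : List (Fin n × Fin n)) : Prop := ∀ a, ∃ e ∈ v, e.1 = a ∨ e.2 = a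

/-- Orientation from left to right excludes a chord together with its reverse, and a chord is a pair
of distinct points by the definition of `edge`. Only the absence of repetitions and the forest
condition remain. -/
theorem isDiagram_nf_iff {n : ℕ} {v : List (Fin n × Fin n)} (ho : Oriented v) (hc : Covering v) :
    IsDiagram (nf v) ↔ v.Nodup ∧ (chordGraph (v.map edge)).IsAcyclic := by
  constructor
  · intro h
    exact ⟨((List.nodup_append.1 h.nodup).2.1).of_map _, chordGraph_nf v ▸ h.forest⟩
  · rintro ⟨h1, h2⟩
    refine ⟨fun a => ?_, ?_, fun a b h => ?_, fun a b h h' => ?_, fun a => ?_, ?_⟩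
    · simp [nf, pts]
    · rw [nf, List.nodup_append]
      refine ⟨(List.nodup_finRange n).map fun a b h => by simpa using h,
        h1.map edge_injective, ?_⟩
      rintro x hx y hy rfl
      obtain ⟨e, -, rfl⟩ := List.mem_map.1 hy
      obtain ⟨a, -, h⟩ := List.mem_map.1 hx
      exact edge_ne_pt e a h.symm
    · exact (chord_mem_nf.1 h).2
    · rw [chord_mem_nf] at h h'
      exact h.2 (le_antisymm (ho _ h.1) (ho _ h'.1))
    · obtain ⟨⟨x, y⟩, he, ha⟩ := hc a
      simp only [chord_mem_nf, ast_mem_nf]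
      grind
    · rwa [chordGraph_nf]

theorem reachable_of_adj {V W : Type*} {G : SimpleGraph V} {H : SimpleGraph W} (f : V → W)
    (h : ∀ x y, G.Adj x y → f x = f y ∨ H.Adj (f x) (f y)) {a b : V} (hab : G.Reachable a b) :
    H.Reachable (f a) (f b) := by
  obtain ⟨p⟩ := hab
  induction p with
  | nil => exact .refl _
  | cons hxy _ ih =>
    rcases h _ _ hxy with h' | h'
    · rwa [h']
    · exact h'.reachable.trans ih

theorem reachable_collapse {n m : ℕ} (f : Fin n → Fin m) (v : List (Fin n × Fin n)) {a b : Fin n}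
    (h : (chordGraph (v.map edge)).Reachable a b) :
    (chordGraph ((v.map (Prod.map f f)).map edge)).Reachable (f a) (f b) := by
  refine reachable_of_adj f (fun x y hxy => ?_) h
  rw [chordGraph_adj, chord_mem_map_edge, chord_mem_map_edge] at hxy
  by_cases hf : f x = f y
  · exact Or.inl hf
  · right
    rw [chordGraph_adj, chord_mem_map_edge, chord_mem_map_edge]
    refine ⟨hf, ?_⟩
    rcases hxy.2 with h | h
    · exact Or.inl ⟨List.mem_map.2 ⟨_, h.1, rfl⟩, hf⟩
    · exact Or.inr ⟨List.mem_map.2 ⟨_, h.1, rfl⟩, Ne.symm hf⟩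

theorem predAbove_mono {n : ℕ} (i : Fin n) {a b : Fin (n + 1)} (h : a ≤ b) :
    i.predAbove a ≤ i.predAbove b := Fin.predAbove_right_monotone i h

/-- Removing an edge from a forest separates its ends. -/
theorem not_reachable_of_isAcyclic {n : ℕ} {v : List (Fin n × Fin n)} {a b : Fin n}
    (ho : Oriented ((a, b) :: v)) (hn : ((a, b) :: v).Nodup) (hab : a ≠ b)
    (h : (chordGraph (((a, b) :: v).map edge)).IsAcyclic) :
    ¬ (chordGraph (v.map edge)).Reachable a b := by
  refine not_reachable_of_cons _ a b hab ?_ ?_ ?_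
  · rw [chord_mem_map_edge]
    exact fun h => (List.nodup_cons.1 hn).1 h.1
  · rw [chord_mem_map_edge]
    exact fun h => hab (le_antisymm (ho (a, b) (by simp)) (ho (b, a) (by simp [h.1])))
  · simpa [edge, hab] using h

/-- If the edges form a forest after gluing, they do so before gluing. -/
theorem isAcyclic_of_collapse {n : ℕ} (i : Fin n) (v : List (Fin (n + 1) × Fin (n + 1)))
    (ho : Oriented v) (hn : (v.map (Prod.map i.predAbove i.predAbove)).Nodup)
    (h : (chordGraph ((v.map (Prod.map i.predAbove i.predAbove)).map edge)).IsAcyclic) :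
    (chordGraph (v.map edge)).IsAcyclic := by
  induction v with
  | nil =>
    have : chordGraph (([] : List (Fin (n + 1) × Fin (n + 1))).map edge) = ⊥ := by
      ext a b
      simp [chordGraph]
    rw [this]
    exact SimpleGraph.isAcyclic_bot
  | cons e v ih =>
    obtain ⟨a, b⟩ := e
    have hov : Oriented v := fun e he => ho e (List.mem_cons_of_mem _ he)
    have ho' : Oriented (((a, b) :: v).map (Prod.map i.predAbove i.predAbove)) := by
      intro e he
      obtain ⟨e', he', rfl⟩ := List.mem_map.1 he
      exact predAbove_mono i (ho e' he')
    have hv := ih hov (List.Nodup.of_cons hn) (h.anti (chordGraph_mono fun x y hxy => by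
      rw [List.map_cons, List.map_cons]
      exact List.mem_cons_of_mem _ hxy))
    by_cases hab : a = b
    · have : chordGraph (((a, b) :: v).map edge) = chordGraph (v.map edge) := by
        ext x y
        simp [chordGraph_adj, edge, hab]
      rwa [this]
    have hcons : ((a, b) :: v).map edge = chord a b :: v.map edge := by
      simp [edge, hab]
    rw [hcons, chordGraph_cons]
    refine SimpleGraph.IsAcyclic.sup_edge_of_not_reachable (fun hr => ?_) hv
    -- If the ends of the new edge stay distinct, a path between them would collapse to a path
    -- closing a cycle. If they are glued, the first edge `e` of a path from `b` to `a` takes the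
    -- role of the new edge: the rest of the path, once collapsed, joins the ends of the image of
    -- `e` without using `e`.
    by_cases hs : i.predAbove a = i.predAbove b
    · obtain ⟨p, hp⟩ := hr.symm.exists_isPath
      cases p with
      | nil => exact hab rfl
      | @cons _ c _ hbc q =>
        rw [SimpleGraph.Walk.cons_isPath_iff] at hp
        have hadj := hbc
        rw [chordGraph_adj, chord_mem_map_edge, chord_mem_map_edge] at hadj
        -- Otherwise the path would begin with a second edge between `a` and `b`, excluded by the
        -- absence of repetitions and the orientation.
        have hca : c ≠ a := by
          rintro rfl
          have h1 : (c, b) ∉ v := fun hm => (List.nodup_cons.1 (hn.of_map _)).1 hm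
          have h2 : (b, c) ∉ v := fun hm => hab
            (le_antisymm (ho (c, b) (by simp)) (hov (b, c) hm))
          tauto
        have hsc : i.predAbove c ≠ i.predAbove b := by
          intro h'
          have g1 := predAbove_eq i hadj.1.symm h'
          have g2 := predAbove_eq i hab hs
          grind
        obtain ⟨e, hev, he⟩ : ∃ e ∈ v, e = (c, b) ∨ e = (b, c) := by
          rcases hadj.2 with h' | h'
          · exact ⟨_, h'.1, Or.inr rfl⟩
          · exact ⟨_, h'.1, Or.inl rfl⟩
        -- A path does not return to its starting point `b`, so the remaining part survives the
        -- removal of `e`.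
        have hq : (chordGraph ((v.erase e).map edge)).Reachable c a := by
          refine ⟨q.transfer _ fun f hf => ?_⟩
          induction f using Sym2.ind with
          | _ x y =>
            have hxy := q.adj_of_mem_edges hf
            have hx : x ≠ b := fun h' => hp.2 (h' ▸ q.fst_mem_support_of_mem_edges hf)
            have hy : y ≠ b := fun h' => hp.2 (h' ▸ q.snd_mem_support_of_mem_edges hf)
            rw [SimpleGraph.mem_edgeSet, chordGraph_adj, chord_mem_map_edge, chord_mem_map_edge]
            rw [chordGraph_adj, chord_mem_map_edge, chord_mem_map_edge] at hxy
            have g1 : (x, y) ≠ e := by grind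
            have g2 : (y, x) ≠ e := by grind
            rw [List.mem_erase_of_ne g1, List.mem_erase_of_ne g2]
            exact hxy
        have hq' := reachable_collapse i.predAbove _ hq
        rw [hs] at hq'
        have hperm : (((a, b) :: v).map (Prod.map i.predAbove i.predAbove)).Perm
            ((e :: (a, b) :: v.erase e).map (Prod.map i.predAbove i.predAbove)) :=
          (((List.perm_cons_erase hev).cons (a, b)).trans (List.Perm.swap _ _ _)).map _
        have hsub : ∀ f ∈ (e :: v.erase e).map (Prod.map i.predAbove i.predAbove),
            f ∈ ((a, b) :: v).map (Prod.map i.predAbove i.predAbove) := fun f hf => by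
          refine hperm.mem_iff.2 ?_
          simp only [List.map_cons, List.mem_cons] at hf ⊢
          tauto
        have hac := h.anti (chordGraph_mono
          (w := ((e :: v.erase e).map (Prod.map i.predAbove i.predAbove)).map edge)
          (fun x y hxy => by
            rw [chord_mem_map_edge] at hxy ⊢
            exact ⟨hsub _ hxy.1, hxy.2⟩))
        have hnd : ((e :: v.erase e).map (Prod.map i.predAbove i.predAbove)).Nodup :=
          (hperm.nodup_iff.1 hn).sublist (((List.sublist_cons_self _ _).cons_cons e).map _)
        have hor : Oriented ((e :: v.erase e).map (Prod.map i.predAbove i.predAbove)) :=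
          fun f hf => ho' f (hsub f hf)
        rcases he with rfl | rfl
        · exact not_reachable_of_isAcyclic hor hnd hsc hac hq'
        · exact not_reachable_of_isAcyclic hor hnd hsc.symm hac hq'.symm
    · exact not_reachable_of_isAcyclic ho' hn hs h (reachable_collapse _ _ hr)

theorem oriented_collapse {n : ℕ} (i : Fin n) {v : List (Fin (n + 1) × Fin (n + 1))}
    (ho : Oriented v) : Oriented (v.map (Prod.map i.predAbove i.predAbove)) := by
  intro e he
  obtain ⟨e', he', rfl⟩ := List.mem_map.1 he
  exact predAbove_mono i (ho e' he')

theorem covering_collapse {n : ℕ} (i : Fin n) {v : List (Fin (n + 1) × Fin (n + 1))}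
    (hc : Covering v) : Covering (v.map (Prod.map i.predAbove i.predAbove)) := by
  intro a
  obtain ⟨b, rfl⟩ : ∃ b, i.predAbove b = a := Fin.predAbove_surjective i a
  obtain ⟨e, he, h⟩ := hc b
  exact ⟨_, List.mem_map.2 ⟨e, he, rfl⟩, h.imp (congrArg i.predAbove) (congrArg i.predAbove)⟩

/-- Repetitions and cycles persist under gluing. Consequently the gluing formula also holds for
monomials that are not diagrams: both sides are then zero. -/
theorem isDiagram_nf_of_collapse {n : ℕ} (i : Fin n) {v : List (Fin (n + 1) × Fin (n + 1))}
    (ho : Oriented v) (hc : Covering v)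
    (h : IsDiagram (nf (v.map (Prod.map i.predAbove i.predAbove)))) : IsDiagram (nf v) := by
  rw [isDiagram_nf_iff (oriented_collapse i ho) (covering_collapse i hc)] at h
  rw [isDiagram_nf_iff ho hc]
  exact ⟨h.1.of_map _, isAcyclic_of_collapse i v ho h.1 h.2⟩

end NormalForm

end KnotDiagram

end

noncomputable section

namespace KnotDiagram

open Letter

/-! ### Signs -/

section Signs

variable (k : Type*) [CommRing k] (d : ℕ)

theorem negOnePow_smul {M : Type*} [AddCommGroup M] {m : ℤ} {n : ℕ} (h : Even (m - n)) (x : M) :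
    m.negOnePow • x = (-1 : ℤ) ^ n • x := by
  rw [(Int.negOnePow_eq_iff m n).2 h, Units.smul_def, Int.coe_negOnePow_natCast]

theorem cls_move_letter {n : ℕ} (u v B : Word n) (a : Letter (Fin n)) :
    cls k d (u ++ a :: B ++ v) = (a.deg d * Word.deg d B).negOnePow • cls k d (u ++ B ++ a :: v) := by
  induction B generalizing u with
  | nil => simp [Word.deg]
  | cons b B ih =>
    have h1 := cls_swap k d u (B ++ v) a b
    have h2 := ih (u ++ [b])
    simp only [List.append_assoc, List.cons_append, List.nil_append] at h1 h2 ⊢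
    rw [h1, h2, smul_smul, ← Int.negOnePow_add]
    congr 2
    simp [Word.deg]
    ring

theorem cls_move {n : ℕ} (u v A B : Word n) :
    cls k d (u ++ A ++ B ++ v) =
      (Word.deg d A * Word.deg d B).negOnePow • cls k d (u ++ B ++ A ++ v) := by
  induction A generalizing u with
  | nil => simp [Word.deg]
  | cons a A ih =>
    have h1 := ih (u ++ [a])
    have h2 := cls_move_letter k d u (A ++ v) B a
    simp only [List.append_assoc, List.cons_append, List.nil_append] at h1 h2 ⊢
    rw [h1, h2, smul_smul, ← Int.negOnePow_add]
    congr 2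
    simp [Word.deg]
    ring

theorem deg_map_edge {n : ℕ} (v : List (Fin n × Fin n)) :
    Word.deg d (v.map edge) = v.length * ((d : ℤ) - 1) := by
  induction v with
  | nil => simp [Word.deg]
  | cons e v ih =>
    rw [List.map_cons, ← List.singleton_append, Word.deg_append, ih]
    simp [Word.deg, deg_edge]
    ring

theorem deg_map_pt {n : ℕ} {β : Type} (f : β → Fin n) (v : List β) :
    Word.deg d (v.map fun b => pt (f b)) = -(v.length : ℤ) := by
  induction v with
  | nil => simp [Word.deg]
  | cons e v ih =>
    rw [List.map_cons, ← List.singleton_append, Word.deg_append, ih]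
    simp [Word.deg, Letter.deg]

theorem cls_swap_pt {n : ℕ} (u v : Word n) (a b : Fin n) :
    cls k d (u ++ [pt a, pt b] ++ v) = -cls k d (u ++ [pt b, pt a] ++ v) := by
  rw [cls_swap]
  simp [Letter.deg]

/-- Edges have degree d − 1, and (d − 1)² has the parity of d + 1; the latter keeps the exponent a
natural number. -/
theorem cls_swap_edges {n : ℕ} (u v : Word n) (v1 v2 : List (Fin n × Fin n)) :
    cls k d (u ++ v1.map edge ++ v2.map edge ++ v) = (-1 : ℤ) ^ ((d + 1) * v1.length * v2.length) •
      cls k d (u ++ v2.map edge ++ v1.map edge ++ v) := by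
  rw [cls_move, negOnePow_smul]
  rw [deg_map_edge, deg_map_edge]
  push_cast
  rw [Int.even_sub]
  simp only [Int.even_mul, Int.even_add, Int.even_sub]
  tauto

theorem cls_swap_edges_pts {n : ℕ} {β : Type} (u v : Word n) (v1 : List (Fin n × Fin n))
    (f : β → Fin n) (v2 : List β) :
    cls k d (u ++ v1.map edge ++ (v2.map fun b => pt (f b)) ++ v) =
      (-1 : ℤ) ^ ((d + 1) * v1.length * v2.length) •
      cls k d (u ++ (v2.map fun b => pt (f b)) ++ v1.map edge ++ v) := by
  rw [cls_move, negOnePow_smul]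
  rw [deg_map_edge, deg_map_pt]
  push_cast
  rw [Int.even_sub]
  simp only [Int.even_mul, Int.even_add, Int.even_sub, even_neg]
  tauto

theorem exists_cls_perm {n : ℕ} {w w' : Word n} (h : w.Perm w') :
    ∃ s : ℤˣ, cls k d w = s • cls k d w' := by
  -- The sign must not depend on the prefix, so that the induction can pass below a first letter.
  suffices H : ∃ s : ℤˣ, ∀ u, cls k d (u ++ w) = s • cls k d (u ++ w') by
    obtain ⟨s, hs⟩ := H
    exact ⟨s, hs []⟩
  induction h with
  | nil => exact ⟨1, fun u => by simp⟩
  | cons a _ ih =>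
    obtain ⟨s, hs⟩ := ih
    exact ⟨s, fun u => by simpa using hs (u ++ [a])⟩
  | swap a b w =>
    refine ⟨(b.deg d * a.deg d).negOnePow, fun u => ?_⟩
    simpa using cls_swap k d u w b a
  | trans _ _ ih1 ih2 =>
    obtain ⟨s, hs⟩ := ih1
    obtain ⟨t, ht⟩ := ih2
    exact ⟨s * t, fun u => by rw [hs, ht, smul_smul]⟩

end Signs

/-! ### Gluing on `T_*` -/

section Glue

variable (k : Type*) [CommRing k] (d : ℕ)

/-- The class of the result of gluing the `i`-th active point with the next one. -/
def glueAt (i : ℕ) : {n : ℕ} → Word n → TStar k d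
  | 0, _ => 0
  | n + 1, w => if h : i < n then (relations k d).mkQ (glue k d (⟨i, h⟩ : Fin n) w) else 0

theorem cls_diagram (D : Diagram) : cls k d D.word = TStar.ofDiagram k d D := by
  rw [cls, ofWord_diagram]
  rfl

/-- Each single gluing respects the relations, so the gluing of the two left-most points is a linear
map by itself and can be separated from the rest of the differential. -/
theorem glue_relations (i : ℕ) :
    relations k d ≤ LinearMap.ker
      (Finsupp.linearCombination k fun D : Diagram => glueAt k d i D.word) := by
  refine Submodule.span_le.2 ?_
  rintro x ⟨n, hx⟩
  refine map_relation_eq_zero k d (Finsupp.linearCombination k fun D : Diagram =>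
    glueAt k d i D.word) (fun w => glueAt k d i w) (fun w hw => ?_) (fun u v a b h => ?_)
    (fun u v a b h => ?_) (fun u v a b c h1 h2 h3 => ?_) hx
  · simp [ofWord, hw]
  all_goals
    cases n with
    | zero => simp [glueAt]
    | succ n =>
      simp only [glueAt]
      split_ifs with hi
      · first
          | exact glue_swap k d _ u v a b h
          | exact glue_reverse k d _ u v a b h
          | exact glue_arnold k d _ u v a b c h1 h2 h3
      · simp

/-- Gluing of the `i`-th active point with the next one, zero if there are no such points. -/
def TStar.glueNext (i : ℕ) : TStar k d →ₗ[k] TStar k d :=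
  (relations k d).liftQ _ (glue_relations k d i)

theorem glueNext_cls (i : ℕ) {n : ℕ} {w : Word n} (h : IsDiagram w) :
    TStar.glueNext k d i (cls k d w) = glueAt k d i w := by
  simp [TStar.glueNext, cls, ofWord, h]

theorem boundary_cls {n : ℕ} (w : Word n) : TStar.boundary k d (cls k d w) =
    ∑ i ∈ Finset.range (n - 1), TStar.glueNext k d i (cls k d w) := by
  by_cases h : IsDiagram w
  · have h1 : TStar.boundary k d (cls k d w) = (relations k d).mkQ (boundaryWord k d w) := by
      rw [cls, ← boundaryFree_ofWord k d h]
      rfl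
    rw [h1]
    simp only [glueNext_cls k d _ h]
    cases n with
    | zero => simp [boundaryWord]
    | succ n =>
      rw [boundaryWord, map_sum, Nat.add_sub_cancel, Finset.sum_range]
      refine Finset.sum_congr rfl fun i _ => ?_
      simp [glueAt]
  · simp [cls_of_not k d h]

/-- After the removal of `t_i`, the renumbering by `predAbove` lists the remaining points again in
their order, and exactly `i` points stand before the removed one. -/
theorem pts_split {n : ℕ} (i : Fin n) : ∃ A B : List (Fin (n + 1)),
    pts (n + 1) = A.map pt ++ pt i.castSucc :: B.map pt ∧ i.castSucc ∉ A ∧ i.castSucc ∉ B ∧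
      A.length = i ∧ (A ++ B).map i.predAbove = List.finRange n := by
  have h := List.take_append_drop i (List.finRange (n + 1))
  have hl : (i : ℕ) < (List.finRange (n + 1)).length := by simp
  rw [List.drop_eq_getElem_cons hl, List.getElem_finRange] at h
  have hi : Fin.cast (by simp) (⟨(i : ℕ), hl⟩ : Fin (List.finRange (n + 1)).length) =
      i.castSucc := rfl
  have hn := List.nodup_finRange (n + 1)
  rw [hi] at h
  rw [← h, List.nodup_append, List.nodup_cons] at hn
  refine ⟨(List.finRange (n + 1)).take i, (List.finRange (n + 1)).drop (i + 1), ?_,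
    fun hm => hn.2.2 _ hm _ (by simp) rfl, hn.2.1.1, ?_, ?_⟩
  · rw [pts, ← List.map_cons, ← List.map_append]
    exact congrArg _ h.symm
  · simp
    omega
  · refine List.ext_getElem ?_ fun j h1 h2 => ?_
    · simp
      omega
    · have hj : j < n := by simpa using h2
      have hmin : min (i : ℕ) (n + 1) = i := by omega
      simp only [List.getElem_map, List.getElem_append, List.getElem_take, List.getElem_drop,
        List.getElem_finRange, List.length_take, List.length_finRange, hmin]
      split_ifs with hji
      · ext
        simp [Fin.predAbove, Fin.lt_def]
        split_ifs <;> simp at * <;> omega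
      · ext
        simp [Fin.predAbove, Fin.lt_def]
        split_ifs <;> simp at * <;> omega

theorem glueLetter_edge {n : ℕ} (i : Fin n) (e : Fin (n + 1) × Fin (n + 1)) :
    glueLetter i (edge e) = edge (e.map i.predAbove i.predAbove) := by
  obtain ⟨a, b⟩ := e
  by_cases hab : a = b
  · simp [edge, hab, glueLetter]
  · simp [edge, hab, glueLetter]

/-- An edge oriented from left to right is never the chord from `t_{i+1}` to `t_i`. -/
theorem glueSign_edge {n : ℕ} (i : Fin n) {e : Fin (n + 1) × Fin (n + 1)} (he : e.1 ≤ e.2) :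
    glueSign d i (edge e) = 1 := by
  obtain ⟨a, b⟩ := e
  by_cases hab : a = b
  · simp [edge, hab, glueSign]
  · simp only [edge, hab, if_false, glueSign]
    rw [if_neg]
    rintro ⟨rfl, rfl⟩
    exact absurd he (not_le.2 Fin.castSucc_lt_succ)

/-- The sign counts the `i` odd points in front of `t_i`. A loop produced by the gluing is an
asterisk by the convention of `edge`, and monomials that are not diagrams are covered by
`isDiagram_nf_of_collapse`. -/
theorem glueNext_nf {n : ℕ} (i : Fin n) {v : List (Fin (n + 1) × Fin (n + 1))} (ho : Oriented v)
    (hc : Covering v) : TStar.glueNext k d i (cls k d (nf v)) =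
      (-1 : ℤ) ^ (i : ℕ) • cls k d (nf (v.map (Prod.map i.predAbove i.predAbove))) := by
  by_cases h : IsDiagram (nf v)
  · rw [glueNext_cls k d _ h]
    simp only [glueAt, i.isLt, dite_true, Fin.eta]
    obtain ⟨A, B, hp, hA, hB, hl, hAB⟩ := pts_split i
    have hA' : pt i.castSucc ∉ A.map pt := by simpa using hA
    have hB' : pt i.castSucc ∉ B.map pt := by simpa using hB
    have hv : pt i.castSucc ∉ v.map edge := by
      intro h
      obtain ⟨e, -, h⟩ := List.mem_map.1 h
      exact edge_ne_pt _ _ h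
    have hw : nf v = A.map pt ++ (pt i.castSucc :: (B.map pt ++ v.map edge)) := by
      rw [nf, hp]
      simp
    have h1 : before i.castSucc (nf v) = A.map pt := by
      rw [hw, before_append_of_not_mem hA']
      simp [before]
    have h2 : removePt i.castSucc (nf v) = (A ++ B).map pt ++ v.map edge := by
      rw [hw, removePt_append, removePt_of_not_mem hA', ← List.singleton_append, removePt_append,
        removePt_append, removePt_of_not_mem hB', removePt_of_not_mem hv]
      simp [removePt]
    have h3 : ((nf v).map (glueSign d i)).prod = 1 := by
      refine List.prod_eq_one fun s hs => ?_
      obtain ⟨l, hl, rfl⟩ := List.mem_map.1 hs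
      rcases List.mem_append.1 hl with hl | hl
      · obtain ⟨a, -, rfl⟩ := List.mem_map.1 hl
        rfl
      · obtain ⟨e, he, rfl⟩ := List.mem_map.1 hl
        exact glueSign_edge d i (ho e he)
    rw [glue, h1, h2, h3, mul_one, map_sign_smul, negOnePow_smul (n := i)]
    · congr 1
      rw [cls, nf, pts, ← hAB]
      congr 2
      rw [List.map_append]
      congr 1
      · simp [Function.comp_def, glueLetter]
      · simp [Function.comp_def, glueLetter_edge]
    · rw [show A.map pt = A.map (fun b => pt (id b)) from rfl, deg_map_pt, hl]
      exact ⟨-(i : ℤ), by ring⟩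
  · rw [cls_of_not k d h, map_zero,
      cls_of_not k d (mt (isDiagram_nf_of_collapse i ho hc) h), smul_zero]

end Glue

end KnotDiagram

end

noncomputable section

namespace KnotDiagram

open Letter

/-! ### Diagrams whose points are blocks of labels -/

section JoinAt

variable {R M : Type*} [SemilatticeSup R] [AddCommGroup M]

/-- Join the `i`-th entry of a list with the next one. -/
def joinAt : ℕ → List R → List R
  | _, [] => []
  | _, [a] => [a]
  | 0, a :: b :: u => (a ⊔ b) :: u
  | i + 1, a :: b :: u => a :: joinAt i (b :: u)

theorem length_joinAt {i : ℕ} {L : List R} (h : i + 1 < L.length) :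
    (joinAt i L).length + 1 = L.length := by
  induction L generalizing i with
  | nil => simp at h
  | cons a L ih =>
    cases L with
    | nil => simp at h
    | cons b u =>
      cases i with
      | zero => simp [joinAt]
      | succ i =>
        have := ih (i := i) (by simpa using h)
        simp only [joinAt, List.length_cons] at this ⊢
        omega

theorem bd_eq_sum (L : List R) (φ : List R → M) :
    bd L φ = ∑ i ∈ Finset.range (L.length - 1), (-1 : ℤ) ^ i • φ (joinAt i L) := by
  induction L generalizing φ with
  | nil => simp [bd]
  | cons a L ih =>
    cases L with
    | nil => simp [bd]
    | cons b u =>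
      rw [bd, ih]
      simp only [List.length_cons, Nat.add_sub_cancel]
      rw [Finset.sum_range_succ', add_comm, sub_eq_add_neg, ← Finset.sum_neg_distrib]
      congr 1
      · simp [joinAt]
      · refine Finset.sum_congr rfl fun i _ => ?_
        rw [pow_succ, mul_neg_one, neg_smul]
        rfl

theorem bd_congr_joinAt {L : List R} {φ ψ : List R → M}
    (h : ∀ i, i + 1 < L.length → φ (joinAt i L) = ψ (joinAt i L)) : bd L φ = bd L ψ := by
  rw [bd_eq_sum, bd_eq_sum]
  refine Finset.sum_congr rfl fun i hi => ?_
  rw [h i (by rw [Finset.mem_range] at hi; omega)]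

end JoinAt

section Blocks

variable {Q : Type}

open Classical in
/-- The position of the block containing a label. -/
def idx (L : List (Set Q)) (p : Q) : ℕ := L.findIdx fun B => decide (p ∈ B)

theorem idx_cons_of_mem {B : Set Q} {p : Q} (h : p ∈ B) (L : List (Set Q)) :
    idx (B :: L) p = 0 := by
  simp [idx, List.findIdx_cons, h]

theorem idx_cons_of_not_mem {B : Set Q} {p : Q} (h : p ∉ B) (L : List (Set Q)) :
    idx (B :: L) p = idx L p + 1 := by
  simp [idx, List.findIdx_cons, h]

/-- The value `L.length` of `idx` means that no block contains the label. -/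
theorem idx_lt_iff {L : List (Set Q)} {p : Q} : idx L p < L.length ↔ ∃ B ∈ L, p ∈ B := by
  simp [idx, List.findIdx_lt_length]

theorem mem_getElem_idx {L : List (Set Q)} {p : Q} (h : idx L p < L.length) :
    p ∈ L[idx L p] := by
  classical
  have := List.findIdx_getElem (xs := L) (w := h)
  rw [decide_eq_true_eq] at this
  exact this

theorem idx_eq {L : List (Set Q)} (hL : L.Pairwise Disjoint) {p : Q} {i : ℕ} (hi : i < L.length)
    (h : p ∈ L[i]) : idx L p = i := by
  have hlt : idx L p < L.length := idx_lt_iff.2 ⟨_, List.getElem_mem hi, h⟩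
  have hm := mem_getElem_idx hlt
  rw [List.pairwise_iff_getElem] at hL
  by_contra hne
  rcases lt_or_gt_of_ne hne with h' | h'
  · exact Set.disjoint_left.1 (hL _ _ hlt hi h') hm h
  · exact Set.disjoint_left.1 (hL _ _ hi hlt h') h hm

/-- On positions, the union of two neighbouring blocks acts like `predAbove` in the gluing of
points. -/
theorem idx_joinAt {i : ℕ} {L : List (Set Q)} (h : i + 1 < L.length) (p : Q) :
    idx (joinAt i L) p = if i < idx L p then idx L p - 1 else idx L p := by
  induction L generalizing i with
  | nil => simp at h
  | cons a L ih =>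
    cases L with
    | nil => simp at h
    | cons b u =>
      cases i with
      | zero =>
        rw [joinAt]
        by_cases ha : p ∈ a
        · have hab : p ∈ a ⊔ b := Or.inl ha
          rw [idx_cons_of_mem hab, idx_cons_of_mem ha]
          rfl
        · rw [idx_cons_of_not_mem ha]
          by_cases hb : p ∈ b
          · have hab : p ∈ a ⊔ b := Or.inr hb
            rw [idx_cons_of_mem hab, idx_cons_of_mem hb]
            rfl
          · have hab : p ∉ a ⊔ b := fun h => h.elim ha hb
            rw [idx_cons_of_not_mem hab, idx_cons_of_not_mem hb]
            simp
      | succ i =>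
        have hi := ih (i := i) (by simpa using h)
        rw [joinAt]
        by_cases ha : p ∈ a
        · rw [idx_cons_of_mem ha, idx_cons_of_mem ha]
          rfl
        · rw [idx_cons_of_not_mem ha, idx_cons_of_not_mem ha, hi]
          split_ifs <;> omega

/-- The edges between labels `V` define an oriented monomial with the blocks `L` as points. -/
structure Fits (V : List (Q × Q)) (L : List (Set Q)) : Prop where
  disjoint : L.Pairwise Disjoint
  idx_lt : ∀ e ∈ V, idx L e.2 < L.length
  idx_le : ∀ e ∈ V, idx L e.1 ≤ idx L e.2
  covering : ∀ B ∈ L, ∃ e ∈ V, e.1 ∈ B ∨ e.2 ∈ B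

theorem disjoint_joinAt {a : Set Q} {i : ℕ} {L : List (Set Q)} (h : ∀ B ∈ L, Disjoint a B) :
    ∀ B ∈ joinAt i L, Disjoint a B := by
  induction L generalizing i with
  | nil => simp [joinAt]
  | cons b L ih =>
    cases L with
    | nil => simpa [joinAt] using h
    | cons c u =>
      cases i with
      | zero =>
        intro B hB
        rcases List.mem_cons.1 hB with rfl | hB
        · exact disjoint_sup_right.2 ⟨h _ (by simp), h _ (by simp)⟩
        · exact h B (by simp [hB])
      | succ i =>
        intro B hB
        rcases List.mem_cons.1 hB with rfl | hB
        · exact h _ (by simp)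
        · exact ih (fun B hB => h B (List.mem_cons_of_mem _ hB)) B hB

theorem pairwise_joinAt {i : ℕ} {L : List (Set Q)} (h : L.Pairwise Disjoint) :
    (joinAt i L).Pairwise Disjoint := by
  induction L generalizing i with
  | nil => simp [joinAt]
  | cons b L ih =>
    cases L with
    | nil => simp [joinAt]
    | cons c u =>
      rw [List.pairwise_cons] at h
      cases i with
      | zero =>
        have h2 := List.pairwise_cons.1 h.2
        refine List.pairwise_cons.2 ⟨fun B hB => ?_, h2.2⟩
        exact disjoint_sup_left.2 ⟨h.1 B (by simp [hB]), h2.1 B hB⟩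
      | succ i => exact List.pairwise_cons.2 ⟨disjoint_joinAt h.1, ih h.2⟩

theorem exists_subset_of_mem_joinAt {i : ℕ} {L : List (Set Q)} {B : Set Q}
    (hB : B ∈ joinAt i L) : ∃ C ∈ L, C ⊆ B := by
  induction L generalizing i with
  | nil => simp [joinAt] at hB
  | cons b L ih =>
    cases L with
    | nil => exact ⟨B, by simpa [joinAt] using hB, subset_rfl⟩
    | cons c u =>
      cases i with
      | zero =>
        rcases List.mem_cons.1 hB with rfl | hB
        · exact ⟨b, by simp, Set.subset_union_left⟩
        · exact ⟨B, by simp [hB], subset_rfl⟩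
      | succ i =>
        rcases List.mem_cons.1 hB with rfl | hB
        · exact ⟨B, by simp, subset_rfl⟩
        · obtain ⟨C, hC, h⟩ := ih hB
          exact ⟨C, List.mem_cons_of_mem _ hC, h⟩

theorem Fits.joinAt {V : List (Q × Q)} {L : List (Set Q)} (h : Fits V L) {i : ℕ}
    (hi : i + 1 < L.length) : Fits V (joinAt i L) where
  disjoint := pairwise_joinAt h.disjoint
  idx_lt e he := by
    have h1 := h.idx_lt e he
    have h2 := length_joinAt hi
    rw [idx_joinAt hi]
    split_ifs <;> omega
  idx_le e he := by
    have h1 := h.idx_le e he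
    rw [idx_joinAt hi, idx_joinAt hi]
    split_ifs <;> omega
  covering B hB := by
    obtain ⟨C, hC, hs⟩ := exists_subset_of_mem_joinAt hB
    obtain ⟨e, he, h'⟩ := h.covering C hC
    exact ⟨e, he, h'.imp (@hs _) (@hs _)⟩

theorem Fits.joinHead {V : List (Q × Q)} {a b : Set Q} {L : List (Set Q)}
    (h : Fits V (a :: b :: L)) : Fits V ((a ⊔ b) :: L) :=
  h.joinAt (i := 0) (by simp)

variable (k : Type*) [CommRing k] (d : ℕ)

/-- The class of the diagram with `n` points in their order and the given edges, zero if there is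
no such diagram. -/
def normalCls : ℕ → List (ℕ × ℕ) → TStar k d
  | 0, _ => cls k d ([] : Word 0)
  | m + 1, v => cls k d (nf (v.map (Prod.map (Fin.ofNat (m + 1)) (Fin.ofNat (m + 1)))))

/-- The class of the diagram with the given blocks of labels as points and the given edges. -/
def blockCls (V : List (Q × Q)) (L : List (Set Q)) : TStar k d :=
  normalCls k d L.length (V.map (Prod.map (idx L) (idx L)))

/-- Edges are written with natural numbers so that diagrams with different numbers of points have
the same type of edges. The three conditions guarantee that reduction modulo the number of points
changes nothing and that the edges are oriented and touch every point. -/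
theorem glueNext_normalCls {n i : ℕ} (hi : i < n + 1) {v : List (ℕ × ℕ)}
    (h1 : ∀ e ∈ v, e.1 ≤ e.2) (h2 : ∀ e ∈ v, e.2 < n + 2)
    (h3 : ∀ j < n + 2, ∃ e ∈ v, e.1 = j ∨ e.2 = j) :
    TStar.glueNext k d i (normalCls k d (n + 2) v) = (-1 : ℤ) ^ i • normalCls k d (n + 1)
      (v.map (Prod.map (fun x => if i < x then x - 1 else x) (fun x => if i < x then x - 1 else x))) := by
  have ho : Oriented (v.map (Prod.map (Fin.ofNat (n + 2)) (Fin.ofNat (n + 2)))) := by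
    intro e he
    obtain ⟨e, he', rfl⟩ := List.mem_map.1 he
    have := h1 e he'
    have := h2 e he'
    simp only [Prod.map_fst, Prod.map_snd, Fin.le_def, Fin.val_ofNat]
    rw [Nat.mod_eq_of_lt (by omega), Nat.mod_eq_of_lt (by omega)]
    omega
  have hc : Covering (v.map (Prod.map (Fin.ofNat (n + 2)) (Fin.ofNat (n + 2)))) := by
    intro a
    obtain ⟨e, he, h⟩ := h3 a a.isLt
    refine ⟨_, List.mem_map.2 ⟨e, he, rfl⟩, ?_⟩
    refine h.imp (fun h => ?_) (fun h => ?_)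
    · simp [h]
    · simp [h]
  have := glueNext_nf k d (⟨i, hi⟩ : Fin (n + 1)) ho hc
  rw [normalCls, normalCls, this]
  congr 3
  rw [List.map_map, List.map_map]
  refine List.map_congr_left fun e he => ?_
  have key : ∀ x, x < n + 2 → (⟨i, hi⟩ : Fin (n + 1)).predAbove (Fin.ofNat (n + 2) x) =
      Fin.ofNat (n + 1) (if i < x then x - 1 else x) := by
    intro x hx
    ext
    simp only [Fin.predAbove, Fin.lt_def, Fin.val_castSucc, Fin.val_ofNat, Nat.mod_eq_of_lt hx]
    split_ifs with h
    · simp only [Fin.val_pred, Fin.val_ofNat]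
      rw [Nat.mod_eq_of_lt hx, Nat.mod_eq_of_lt (by omega)]
    · simp only [Fin.coe_castPred, Fin.val_ofNat]
      rw [Nat.mod_eq_of_lt hx, Nat.mod_eq_of_lt (by omega)]
  have g1 := h1 e he
  have g2 := h2 e he
  simp only [Function.comp_apply, Prod.map]
  rw [key _ (by omega), key _ g2]

/-- This is the purpose of blocks: the labelled edges `V` are unchanged by the gluing, and only the
positions of the labels change. -/
theorem glueNext_blockCls {V : List (Q × Q)} {L : List (Set Q)} (h : Fits V L) {i : ℕ}
    (hi : i + 1 < L.length) : TStar.glueNext k d i (blockCls k d V L) =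
      (-1 : ℤ) ^ i • blockCls k d V (joinAt i L) := by
  obtain ⟨n, hn⟩ : ∃ n, L.length = n + 2 := ⟨L.length - 2, by omega⟩
  have hn' : (joinAt i L).length = n + 1 := by
    have := length_joinAt hi
    omega
  rw [blockCls, blockCls, hn, hn', glueNext_normalCls k d (by omega)]
  · rw [List.map_map]
    congr 2
    refine List.map_congr_left fun e _ => ?_
    simp [Prod.map, idx_joinAt hi]
  · intro e he
    obtain ⟨e, he', rfl⟩ := List.mem_map.1 he
    exact h.idx_le e he'
  · intro e he
    obtain ⟨e, he', rfl⟩ := List.mem_map.1 he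
    exact hn ▸ h.idx_lt e he'
  · intro j hj
    obtain ⟨e, he, h'⟩ := h.covering (L[j]) (List.getElem_mem _)
    exact ⟨_, List.mem_map.2 ⟨e, he, rfl⟩, h'.imp (idx_eq h.disjoint _) (idx_eq h.disjoint _)⟩

theorem glueNext_zero_blockCls {V : List (Q × Q)} {a b : Set Q} {L : List (Set Q)}
    (h : Fits V (a :: b :: L)) : TStar.glueNext k d 0 (blockCls k d V (a :: b :: L)) =
      blockCls k d V ((a ⊔ b) :: L) := by
  rw [glueNext_blockCls k d h (by simp), pow_zero, one_smul, joinAt]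

theorem boundary_normalCls (n : ℕ) (v : List (ℕ × ℕ)) :
    TStar.boundary k d (normalCls k d n v) =
      ∑ i ∈ Finset.range (n - 1), TStar.glueNext k d i (normalCls k d n v) := by
  cases n <;> exact boundary_cls k d _

theorem boundary_blockCls {V : List (Q × Q)} {L : List (Set Q)} (h : Fits V L) :
    TStar.boundary k d (blockCls k d V L) = bd L (blockCls k d V) := by
  rw [bd_eq_sum, blockCls, boundary_normalCls, ← blockCls]
  refine Finset.sum_congr rfl fun i hi => ?_
  rw [Finset.mem_range] at hi
  exact glueNext_blockCls k d h (by omega)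

/-- The first summand of the bar differential is the gluing of the first two points; in the others
`a` is a passive entry, which shifts every position by one and hence changes the sign. -/
theorem boundary_sub_glueNext_blockCls {V : List (Q × Q)} {a : Set Q} {L : List (Set Q)}
    (h : Fits V (a :: L)) (hL : L ≠ []) :
    TStar.boundary k d (blockCls k d V (a :: L)) -
      TStar.glueNext k d 0 (blockCls k d V (a :: L)) =
      -bd L (fun u => blockCls k d V (a :: u)) := by
  obtain ⟨b, L, rfl⟩ := List.exists_cons_of_ne_nil hL
  rw [boundary_blockCls k d h, glueNext_zero_blockCls k d h, bd]
  abel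

end Blocks

end KnotDiagram

end

noncomputable section

namespace KnotDiagram

open Letter

/-! ### Bilinear operations given by families of shuffles -/

section Respects

variable (k : Type*) [CommRing k] (d : ℕ)

/-- A function on monomials satisfying the relations of `T_*`. -/
structure RespectsRelations {M : Type*} [AddCommGroup M] {n : ℕ} (Φ : Word n → M) : Prop where
  swap : ∀ u v a b, Φ (u ++ [a, b] ++ v) = (a.deg d * b.deg d).negOnePow • Φ (u ++ [b, a] ++ v)
  reverse : ∀ u v a b, a ≠ b →
    Φ (u ++ [chord a b] ++ v) = (d : ℤ).negOnePow • Φ (u ++ [chord b a] ++ v)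
  arnold : ∀ u v a b c, a ≠ b → b ≠ c → c ≠ a →
    Φ (u ++ [chord a b, chord b c] ++ v) + Φ (u ++ [chord b c, chord c a] ++ v)
      + Φ (u ++ [chord c a, chord a b] ++ v) = 0

variable {d} in
theorem RespectsRelations.list_sum {M ι : Type*} [AddCommGroup M] {n : ℕ} {Φ : ι → Word n → M}
    (l : List ι) (h : ∀ i ∈ l, RespectsRelations d (Φ i)) :
    RespectsRelations d fun w => (l.map fun i => Φ i w).sum := by
  induction l with
  | nil => exact ⟨fun _ _ _ _ => by simp, fun _ _ _ _ _ => by simp, fun _ _ _ _ _ _ _ _ => by simp⟩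
  | cons i l ih =>
    have h1 := h i (by simp)
    have h2 := ih fun j hj => h j (by simp [hj])
    refine ⟨fun u v a b => ?_, fun u v a b hab => ?_, fun u v a b c hab hbc hca => ?_⟩
    · simp only [List.map_cons, List.sum_cons, smul_add]
      rw [h1.swap, h2.swap]
    · simp only [List.map_cons, List.sum_cons, smul_add]
      rw [h1.reverse _ _ _ _ hab, h2.reverse _ _ _ _ hab]
    · simp only [List.map_cons, List.sum_cons]
      have g1 := h1.arnold u v a b c hab hbc hca
      have g2 := h2.arnold u v a b c hab hbc hca
      calc _ = (Φ i (u ++ [chord a b, chord b c] ++ v) + Φ i (u ++ [chord b c, chord c a] ++ v)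
          + Φ i (u ++ [chord c a, chord a b] ++ v)) +
          ((l.map fun i => Φ i (u ++ [chord a b, chord b c] ++ v)).sum +
          (l.map fun i => Φ i (u ++ [chord b c, chord c a] ++ v)).sum +
          (l.map fun i => Φ i (u ++ [chord c a, chord a b] ++ v)).sum) := by abel
        _ = 0 := by rw [g1, g2, add_zero]

theorem respectsRelations_cls {n N : ℕ} {f : Fin n → Fin N} (hf : Function.Injective f)
    (X Y : Word N) : RespectsRelations d fun w : Word n =>
      cls k d (X ++ w.map (Letter.map f) ++ Y) := by
  have e : ∀ u v m : Word n, X ++ (u ++ m ++ v).map (Letter.map f) ++ Y =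
      (X ++ u.map (Letter.map f)) ++ m.map (Letter.map f) ++ (v.map (Letter.map f) ++ Y) := by
    intro u v m
    simp
  refine ⟨fun u v a b => ?_, fun u v a b _ => ?_, fun u v a b c hab hbc hca => ?_⟩
  · rw [e, e]
    exact (cls_swap k d _ _ _ _).trans (by rw [deg_map, deg_map]; rfl)
  · rw [e, e]
    exact cls_reverse k d _ _ _ _
  · rw [e, e, e]
    exact cls_arnold k d _ _ _ _ _ (hf.ne hab) (hf.ne hbc) (hf.ne hca)

theorem relations_le_ker {M : Type*} [AddCommGroup M] [Module k M]
    (Φ : ∀ {n}, Word n → M) (h : ∀ n, RespectsRelations d (Φ : Word n → M)) :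
    relations k d ≤ LinearMap.ker (Finsupp.linearCombination k fun D : Diagram => Φ D.word) := by
  refine Submodule.span_le.2 ?_
  rintro x ⟨n, hx⟩
  exact map_relation_eq_zero k d (Finsupp.linearCombination k fun D : Diagram => Φ D.word) Φ
    (fun w hw => by simp [ofWord, hw]) (fun u v a b _ => (h n).swap u v a b)
    (h n).reverse (h n).arnold hx

/-- Every point occurs in the monomial and is marked or adjacent to a chord. -/
structure IsFull {n : ℕ} (w : Word n) : Prop where
  pt_mem : ∀ a, pt a ∈ w
  touched : ∀ a, ast a ∈ w ∨ ∃ b, chord a b ∈ w ∨ chord b a ∈ w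

theorem IsDiagram.isFull {n : ℕ} {w : Word n} (h : IsDiagram w) : IsFull w :=
  ⟨h.pt_mem, h.touched⟩

/-- A factor inherits the diagram conditions from the product. Contrapositively, if a factor is not
a diagram, every term of the product is zero. -/
theorem isDiagram_of_map {n N : ℕ} {f : Fin n → Fin N} (hf : Function.Injective f) {X Y : Word N}
    {w : Word n} (hw : IsFull w) (h : IsDiagram (X ++ w.map (Letter.map f) ++ Y)) :
    IsDiagram w := by
  have hm : ∀ l ∈ w, l.map f ∈ X ++ w.map (Letter.map f) ++ Y := fun l hl => by
    simp only [List.mem_append, List.mem_map]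
    exact Or.inl (Or.inr ⟨l, hl, rfl⟩)
  refine ⟨hw.pt_mem, ?_, fun a b hab hne => ?_, fun a b hab hba => ?_, hw.touched, ?_⟩
  · exact ((List.nodup_append.1 (List.nodup_append.1 h.nodup).1).2.1).of_map _
  · exact h.chord_ne _ _ (hm _ hab) (congrArg f hne)
  · exact h.chord_simple _ _ (hm _ hab) (hm _ hba)
  · refine h.forest.comap (G := chordGraph w) ⟨f, fun {a b} hab => ?_⟩ hf
    rw [chordGraph_adj] at hab ⊢
    exact ⟨hf.ne hab.1, hab.2.imp (hm _) (hm _)⟩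

end Respects

/-! ### The bilinear product on `T_*` defined by a family of shuffles -/

section Operation

variable (k : Type*) [CommRing k] (d : ℕ)

/-- The class of a monomial whose points are numbered by natural numbers. -/
def natCls : ℕ → List (Letter ℕ) → TStar k d
  | 0, _ => cls k d ([] : Word 0)
  | m + 1, w => cls k d (w.map (Letter.map (Fin.ofNat (m + 1))))

/-- The labels of the points of the first factor. -/
def inls (n : ℕ) : List (ℕ ⊕ ℕ) := (List.range n).map Sum.inl

/-- The labels of the points of the second factor. -/
def inrs (n : ℕ) : List (ℕ ⊕ ℕ) := (List.range n).map Sum.inr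

instance : LawfulBEq (ℕ ⊕ ℕ) where
  eq_of_beq {a b} h := by
    cases a <;> cases b
    · exact congrArg Sum.inl (eq_of_beq (α := ℕ) h)
    · cases h
    · cases h
    · exact congrArg Sum.inr (eq_of_beq (α := ℕ) h)
  rfl {a} := by
    cases a
    · exact BEq.rfl (α := ℕ)
    · exact BEq.rfl (α := ℕ)

/-- A family of shuffles for each pair of lists. -/
structure ShuffleFamily where
  lists : List (ℕ ⊕ ℕ) → List (ℕ ⊕ ℕ) → List (List (ℕ ⊕ ℕ))
  perm : ∀ u w, ∀ L ∈ lists u w, L.Perm (u ++ w)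

/-- The product of two monomials given by a family of shuffles. -/
def opWord (K : ShuffleFamily) {n m : ℕ} (w₁ : Word n) (w₂ : Word m) : TStar k d :=
  ((K.lists (inls n) (inrs m)).map fun L => natCls k d L.length
    (w₁.map (Letter.map fun a : Fin n => L.idxOf (Sum.inl (a : ℕ))) ++
      w₂.map (Letter.map fun a : Fin m => L.idxOf (Sum.inr (a : ℕ))))).sum

theorem nodup_labels (n m : ℕ) : (inls n ++ inrs m).Nodup := by
  rw [List.nodup_append]
  refine ⟨List.nodup_range.map Sum.inl_injective, List.nodup_range.map Sum.inr_injective, ?_⟩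
  rintro a ha b hb rfl
  obtain ⟨x, -, rfl⟩ := List.mem_map.1 ha
  obtain ⟨y, -, h⟩ := List.mem_map.1 hb
  simp at h

theorem mem_inls {n : ℕ} (a : Fin n) : Sum.inl (a : ℕ) ∈ inls n :=
  List.mem_map.2 ⟨a, by simp, rfl⟩

theorem mem_inrs {n : ℕ} (a : Fin n) : Sum.inr (a : ℕ) ∈ inrs n :=
  List.mem_map.2 ⟨a, by simp, rfl⟩

theorem ofNat_idxOf_injective {α : Type*} [BEq α] [LawfulBEq α] {N : ℕ} {L : List α}
    (hL : L.length = N + 1) {ι : Type*} {f : ι → α} (hf : Function.Injective f)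
    (hm : ∀ i, f i ∈ L) : Function.Injective fun i => Fin.ofNat (N + 1) (L.idxOf (f i)) := by
  intro a b h
  have h' := congrArg Fin.val h
  simp only [Fin.val_ofNat] at h'
  rw [Nat.mod_eq_of_lt (hL ▸ List.idxOf_lt_length_iff.2 (hm a)),
    Nat.mod_eq_of_lt (hL ▸ List.idxOf_lt_length_iff.2 (hm b))] at h'
  exact hf ((List.idxOf_inj (hm a)).1 h')

theorem inl_injective {n : ℕ} : Function.Injective fun a : Fin n => (Sum.inl (a : ℕ) : ℕ ⊕ ℕ) :=
  fun a b h => by simpa [Fin.ext_iff] using h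

theorem inr_injective {n : ℕ} : Function.Injective fun a : Fin n => (Sum.inr (a : ℕ) : ℕ ⊕ ℕ) :=
  fun a b h => by simpa [Fin.ext_iff] using h

theorem length_of_perm_labels {n m : ℕ} {L : List (ℕ ⊕ ℕ)} (h : L.Perm (inls n ++ inrs m)) :
    L.length = n + m := by
  simpa [inls, inrs] using h.length_eq

theorem respects_of_zero {M : Type*} [AddCommGroup M] (Φ : Word 0 → M) :
    RespectsRelations d Φ where
  swap _ _ a _ := by cases a <;> rename_i a <;> exact a.elim0
  reverse _ _ a := a.elim0
  arnold _ _ a := a.elim0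

theorem Letter.map_map {α β γ : Type} (f : α → β) (g : β → γ) (l : Letter α) :
    (l.map f).map g = l.map fun a => g (f a) := by
  cases l <;> rfl

theorem natCls_append_map {n m N : ℕ} (f : Fin n → ℕ) (g : Fin m → ℕ) (w₁ : Word n) (w₂ : Word m) :
    natCls k d (N + 1) (w₁.map (Letter.map f) ++ w₂.map (Letter.map g)) =
      cls k d (w₁.map (Letter.map fun a => Fin.ofNat (N + 1) (f a)) ++
        w₂.map (Letter.map fun a => Fin.ofNat (N + 1) (g a))) := by
  simp [natCls, Function.comp_def, Letter.map_map]

theorem eq_nil_of_zero (w : Word 0) : w = [] := by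
  cases w with
  | nil => rfl
  | cons a w => cases a <;> rename_i a <;> exact a.elim0

/-- In every term the letters of the first factor form a segment of the monomial, with injectively
renamed points, so each relation can be applied inside that segment. -/
theorem respects_opWord_left (K : ShuffleFamily) {n m : ℕ} (w₂ : Word m) :
    RespectsRelations d fun w₁ : Word n => opWord k d K w₁ w₂ := by
  refine RespectsRelations.list_sum _ fun L hL => ?_
  have hp := K.perm _ _ L hL
  cases n with
  | zero => exact respects_of_zero d _
  | succ n =>
    have hl : L.length = (n + m) + 1 := by
      rw [length_of_perm_labels hp]
      omega
    have := respectsRelations_cls k d (ofNat_idxOf_injective hl inl_injective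
      fun a : Fin (n + 1) => hp.mem_iff.2 (List.mem_append_left _ (mem_inls a))) []
      (w₂.map (Letter.map fun a : Fin m => Fin.ofNat (n + m + 1) (L.idxOf (Sum.inr (a : ℕ)))))
    simpa only [hl, natCls_append_map, List.nil_append] using this

theorem respects_opWord_right (K : ShuffleFamily) {n m : ℕ} (w₁ : Word n) :
    RespectsRelations d fun w₂ : Word m => opWord k d K w₁ w₂ := by
  refine RespectsRelations.list_sum _ fun L hL => ?_
  have hp := K.perm _ _ L hL
  cases m with
  | zero => exact respects_of_zero d _
  | succ m =>
    have hl : L.length = (n + m) + 1 := by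
      rw [length_of_perm_labels hp]
      omega
    have := respectsRelations_cls k d (ofNat_idxOf_injective hl inr_injective
      fun a : Fin (m + 1) => hp.mem_iff.2 (List.mem_append_right _ (mem_inrs a)))
      (w₁.map (Letter.map fun a : Fin n => Fin.ofNat (n + m + 1) (L.idxOf (Sum.inl (a : ℕ))))) []
    simpa only [hl, natCls_append_map, List.append_nil] using this

/-- The bilinear extension of the product to the free module. -/
def opFree (K : ShuffleFamily) : Free k →ₗ[k] Free k →ₗ[k] TStar k d :=
  Finsupp.linearCombination k fun D₁ : Diagram =>
    Finsupp.linearCombination k fun D₂ : Diagram => opWord k d K D₁.word D₂.word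

theorem opFree_relations_right (K : ShuffleFamily) (x : Free k) :
    relations k d ≤ LinearMap.ker (opFree k d K x) := by
  induction x using Finsupp.induction_linear with
  | zero => simp
  | add x y hx hy =>
    intro r hr
    rw [map_add, LinearMap.mem_ker, LinearMap.add_apply, LinearMap.mem_ker.1 (hx hr),
      LinearMap.mem_ker.1 (hy hr), add_zero]
  | single D c =>
    intro r hr
    have := relations_le_ker k d (fun {n} (w : Word n) => opWord k d K D.word w)
      (fun n => respects_opWord_right k d K D.word) hr
    rw [LinearMap.mem_ker] at this ⊢
    rw [opFree, Finsupp.linearCombination_single, LinearMap.smul_apply, this, smul_zero]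

theorem opFree_relations_left (K : ShuffleFamily) : relations k d ≤ LinearMap.ker (opFree k d K) := by
  intro r hr
  rw [LinearMap.mem_ker]
  ext D
  have := relations_le_ker k d (fun {n} (w : Word n) => opWord k d K w D.word)
      (fun n => respects_opWord_left k d K D.word) hr
  rw [LinearMap.mem_ker] at this
  simp only [LinearMap.comp_apply, Finsupp.lsingle_apply, LinearMap.zero_apply]
  rw [← this]
  have e : (opFree k d K).flip (Finsupp.single D 1) =
      Finsupp.linearCombination k fun D' : Diagram => opWord k d K D'.word D.word := by
    ext D'
    simp [opFree]
  exact LinearMap.congr_fun e r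

/-- The bilinear product on `T_*` given by a family of shuffles. -/
def TStar.op (K : ShuffleFamily) : TStar k d →ₗ[k] TStar k d →ₗ[k] TStar k d :=
  (relations k d).liftQ
    { toFun := fun x => (relations k d).liftQ (opFree k d K x) (opFree_relations_right k d K x)
      map_add' := fun x y => by
        ext
        simp
      map_smul' := fun c x => by
        ext
        simp }
    (fun r hr => by
      rw [LinearMap.mem_ker]
      ext
      simp [LinearMap.mem_ker.1 (opFree_relations_left k d K hr)])

theorem op_cls_of_isDiagram (K : ShuffleFamily) {n m : ℕ} {w₁ : Word n} {w₂ : Word m}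
    (h₁ : IsDiagram w₁) (h₂ : IsDiagram w₂) :
    TStar.op k d K (cls k d w₁) (cls k d w₂) = opWord k d K w₁ w₂ := by
  simp [TStar.op, cls, ofWord, h₁, h₂, opFree]

/-- The formula extends from diagrams to all full monomials, both sides being zero if a factor is
not a diagram. This matters because normal forms obtained by gluing need not be diagrams. -/
theorem op_cls (K : ShuffleFamily) {n m : ℕ} {w₁ : Word n} {w₂ : Word m}
    (h₁ : IsFull w₁) (h₂ : IsFull w₂) :
    TStar.op k d K (cls k d w₁) (cls k d w₂) = opWord k d K w₁ w₂ := by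
  by_cases hd₁ : IsDiagram w₁
  · by_cases hd₂ : IsDiagram w₂
    · exact op_cls_of_isDiagram k d K hd₁ hd₂
    · rw [cls_of_not k d hd₂, map_zero, opWord]
      refine (List.sum_eq_zero fun x hx => ?_).symm
      obtain ⟨L, hL, rfl⟩ := List.mem_map.1 hx
      have hp := K.perm _ _ L hL
      cases m with
      | zero =>
        refine absurd ?_ hd₂
        have : w₂ = [] := eq_nil_of_zero _
        rw [this]
        exact isDiagram_nil
      | succ m =>
        have hl : L.length = (n + m) + 1 := by
          rw [length_of_perm_labels hp]
          omega
        rw [hl, natCls_append_map]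
        refine cls_of_not k d fun h => hd₂ (isDiagram_of_map (ofNat_idxOf_injective hl
          inr_injective fun a : Fin (m + 1) => hp.mem_iff.2 (List.mem_append_right _ (mem_inrs a)))
          h₂ (X := w₁.map (Letter.map fun a : Fin n => Fin.ofNat (n + m + 1)
            (L.idxOf (Sum.inl (a : ℕ))))) (Y := []) (by rwa [List.append_nil]))
  · rw [cls_of_not k d hd₁, map_zero, LinearMap.zero_apply, opWord]
    refine (List.sum_eq_zero fun x hx => ?_).symm
    obtain ⟨L, hL, rfl⟩ := List.mem_map.1 hx
    have hp := K.perm _ _ L hL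
    cases n with
    | zero =>
      refine absurd ?_ hd₁
      have : w₁ = [] := eq_nil_of_zero _
      rw [this]
      exact isDiagram_nil
    | succ n =>
      have hl : L.length = (n + m) + 1 := by
        rw [length_of_perm_labels hp]
        omega
      rw [hl, natCls_append_map]
      refine cls_of_not k d fun h => hd₁ (isDiagram_of_map (ofNat_idxOf_injective hl
        inl_injective fun a : Fin (n + 1) => hp.mem_iff.2 (List.mem_append_left _ (mem_inls a)))
        h₁ (X := []) (by rwa [List.nil_append]))

end Operation

end KnotDiagram

end

noncomputable section

namespace KnotDiagram

open Letter

/-! ### Half shuffles and joined shuffles of diagrams -/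

section Families

variable {α M : Type*} [AddCommGroup M]

/-- The shuffles starting with the two heads. -/
def joinShuffles : List α → List α → List (List α)
  | a :: u, b :: w => (shuffles u w).map fun L => a :: b :: L
  | _, _ => []

/-- The shuffles starting with the two heads followed by the second entry of the first list. -/
def joinHalfShuffles : List α → List α → List (List α)
  | a :: u, b :: w => (halfShuffles u w).map fun L => a :: b :: L
  | _, _ => []

theorem perm_cons_cons {a b : α} {u w L : List α} (h : L.Perm (u ++ w)) :
    (a :: b :: L).Perm (a :: u ++ b :: w) :=
  ((h.cons b).trans List.perm_middle.symm).cons a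

theorem perm_of_mem_joinShuffles {u w L : List α} (h : L ∈ joinShuffles u w) :
    L.Perm (u ++ w) := by
  match u, w with
  | [], w => simp [joinShuffles] at h
  | a :: u, [] => simp [joinShuffles] at h
  | a :: u, b :: w =>
    obtain ⟨L, h', rfl⟩ := List.mem_map.1 h
    exact perm_cons_cons (perm_of_mem_shuffles h')

theorem perm_of_mem_joinHalfShuffles {u w L : List α} (h : L ∈ joinHalfShuffles u w) :
    L.Perm (u ++ w) := by
  match u, w with
  | [], w => simp [joinHalfShuffles] at h
  | a :: u, [] => simp [joinHalfShuffles] at h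
  | a :: u, b :: w =>
    obtain ⟨L, h', rfl⟩ := List.mem_map.1 h
    exact perm_cons_cons (perm_of_mem_halfShuffles h')

/-- The family of half shuffles. -/
def halfFamily : ShuffleFamily := ⟨halfShuffles, fun _ _ _ => perm_of_mem_halfShuffles⟩

/-- The family of the shuffles starting with the two heads. -/
def joinFamily : ShuffleFamily := ⟨joinShuffles, fun _ _ _ => perm_of_mem_joinShuffles⟩

/-- The family of the shuffles starting with the two heads and the second entry of the first
list. -/
def joinHalfFamily : ShuffleFamily :=
  ⟨joinHalfShuffles, fun _ _ _ => perm_of_mem_joinHalfShuffles⟩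

/-- A function of lists which is antisymmetric in its first argument. -/
def IsAntisymm (c : List α → List α → M) : Prop :=
  ∀ X Y a b L, L ≠ [] → c (X ++ a :: b :: Y) L = -c (X ++ b :: a :: Y) L

theorem IsAntisymm.move {c : List α → List α → M} (hc : IsAntisymm c) (X u w : List α) (b : α)
    {L : List α} (hL : L ≠ []) :
    c (X ++ (u ++ b :: w)) L = (-1 : ℤ) ^ u.length • c (X ++ b :: (u ++ w)) L := by
  induction u generalizing X with
  | nil => simp
  | cons a u ih =>
    have h1 := ih (X ++ [a])
    have h2 := hc X (u ++ w) a b L hL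
    simp only [List.append_assoc, List.cons_append, List.nil_append] at h1 h2 ⊢
    rw [h1, h2, List.length_cons, pow_succ, mul_neg_one, neg_smul, smul_neg]

theorem IsAntisymm.cons {c : List α → List α → M} (hc : IsAntisymm c) (a : α) (v : List α) :
    IsAntisymm fun Y L => c (a :: Y) (v ++ a :: L) := fun X Y x y L _ =>
  hc (a :: X) Y x y _ (by simp)

/-- The first argument of `c` is the order in which the point letters are written, the second the
order of the points on the line. An unsigned sum with the point letters written as in the
concatenation becomes a signed one when they are rewritten in the order on the line; the recursion
of `sh` records the resulting sign. -/
theorem sum_shuffles {c : List α → List α → M} (hc : IsAntisymm c) (u w : List α) :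
    ((shuffles u w).map (c (u ++ w))).sum = sh u w fun L => c L L := by
  induction u, w using shuffle_induction generalizing c with
  | left w => simp
  | right u => simp
  | cons a b u w h1 h2 =>
    have g1 := h1 (hc.cons a [])
    have g2 := h2 (hc.cons b [])
    rw [sh_cons_cons, shuffles_cons_cons, List.map_append, List.sum_append, List.map_map,
      List.map_map]
    simp only [List.nil_append] at g1 g2
    rw [← g1, ← g2]
    congr 1
    rw [← List.length_cons (a := a), ← zsmulAddGroupHom_apply, map_list_sum, List.map_map]
    congr 1
    refine List.map_congr_left fun L _ => ?_
    exact hc.move [] (a :: u) w b (List.cons_ne_nil b L)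

theorem sum_halfShuffles {c : List α → List α → M} (hc : IsAntisymm c) (u w : List α) :
    ((halfShuffles u w).map (c (u ++ w))).sum = hs u w fun L => c L L := by
  cases u with
  | nil => simp [halfShuffles, hs]
  | cons a u =>
    have := sum_shuffles (hc.cons a []) u w
    rw [hs, halfShuffles, List.map_map]
    exact this

/-- The extra sign arises from moving `b` past the tail `u` to the second place. -/
theorem sum_joinShuffles {c : List α → List α → M} (hc : IsAntisymm c) (a b : α) (u w : List α) :
    ((joinShuffles (a :: u) (b :: w)).map (c ((a :: u) ++ (b :: w)))).sum =
      (-1 : ℤ) ^ u.length • sh u w fun L => c (a :: b :: L) (a :: b :: L) := by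
  have := sum_shuffles ((hc.cons a []).cons b []) u w
  simp only [List.nil_append] at this
  rw [← this, joinShuffles, List.map_map, ← zsmulAddGroupHom_apply, map_list_sum, List.map_map]
  congr 1
  refine List.map_congr_left fun L _ => ?_
  exact hc.move [a] u w b (List.cons_ne_nil a _)

theorem sum_joinHalfShuffles {c : List α → List α → M} (hc : IsAntisymm c) (a b : α)
    (u w : List α) :
    ((joinHalfShuffles (a :: u) (b :: w)).map (c ((a :: u) ++ (b :: w)))).sum =
      (-1 : ℤ) ^ u.length • hs u w fun L => c (a :: b :: L) (a :: b :: L) := by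
  have := sum_halfShuffles ((hc.cons a []).cons b []) u w
  simp only [List.nil_append] at this
  rw [← this, joinHalfShuffles, List.map_map, ← zsmulAddGroupHom_apply, map_list_sum, List.map_map]
  congr 1
  refine List.map_congr_left fun L _ => ?_
  exact hc.move [a] u w b (List.cons_ne_nil a _)

end Families

/-! ### Products of diagrams in normal form -/

section Product

variable {Q : Type}

/-- Shuffles keep the order of the blocks of each factor, so edges remain oriented from left to
right. The bound on `q` is needed because `idx` carries no order information for labels outside all
blocks. -/
theorem idx_le_of_sublist {L₁ L : List (Set Q)} (hs : L₁.Sublist L) (hL : L.Pairwise Disjoint)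
    {p q : Q} (hpq : idx L₁ p ≤ idx L₁ q) (hq : idx L₁ q < L₁.length) : idx L p ≤ idx L q := by
  induction hs with
  | slnil => simp at hq
  | @cons L₁ L B hs ih =>
    rw [List.pairwise_cons] at hL
    have hm : ∀ x, idx L₁ x < L₁.length → x ∉ B := fun x hx hxB => by
      obtain ⟨C, hC, hxC⟩ := idx_lt_iff.1 hx
      exact Set.disjoint_left.1 (hL.1 C (hs.subset hC)) hxB hxC
    rw [idx_cons_of_not_mem (hm p (hpq.trans_lt hq)), idx_cons_of_not_mem (hm q hq)]
    exact Nat.succ_le_succ (ih hL.2 hpq hq)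
  | @cons_cons L₁ L B hs ih =>
    rw [List.pairwise_cons] at hL
    by_cases hp : p ∈ B
    · rw [idx_cons_of_mem hp]
      exact Nat.zero_le _
    · by_cases hqB : q ∈ B
      · rw [idx_cons_of_mem hqB, idx_cons_of_not_mem hp] at hpq
        omega
      · rw [idx_cons_of_not_mem hp, idx_cons_of_not_mem hqB] at *
        rw [List.length_cons] at hq
        exact Nat.succ_le_succ (ih hL.2 (by omega) (by omega))

theorem Fits.append {V₁ V₂ : List (Q × Q)} {L₁ L₂ L : List (Set Q)} (h₁ : Fits V₁ L₁)
    (h₂ : Fits V₂ L₂) (hd : (L₁ ++ L₂).Pairwise Disjoint) (hp : L.Perm (L₁ ++ L₂))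
    (hs₁ : L₁.Sublist L) (hs₂ : L₂.Sublist L) : Fits (V₁ ++ V₂) L := by
  have hL : L.Pairwise Disjoint := (hp.pairwise_iff fun h => h.symm).2 hd
  refine ⟨hL, fun e he => ?_, fun e he => ?_, fun B hB => ?_⟩
  · rw [idx_lt_iff]
    rcases List.mem_append.1 he with he | he
    · obtain ⟨B, hB, h⟩ := idx_lt_iff.1 (h₁.idx_lt e he)
      exact ⟨B, hs₁.subset hB, h⟩
    · obtain ⟨B, hB, h⟩ := idx_lt_iff.1 (h₂.idx_lt e he)
      exact ⟨B, hs₂.subset hB, h⟩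
  · rcases List.mem_append.1 he with he | he
    · exact idx_le_of_sublist hs₁ hL (h₁.idx_le e he) (h₁.idx_lt e he)
    · exact idx_le_of_sublist hs₂ hL (h₂.idx_le e he) (h₂.idx_lt e he)
  · rcases List.mem_append.1 (hp.subset hB) with hB | hB
    · obtain ⟨e, he, h⟩ := h₁.covering B hB
      exact ⟨e, List.mem_append_left _ he, h⟩
    · obtain ⟨e, he, h⟩ := h₂.covering B hB
      exact ⟨e, List.mem_append_right _ he, h⟩

variable (k : Type*) [CommRing k] (d : ℕ)

theorem exists_nf_of_lt (n : ℕ) (v : List (ℕ × ℕ)) (h₁ : ∀ e ∈ v, e.1 ≤ e.2)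
    (h₂ : ∀ e ∈ v, e.2 < n) (h₃ : ∀ j < n, ∃ e ∈ v, e.1 = j ∨ e.2 = j) :
    ∃ v' : List (Fin n × Fin n), normalCls k d n v = cls k d (nf v') ∧
      v'.map (Prod.map Fin.val Fin.val) = v ∧ Covering v' := by
  cases n with
  | zero =>
    have : v = [] := List.eq_nil_iff_forall_not_mem.2 fun e he => by simpa using h₂ e he
    subst this
    exact ⟨[], rfl, rfl, fun a => a.elim0⟩
  | succ n =>
    refine ⟨v.map (Prod.map (Fin.ofNat (n + 1)) (Fin.ofNat (n + 1))), rfl, ?_, fun a => ?_⟩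
    · rw [List.map_map]
      conv_rhs => rw [← List.map_id v]
      refine List.map_congr_left fun e he => ?_
      have g1 := h₁ e he
      have g2 := h₂ e he
      refine Prod.ext ?_ ?_
      · exact Nat.mod_eq_of_lt (by omega)
      · exact Nat.mod_eq_of_lt g2
    · obtain ⟨e, he, h⟩ := h₃ a a.isLt
      refine ⟨_, List.mem_map.2 ⟨e, he, rfl⟩, ?_⟩
      refine h.imp (fun h => ?_) (fun h => ?_)
      · simp [h]
      · simp [h]

theorem Fits.exists_nf {V : List (Q × Q)} {L : List (Set Q)} (h : Fits V L) :
    ∃ v : List (Fin L.length × Fin L.length), blockCls k d V L = cls k d (nf v) ∧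
      v.map (Prod.map Fin.val Fin.val) = V.map (Prod.map (idx L) (idx L)) ∧ Covering v := by
  refine exists_nf_of_lt k d _ _ ?_ ?_ ?_
  · intro e he
    obtain ⟨e, he', rfl⟩ := List.mem_map.1 he
    exact h.idx_le e he'
  · intro e he
    obtain ⟨e, he', rfl⟩ := List.mem_map.1 he
    exact h.idx_lt e he'
  · intro j hj
    obtain ⟨e, he, h'⟩ := h.covering (L[j]) (List.getElem_mem _)
    exact ⟨_, List.mem_map.2 ⟨e, he, rfl⟩, h'.imp (idx_eq h.disjoint _) (idx_eq h.disjoint _)⟩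

theorem isFull_nf {n : ℕ} {v : List (Fin n × Fin n)} (hc : Covering v) : IsFull (nf v) := by
  refine ⟨fun a => by simp [nf, pts], fun a => ?_⟩
  obtain ⟨⟨x, y⟩, he, ha⟩ := hc a
  simp only [chord_mem_nf, ast_mem_nf]
  grind

/-- The monomial with the points `Y`, in this order, and with the edges of two diagrams, when the
points are numbered by the list `L`. -/
def mixedCls {n m : ℕ} (v₁ : List (Fin n × Fin n)) (v₂ : List (Fin m × Fin m))
    (Y L : List (ℕ ⊕ ℕ)) : TStar k d :=
  natCls k d L.length (Y.map (fun y => pt (L.idxOf y)) ++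
    (v₁.map (fun e => edge (L.idxOf (Sum.inl (e.1 : ℕ)), L.idxOf (Sum.inl (e.2 : ℕ)))) ++
      v₂.map (fun e => edge (L.idxOf (Sum.inr (e.1 : ℕ)), L.idxOf (Sum.inr (e.2 : ℕ))))))

/-- An empty list must be excluded in `IsAntisymm`, since `natCls` at length zero ignores the
monomial and would not change sign. -/
theorem isAntisymm_mixedCls {n m : ℕ} (v₁ : List (Fin n × Fin n)) (v₂ : List (Fin m × Fin m)) :
    IsAntisymm (mixedCls k d v₁ v₂) := by
  intro X Y a b L hL
  obtain ⟨N, hN⟩ : ∃ N, L.length = N + 1 :=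
    Nat.exists_eq_succ_of_ne_zero (by simpa using hL)
  rw [mixedCls, mixedCls, hN, natCls, natCls]
  simp only [List.map_append, List.map_cons, Letter.map, List.append_assoc, List.cons_append]
  have := cls_swap_pt k d (n := N + 1)
  simp only [List.append_assoc, List.cons_append, List.nil_append] at this
  exact this _ _ _ _

theorem map_ofNat_edge {N x y : ℕ} (hx : x < N + 1) (hy : y < N + 1) :
    (edge (x, y)).map (Fin.ofNat (N + 1)) = edge (Fin.ofNat (N + 1) x, Fin.ofNat (N + 1) y) := by
  refine edge_map _ _ fun h => ?_
  have := congrArg Fin.val h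
  simpa [Nat.mod_eq_of_lt hx, Nat.mod_eq_of_lt hy] using this

theorem map_map_edge {n N : ℕ} {α : Type} (L : List α) [BEq α] [LawfulBEq α]
    (hN : L.length = N + 1) {f : Fin n → α} (hf : ∀ i, f i ∈ L) (v : List (Fin n × Fin n)) :
    (v.map (fun e => edge (L.idxOf (f e.1), L.idxOf (f e.2)))).map (Letter.map (Fin.ofNat (N + 1))) =
      (v.map (Prod.map (fun a => Fin.ofNat (N + 1) (L.idxOf (f a)))
        (fun a => Fin.ofNat (N + 1) (L.idxOf (f a))))).map edge := by
  rw [List.map_map, List.map_map]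
  refine List.map_congr_left fun e _ => ?_
  exact map_ofNat_edge (hN ▸ List.idxOf_lt_length_iff.2 (hf _))
    (hN ▸ List.idxOf_lt_length_iff.2 (hf _))

/-- The concatenation of two normal forms has the edges of the first factor in front of the points
of the second. Moving them behind these `m` points is the only source of sign. -/
theorem opWord_nf (K : ShuffleFamily) {n m : ℕ} (hn : 0 < n) (v₁ : List (Fin n × Fin n))
    (v₂ : List (Fin m × Fin m)) : opWord k d K (nf v₁) (nf v₂) =
      (-1 : ℤ) ^ ((d + 1) * v₁.length * m) •
        ((K.lists (inls n) (inrs m)).map (mixedCls k d v₁ v₂ (inls n ++ inrs m))).sum := by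
  rw [opWord, ← zsmulAddGroupHom_apply, map_list_sum, List.map_map]
  congr 1
  refine List.map_congr_left fun L hL => ?_
  have hp := K.perm _ _ L hL
  obtain ⟨N, hN⟩ : ∃ N, L.length = N + 1 :=
    ⟨n + m - 1, by rw [length_of_perm_labels hp]; omega⟩
  have hm₁ : ∀ a : Fin n, Sum.inl (a : ℕ) ∈ L := fun a =>
    hp.mem_iff.2 (List.mem_append_left _ (mem_inls a))
  have hm₂ : ∀ a : Fin m, Sum.inr (a : ℕ) ∈ L := fun a =>
    hp.mem_iff.2 (List.mem_append_right _ (mem_inrs a))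
  have hi₁ := ofNat_idxOf_injective hN inl_injective hm₁
  have hi₂ := ofNat_idxOf_injective hN inr_injective hm₂
  have e₁ : (v₁.map edge).map (Letter.map fun a : Fin n =>
      Fin.ofNat (N + 1) (L.idxOf (Sum.inl (a : ℕ)))) = (v₁.map (Prod.map
        (fun a : Fin n => Fin.ofNat (N + 1) (L.idxOf (Sum.inl (a : ℕ))))
        (fun a : Fin n => Fin.ofNat (N + 1) (L.idxOf (Sum.inl (a : ℕ)))))).map edge := by
    rw [List.map_map, List.map_map]
    exact List.map_congr_left fun e _ => edge_map _ e fun h => hi₁ h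
  have e₂ : (v₂.map edge).map (Letter.map fun a : Fin m =>
      Fin.ofNat (N + 1) (L.idxOf (Sum.inr (a : ℕ)))) = (v₂.map (Prod.map
        (fun a : Fin m => Fin.ofNat (N + 1) (L.idxOf (Sum.inr (a : ℕ))))
        (fun a : Fin m => Fin.ofNat (N + 1) (L.idxOf (Sum.inr (a : ℕ)))))).map edge := by
    rw [List.map_map, List.map_map]
    exact List.map_congr_left fun e _ => edge_map _ e fun h => hi₂ h
  have hmix := cls_swap_edges_pts k d (n := N + 1)
    ((pts n).map (Letter.map fun a : Fin n => Fin.ofNat (N + 1) (L.idxOf (Sum.inl (a : ℕ)))))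
    ((v₂.map (Prod.map (fun a : Fin m => Fin.ofNat (N + 1) (L.idxOf (Sum.inr (a : ℕ))))
        (fun a : Fin m => Fin.ofNat (N + 1) (L.idxOf (Sum.inr (a : ℕ)))))).map edge)
    (v₁.map (Prod.map (fun a : Fin n => Fin.ofNat (N + 1) (L.idxOf (Sum.inl (a : ℕ))))
        (fun a : Fin n => Fin.ofNat (N + 1) (L.idxOf (Sum.inl (a : ℕ))))))
    (fun a : Fin m => Fin.ofNat (N + 1) (L.idxOf (Sum.inr (a : ℕ)))) (List.finRange m)
  rw [Function.comp_apply, zsmulAddGroupHom_apply, mixedCls, hN, natCls_append_map, natCls, nf, nf,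
    List.map_append, List.map_append, e₁, e₂]
  simp only [List.map_append, map_map_edge L hN hm₁, map_map_edge L hN hm₂, List.length_map,
    List.length_finRange, List.append_assoc] at hmix ⊢
  have p₁ : (inls n).map (fun y => (pt (L.idxOf y) : Letter ℕ)) = (List.finRange n).map
      fun a : Fin n => pt (L.idxOf (Sum.inl (a : ℕ))) := by
    rw [inls, List.map_map, ← List.map_coe_finRange_eq_range, List.map_map]
    rfl
  have p₂ : (inrs m).map (fun y => (pt (L.idxOf y) : Letter ℕ)) = (List.finRange m).map
      fun a : Fin m => pt (L.idxOf (Sum.inr (a : ℕ))) := by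
    rw [inrs, List.map_map, ← List.map_coe_finRange_eq_range, List.map_map]
    rfl
  rw [p₁, p₂]
  simp only [pts, List.map_map, Function.comp_def, Letter.map] at hmix ⊢
  exact hmix

/-- When the point letters are written in the order of the points on the line, the mixed monomial is
itself in normal form, and its points are the blocks named by `g`. -/
theorem mixedCls_self {V₁ V₂ : List (Q × Q)} {L₁ L₂ : List (Set Q)} (h₁ : Fits V₁ L₁)
    (h₂ : Fits V₂ L₂)
    {v₁ : List (Fin L₁.length × Fin L₁.length)} {v₂ : List (Fin L₂.length × Fin L₂.length)}
    (hv₁ : v₁.map (Prod.map Fin.val Fin.val) = V₁.map (Prod.map (idx L₁) (idx L₁)))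
    (hv₂ : v₂.map (Prod.map Fin.val Fin.val) = V₂.map (Prod.map (idx L₂) (idx L₂)))
    {g : ℕ ⊕ ℕ → Set Q} (hg₁ : ∀ i (hi : i < L₁.length), g (Sum.inl i) = L₁[i])
    (hg₂ : ∀ i (hi : i < L₂.length), g (Sum.inr i) = L₂[i]) {L : List (ℕ ⊕ ℕ)}
    (hp : L.Perm (inls L₁.length ++ inrs L₂.length))
    (hgp : (L.map g).Pairwise Disjoint) :
    mixedCls k d v₁ v₂ L L = blockCls k d (V₁ ++ V₂) (L.map g) := by
  have hnd : L.Nodup := hp.nodup_iff.2 (nodup_labels _ _)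
  -- Disjointness makes the block containing a label unique, so its position is that of its name in
  -- `L`.
  have key : ∀ (x : ℕ ⊕ ℕ) (p : Q), x ∈ L → p ∈ g x → idx (L.map g) p = L.idxOf x := by
    intro x p hx hpx
    have hlt : L.idxOf x < L.length := List.idxOf_lt_length_iff.2 hx
    refine idx_eq hgp (by simpa using hlt) ?_
    rw [List.getElem_map, List.getElem_idxOf]
    exact hpx
  have key₁ : ∀ p, idx L₁ p < L₁.length → idx (L.map g) p = L.idxOf (Sum.inl (idx L₁ p)) :=
    fun p hlt => key _ _ (hp.mem_iff.2 (List.mem_append_left _ (mem_inls ⟨_, hlt⟩)))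
      (by rw [hg₁ _ hlt]; exact mem_getElem_idx hlt)
  have key₂ : ∀ p, idx L₂ p < L₂.length → idx (L.map g) p = L.idxOf (Sum.inr (idx L₂ p)) :=
    fun p hlt => key _ _ (hp.mem_iff.2 (List.mem_append_right _ (mem_inrs ⟨_, hlt⟩)))
      (by rw [hg₂ _ hlt]; exact mem_getElem_idx hlt)
  have e₁ : v₁.map (fun e => edge (L.idxOf (Sum.inl (e.1 : ℕ)), L.idxOf (Sum.inl (e.2 : ℕ)))) =
      (V₁.map (Prod.map (idx (L.map g)) (idx (L.map g)))).map edge := by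
    have := congrArg (List.map fun e : ℕ × ℕ => edge (L.idxOf (Sum.inl e.1), L.idxOf (Sum.inl e.2))) hv₁
    rw [List.map_map, List.map_map] at this
    rw [List.map_map]
    refine this.trans (List.map_congr_left fun e he => ?_)
    have g2 := h₁.idx_lt e he
    have g1 := (h₁.idx_le e he).trans_lt g2
    simp only [Function.comp_apply, Prod.map, key₁ _ g1, key₁ _ g2]
  have e₂ : v₂.map (fun e => edge (L.idxOf (Sum.inr (e.1 : ℕ)), L.idxOf (Sum.inr (e.2 : ℕ)))) =
      (V₂.map (Prod.map (idx (L.map g)) (idx (L.map g)))).map edge := by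
    have := congrArg (List.map fun e : ℕ × ℕ => edge (L.idxOf (Sum.inr e.1), L.idxOf (Sum.inr e.2))) hv₂
    rw [List.map_map, List.map_map] at this
    rw [List.map_map]
    refine this.trans (List.map_congr_left fun e he => ?_)
    have g2 := h₂.idx_lt e he
    have g1 := (h₂.idx_le e he).trans_lt g2
    simp only [Function.comp_apply, Prod.map, key₂ _ g1, key₂ _ g2]
  have e₃ : L.map (fun y => (pt (L.idxOf y) : Letter ℕ)) = (List.range L.length).map pt := by
    refine List.ext_getElem (by simp) fun i hi _ => ?_
    simp only [List.length_map] at hi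
    simp [hnd.idxOf_getElem]
  rw [mixedCls, e₁, e₂, e₃, blockCls, List.length_map, ← List.map_append, ← List.map_append]
  have hlt : ∀ e ∈ (V₁ ++ V₂).map (Prod.map (idx (L.map g)) (idx (L.map g))),
      e.1 < L.length ∧ e.2 < L.length := by
    intro e he
    obtain ⟨e, he', rfl⟩ := List.mem_map.1 he
    simp only [Prod.map]
    rcases List.mem_append.1 he' with he' | he'
    · have g2 := h₁.idx_lt e he'
      have g1 := (h₁.idx_le e he').trans_lt g2
      rw [key₁ _ g1, key₁ _ g2]
      exact ⟨List.idxOf_lt_length_iff.2 (hp.mem_iff.2 (List.mem_append_left _ (mem_inls ⟨_, g1⟩))),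
        List.idxOf_lt_length_iff.2 (hp.mem_iff.2 (List.mem_append_left _ (mem_inls ⟨_, g2⟩)))⟩
    · have g2 := h₂.idx_lt e he'
      have g1 := (h₂.idx_le e he').trans_lt g2
      rw [key₂ _ g1, key₂ _ g2]
      exact ⟨List.idxOf_lt_length_iff.2 (hp.mem_iff.2 (List.mem_append_right _ (mem_inrs ⟨_, g1⟩))),
        List.idxOf_lt_length_iff.2 (hp.mem_iff.2 (List.mem_append_right _ (mem_inrs ⟨_, g2⟩)))⟩
  generalize (V₁ ++ V₂).map (Prod.map (idx (L.map g)) (idx (L.map g))) = v at hlt ⊢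
  generalize L.length = N at hlt ⊢
  cases N with
  | zero => rfl
  | succ N =>
    rw [natCls, normalCls, nf, List.map_append]
    congr 2
    · rw [pts, List.map_map, ← List.map_coe_finRange_eq_range, List.map_map]
      refine List.map_congr_left fun a _ => ?_
      simp [Letter.map]
    · rw [List.map_map, List.map_map]
      exact List.map_congr_left fun e he => map_ofNat_edge (hlt e he).1 (hlt e he).2

end Product

end KnotDiagram

end

noncomputable section

namespace KnotDiagram

open Letter

/-! ### The operations on diagrams with blocks of labels -/

section Supp

variable {Q : Type}

/-- The labels occurring in a list of blocks. -/
def supp (L : List (Set Q)) : Set Q := {p | ∃ B ∈ L, p ∈ B}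

theorem supp_cons (a : Set Q) (L : List (Set Q)) : supp (a :: L) = a ∪ supp L := by
  ext p
  simp [supp]

theorem supp_append (L L' : List (Set Q)) : supp (L ++ L') = supp L ∪ supp L' := by
  ext p
  simp [supp, or_and_right, exists_or]

theorem supp_perm {L L' : List (Set Q)} (h : L.Perm L') : supp L = supp L' := by
  ext p
  simp [supp, h.mem_iff]

theorem subset_supp {L : List (Set Q)} {B : Set Q} (hB : B ∈ L) : B ⊆ supp L :=
  fun _ hp => ⟨B, hB, hp⟩

theorem supp_joinAt (i : ℕ) (L : List (Set Q)) : supp (joinAt i L) = supp L := by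
  induction L generalizing i with
  | nil => simp [joinAt]
  | cons a L ih =>
    cases L with
    | nil => simp [joinAt]
    | cons b u =>
      cases i with
      | zero =>
        rw [joinAt, supp_cons, supp_cons, supp_cons, ← Set.union_assoc]
        rfl
      | succ i => rw [joinAt, supp_cons, ih, ← supp_cons]

theorem pairwise_append_of_supp {L₁ L₂ : List (Set Q)} (h₁ : L₁.Pairwise Disjoint)
    (h₂ : L₂.Pairwise Disjoint) (hd : Disjoint (supp L₁) (supp L₂)) :
    (L₁ ++ L₂).Pairwise Disjoint :=
  List.pairwise_append.2 ⟨h₁, h₂, fun _ hA _ hB => hd.mono (subset_supp hA) (subset_supp hB)⟩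

theorem Fits.halfShuffle {V₁ V₂ : List (Q × Q)} {L₁ L₂ L : List (Set Q)} (h₁ : Fits V₁ L₁)
    (h₂ : Fits V₂ L₂) (hd : Disjoint (supp L₁) (supp L₂)) (hL : L ∈ halfShuffles L₁ L₂) :
    Fits (V₁ ++ V₂) L :=
  h₁.append h₂ (pairwise_append_of_supp h₁.disjoint h₂.disjoint hd) (perm_of_mem_halfShuffles hL)
    (sublist_of_mem_halfShuffles hL).1 (sublist_of_mem_halfShuffles hL).2

theorem Fits.joinHeads {V₁ V₂ : List (Q × Q)} {a b : Set Q} {u w L : List (Set Q)}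
    (h₁ : Fits V₁ (a :: u)) (h₂ : Fits V₂ (b :: w)) (hd : Disjoint (supp (a :: u)) (supp (b :: w)))
    (hL : L ∈ shuffles u w) : Fits (V₁ ++ V₂) ((a ⊔ b) :: L) := by
  refine Fits.joinHead (h₁.append h₂ (pairwise_append_of_supp h₁.disjoint h₂.disjoint hd)
    (perm_cons_cons (perm_of_mem_shuffles hL)) ?_ ?_)
  · exact ((sublist_of_mem_shuffles hL).1.cons b).cons_cons a
  · exact ((sublist_of_mem_shuffles hL).2.cons_cons b).cons a

end Supp

section Packaged

variable {Q : Type} (k : Type*) [CommRing k] (d : ℕ)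

/-- The block with a given number in one of two lists of blocks. -/
def blockAt (L₁ L₂ : List (Set Q)) : ℕ ⊕ ℕ → Set Q :=
  Sum.elim (fun i => L₁.getD i ∅) (fun i => L₂.getD i ∅)

theorem map_getD_range {α : Type*} (L : List α) (x : α) :
    (List.range L.length).map (fun i => L.getD i x) = L := by
  refine List.ext_getElem (by simp) fun i hi hi' => ?_
  simp [hi']

theorem map_blockAt_inls (L₁ L₂ : List (Set Q)) : (inls L₁.length).map (blockAt L₁ L₂) = L₁ := by
  rw [inls, List.map_map]
  exact map_getD_range L₁ ∅

theorem map_blockAt_inrs (L₁ L₂ : List (Set Q)) : (inrs L₂.length).map (blockAt L₁ L₂) = L₂ := by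
  rw [inrs, List.map_map]
  exact map_getD_range L₂ ∅

/-- One antisymmetric function `c` and one sign serve all families of shuffles, so the formulas for
`half`, `join` and `joinHalf` follow from the same statement. -/
theorem exists_op_blockCls {V₁ V₂ : List (Q × Q)} {L₁ L₂ : List (Set Q)} (h₁ : Fits V₁ L₁)
    (h₂ : Fits V₂ L₂) (hd : Disjoint (supp L₁) (supp L₂)) (hL : L₁ ≠ []) :
    ∃ c : List (ℕ ⊕ ℕ) → List (ℕ ⊕ ℕ) → TStar k d, IsAntisymm c ∧
      (∀ K : ShuffleFamily, TStar.op k d K (blockCls k d V₁ L₁) (blockCls k d V₂ L₂) =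
        (-1 : ℤ) ^ ((d + 1) * V₁.length * L₂.length) •
          ((K.lists (inls L₁.length) (inrs L₂.length)).map
            (c (inls L₁.length ++ inrs L₂.length))).sum) ∧
      ∀ L, L.Perm (inls L₁.length ++ inrs L₂.length) →
        c L L = blockCls k d (V₁ ++ V₂) (L.map (blockAt L₁ L₂)) := by
  obtain ⟨v₁, e₁, hv₁, c₁⟩ := h₁.exists_nf k d
  obtain ⟨v₂, e₂, hv₂, c₂⟩ := h₂.exists_nf k d
  refine ⟨mixedCls k d v₁ v₂, isAntisymm_mixedCls k d v₁ v₂, fun K => ?_, fun L hp => ?_⟩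
  · rw [e₁, e₂, op_cls k d K (isFull_nf c₁) (isFull_nf c₂), opWord_nf k d K
      (List.length_pos_iff.2 hL)]
    have := congrArg List.length hv₁
    rw [List.length_map, List.length_map] at this
    rw [this]
  · refine mixedCls_self k d h₁ h₂ hv₁ hv₂ (fun i hi => ?_) (fun i hi => ?_) hp ?_
    · simp [blockAt, hi]
    · simp [blockAt, hi]
    · have hp' := hp.map (blockAt L₁ L₂)
      rw [List.map_append, map_blockAt_inls, map_blockAt_inrs] at hp'
      exact (hp'.pairwise_iff fun h => h.symm).2
        (pairwise_append_of_supp h₁.disjoint h₂.disjoint hd)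

/-- The half shuffle product: the left-most point of the first factor is the left-most point. -/
def TStar.half : TStar k d →ₗ[k] TStar k d →ₗ[k] TStar k d := TStar.op k d halfFamily

/-- The sum of the shuffles in which the left-most points are joined. -/
def TStar.join : TStar k d →ₗ[k] TStar k d →ₗ[k] TStar k d :=
  (TStar.op k d joinFamily).compr₂ (TStar.glueNext k d 0)

/-- The sum of the shuffles in which the left-most points are joined and the next point is that of
the first factor. -/
def TStar.joinHalf : TStar k d →ₗ[k] TStar k d →ₗ[k] TStar k d :=
  (TStar.op k d joinHalfFamily).compr₂ (TStar.glueNext k d 0)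

theorem half_blockCls {V₁ V₂ : List (Q × Q)} {L₁ L₂ : List (Set Q)} (h₁ : Fits V₁ L₁)
    (h₂ : Fits V₂ L₂) (hd : Disjoint (supp L₁) (supp L₂)) (hL : L₁ ≠ []) :
    TStar.half k d (blockCls k d V₁ L₁) (blockCls k d V₂ L₂) =
      (-1 : ℤ) ^ ((d + 1) * V₁.length * L₂.length) • hs L₁ L₂ (blockCls k d (V₁ ++ V₂)) := by
  obtain ⟨c, hc, hop, hcc⟩ := exists_op_blockCls k d h₁ h₂ hd hL
  rw [TStar.half, hop, halfFamily, sum_halfShuffles hc, hs_congr fun L hL' =>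
    hcc L (perm_of_mem_halfShuffles hL'), ← hs_map, map_blockAt_inls, map_blockAt_inrs]

/-- Without points in the second factor there is no second head to be joined. -/
theorem join_nil {V₁ V₂ : List (Q × Q)} {L₁ : List (Set Q)} (h₁ : Fits V₁ L₁)
    (h₂ : Fits V₂ []) (hL : L₁ ≠ []) :
    TStar.join k d (blockCls k d V₁ L₁) (blockCls k d V₂ []) = 0 := by
  obtain ⟨c, hc, hop, hcc⟩ := exists_op_blockCls k d h₁ h₂ (by simp [supp]) hL
  rw [TStar.join, LinearMap.compr₂_apply, hop, joinFamily]
  obtain ⟨a, u, rfl⟩ := List.exists_cons_of_ne_nil hL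
  simp [inls, inrs, List.range_succ_eq_map, joinShuffles]

theorem exists_inls_cons (a : Set Q) (u : List (Set Q)) :
    ∃ x y, inls (a :: u).length = x :: y ∧ y.length = u.length :=
  ⟨_, _, by rw [inls, List.length_cons, List.range_succ_eq_map, List.map_cons], by simp⟩

theorem exists_inrs_cons (a : Set Q) (u : List (Set Q)) :
    ∃ x y, inrs (a :: u).length = x :: y ∧ y.length = u.length :=
  ⟨_, _, by rw [inrs, List.length_cons, List.range_succ_eq_map, List.map_cons], by simp⟩

/-- The exponent has two sources: the edges of the first factor pass the points of the second, and
the head `b` passes the tail `u`. -/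
theorem join_blockCls {V₁ V₂ : List (Q × Q)} {a b : Set Q} {u w : List (Set Q)}
    (h₁ : Fits V₁ (a :: u)) (h₂ : Fits V₂ (b :: w))
    (hd : Disjoint (supp (a :: u)) (supp (b :: w))) :
    TStar.join k d (blockCls k d V₁ (a :: u)) (blockCls k d V₂ (b :: w)) =
      (-1 : ℤ) ^ ((d + 1) * V₁.length * (b :: w).length + u.length) •
        sh u w fun L => blockCls k d (V₁ ++ V₂) ((a ⊔ b) :: L) := by
  obtain ⟨c, hc, hop, hcc⟩ := exists_op_blockCls k d h₁ h₂ hd (List.cons_ne_nil a u)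
  obtain ⟨x, U, hU, lU⟩ := exists_inls_cons a u
  obtain ⟨y, W, hW, -⟩ := exists_inrs_cons b w
  have m₁ := map_blockAt_inls (a :: u) (b :: w)
  have m₂ := map_blockAt_inrs (a :: u) (b :: w)
  rw [hU, List.map_cons, List.cons_eq_cons] at m₁
  rw [hW, List.map_cons, List.cons_eq_cons] at m₂
  rw [hU, hW] at hcc
  rw [TStar.join, LinearMap.compr₂_apply, hop, joinFamily, hU, hW]
  simp only
  rw [sum_joinShuffles hc, sh_congr fun L hL' => hcc _ (perm_cons_cons (perm_of_mem_shuffles hL')),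
    lU, smul_smul, ← pow_add, map_zsmul]
  simp only [List.map_cons, m₁.1, m₂.1]
  rw [← sh_map (blockAt (a :: u) (b :: w)) U W
    (fun L => blockCls k d (V₁ ++ V₂) (a :: b :: L)), m₁.2, m₂.2]
  congr 1
  rw [← LinearMap.toAddMonoidHom_coe, map_sh]
  refine sh_congr fun L hL => glueNext_zero_blockCls k d ?_
  exact h₁.append h₂ (pairwise_append_of_supp h₁.disjoint h₂.disjoint hd)
    (perm_cons_cons (perm_of_mem_shuffles hL))
    (((sublist_of_mem_shuffles hL).1.cons b).cons_cons a)
    (((sublist_of_mem_shuffles hL).2.cons_cons b).cons a)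

theorem joinHalf_blockCls {V₁ V₂ : List (Q × Q)} {a b : Set Q} {u w : List (Set Q)}
    (h₁ : Fits V₁ (a :: u)) (h₂ : Fits V₂ (b :: w))
    (hd : Disjoint (supp (a :: u)) (supp (b :: w))) :
    TStar.joinHalf k d (blockCls k d V₁ (a :: u)) (blockCls k d V₂ (b :: w)) =
      (-1 : ℤ) ^ ((d + 1) * V₁.length * (b :: w).length + u.length) •
        hs u w fun L => blockCls k d (V₁ ++ V₂) ((a ⊔ b) :: L) := by
  obtain ⟨c, hc, hop, hcc⟩ := exists_op_blockCls k d h₁ h₂ hd (List.cons_ne_nil a u)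
  obtain ⟨x, U, hU, lU⟩ := exists_inls_cons a u
  obtain ⟨y, W, hW, -⟩ := exists_inrs_cons b w
  have m₁ := map_blockAt_inls (a :: u) (b :: w)
  have m₂ := map_blockAt_inrs (a :: u) (b :: w)
  rw [hU, List.map_cons, List.cons_eq_cons] at m₁
  rw [hW, List.map_cons, List.cons_eq_cons] at m₂
  rw [hU, hW] at hcc
  rw [TStar.joinHalf, LinearMap.compr₂_apply, hop, joinHalfFamily, hU, hW]
  simp only
  rw [sum_joinHalfShuffles hc, hs_congr fun L hL' =>
    hcc _ (perm_cons_cons (perm_of_mem_halfShuffles hL')), lU, smul_smul, ← pow_add, map_zsmul]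
  simp only [List.map_cons, m₁.1, m₂.1]
  rw [← hs_map (blockAt (a :: u) (b :: w)) U W
    (fun L => blockCls k d (V₁ ++ V₂) (a :: b :: L)), m₁.2, m₂.2]
  congr 1
  rw [← LinearMap.toAddMonoidHom_coe, map_hs]
  refine hs_congr fun L hL => glueNext_zero_blockCls k d ?_
  exact h₁.append h₂ (pairwise_append_of_supp h₁.disjoint h₂.disjoint hd)
    (perm_cons_cons (perm_of_mem_halfShuffles hL))
    (((sublist_of_mem_halfShuffles hL).1.cons b).cons_cons a)
    (((sublist_of_mem_halfShuffles hL).2.cons_cons b).cons a)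

end Packaged

end KnotDiagram

end

noncomputable section

namespace KnotDiagram

open Letter

/-! ### Iterated half shuffles -/

section Iterated

variable {α β : Type*}

/-- The shuffles of several lists in which the heads of the lists are in their order. -/
def iterShuffles : List (List α) → List (List α)
  | [] => [[]]
  | C :: Cs => (iterShuffles Cs).flatMap (halfShuffles C)

theorem iterShuffles_map (f : α → β) (Cs : List (List α)) :
    iterShuffles (Cs.map (List.map f)) = (iterShuffles Cs).map (List.map f) := by
  induction Cs with
  | nil => simp [iterShuffles]
  | cons C Cs ih =>
    rw [List.map_cons, iterShuffles, ih, iterShuffles, List.map_flatMap, List.flatMap_map]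
    simp only [halfShuffles_map]

/-- The heads of the lists. -/
def heads (Cs : List (List α)) : List α := Cs.filterMap List.head?

theorem heads_subset (Cs : List (List α)) : heads Cs ⊆ Cs.flatten := by
  intro a ha
  obtain ⟨C, hC, h⟩ := List.mem_filterMap.1 ha
  exact List.mem_flatten.2 ⟨C, hC, List.mem_of_mem_head? h⟩

/-- The order conditions for an iterated shuffle. -/
structure IsIterShuffle (Cs : List (List α)) (L : List α) : Prop where
  perm : L.Perm Cs.flatten
  sublist : ∀ C ∈ Cs, C.Sublist L
  heads : (heads Cs).Sublist L

theorem isIterShuffle_of_mem {Cs : List (List α)} {L : List α} (h : L ∈ iterShuffles Cs) :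
    IsIterShuffle Cs L := by
  induction Cs generalizing L with
  | nil =>
    rw [iterShuffles, List.mem_singleton] at h
    subst h
    exact ⟨by simp, by simp, by simp [KnotDiagram.heads]⟩
  | cons C Cs ih =>
    obtain ⟨L', hL', h⟩ := List.mem_flatMap.1 h
    have h' := ih hL'
    have hs := sublist_of_mem_halfShuffles h
    refine ⟨?_, fun B hB => ?_, ?_⟩
    · exact (perm_of_mem_halfShuffles h).trans (h'.perm.append_left C)
    · rcases List.mem_cons.1 hB with rfl | hB
      · exact hs.1
      · exact (h'.sublist B hB).trans hs.2
    · cases C with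
      | nil =>
        rw [halfShuffles, List.mem_singleton] at h
        subst h
        exact h'.heads
      | cons a u =>
        obtain ⟨M, hM, rfl⟩ := List.mem_map.1 h
        exact (h'.heads.trans (sublist_of_mem_shuffles hM).2).cons_cons a

theorem sublist_of_cons_sublist_of_ne {a b : α} {u L : List α} (h : (a :: u).Sublist (b :: L))
    (hab : a ≠ b) : (a :: u).Sublist L := by
  cases h with
  | cons _ h => exact h
  | cons_cons _ h => exact absurd rfl hab

theorem filter_sublist {p : α → Bool} {C L : List α} (h : C.Sublist L) (hp : ∀ a ∈ C, p a) :
    C.Sublist (L.filter p) := by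
  rw [← List.filter_eq_self.2 hp]
  exact h.filter p

/-- The order conditions force `L` to start with the head of the first nonempty list; deleting the
entries of that list leaves an iterated shuffle of the others. An empty list has no head and imposes
no condition. -/
theorem mem_iterShuffles {Cs : List (List α)} (hn : Cs.flatten.Nodup) {L : List α}
    (h : IsIterShuffle Cs L) : L ∈ iterShuffles Cs := by
  classical
  induction Cs generalizing L with
  | nil => simpa [iterShuffles] using h.perm
  | cons C Cs ih =>
    rw [List.flatten_cons] at hn
    obtain ⟨-, hn₂, hdis⟩ := List.nodup_append.1 hn
    cases C with
    | nil =>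
      refine List.mem_flatMap.2 ⟨L, ih hn₂ ⟨h.perm, fun B hB => h.sublist B (by simp [hB]),
        h.heads⟩, by simp [halfShuffles]⟩
    | cons a u =>
      have hnL : L.Nodup := h.perm.nodup_iff.2 hn
      -- The first entry of `L` must be the head of its own list, and among the heads `a` comes
      -- first.
      obtain ⟨M, rfl⟩ : ∃ M, L = a :: M := by
        cases L with
        | nil => simpa using h.perm
        | cons b M =>
          by_cases hab : a = b
          · exact ⟨M, by rw [hab]⟩
          · exfalso
            have hb : b ∉ M := (List.nodup_cons.1 hnL).1
            have hmem : b ∈ (a :: u) ++ Cs.flatten := h.perm.mem_iff.1 (by simp)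
            rcases List.mem_append.1 hmem with hmem | hmem
            · exact hb ((sublist_of_cons_sublist_of_ne (h.sublist _ (by simp)) hab).subset hmem)
            · obtain ⟨B, hB, hbB⟩ := List.mem_flatten.1 hmem
              cases B with
              | nil => simp at hbB
              | cons c B =>
                by_cases hcb : c = b
                · have hh : b ∈ KnotDiagram.heads Cs :=
                    List.mem_filterMap.2 ⟨c :: B, hB, by simp [hcb]⟩
                  have := h.heads
                  rw [KnotDiagram.heads, List.filterMap_cons_some (b := a) (by simp)] at this
                  exact hb ((sublist_of_cons_sublist_of_ne this hab).subset
                    (List.mem_cons_of_mem _ hh))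
                · exact hb ((sublist_of_cons_sublist_of_ne
                    (h.sublist _ (List.mem_cons_of_mem _ hB)) hcb).subset hbB)
      have hpM : M.Perm (u ++ Cs.flatten) := (List.perm_cons a).1 h.perm
      -- The inner shuffle is recovered by keeping only the entries of the remaining lists.
      have key : ∀ B, B.Sublist (a :: M) → B ⊆ Cs.flatten →
          B.Sublist (M.filter (· ∈ Cs.flatten)) := by
        intro B hB hs
        refine filter_sublist ?_ fun x hx => by simpa using hs hx
        cases hB with
        | cons _ h => exact h
        | cons_cons _ h => exact absurd rfl (hdis a (by simp) a (hs (by simp)))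
      have hf : (M.filter (· ∈ Cs.flatten)).Perm Cs.flatten := by
        refine (hpM.filter _).trans ?_
        rw [List.filter_append, List.filter_eq_nil_iff.2, List.nil_append,
          List.filter_eq_self.2]
        · intro x hx
          simpa using hx
        · intro x hx hx'
          exact hdis x (List.mem_cons_of_mem _ hx) x (by simpa using hx') rfl
      have hheads := h.heads
      rw [KnotDiagram.heads, List.filterMap_cons_some (b := a) (by simp)] at hheads
      refine List.mem_flatMap.2 ⟨M.filter (· ∈ Cs.flatten), ih hn₂ ⟨hf, fun B hB => ?_, ?_⟩, ?_⟩
      · exact key B (h.sublist B (by simp [hB])) fun x hx => List.mem_flatten.2 ⟨B, hB, hx⟩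
      · exact key _ ((List.sublist_cons_self a _).trans hheads) (heads_subset Cs)
      · refine List.mem_map.2 ⟨M, mem_shuffles ?_ (hpM.trans (hf.symm.append_left u))
          (h.sublist (a :: u) (by simp)).of_cons_cons List.filter_sublist, rfl⟩
        have : (u ++ Cs.flatten).Nodup := (List.nodup_cons.1 hn).2
        exact ((hf.append_left u).nodup_iff).2 this

theorem nodup_halfShuffles {u w : List α} (hn : (u ++ w).Nodup) : (halfShuffles u w).Nodup := by
  cases u with
  | nil => simp [halfShuffles]
  | cons a u => exact (nodup_shuffles (List.nodup_cons.1 hn).2).map (List.cons_injective)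

/-- Deleting the entries of `C` recovers the inner shuffle, so different inner shuffles have no half
shuffle with `C` in common. -/
theorem nodup_iterShuffles {Cs : List (List α)} (hn : Cs.flatten.Nodup) :
    (iterShuffles Cs).Nodup := by
  classical
  induction Cs with
  | nil => simp [iterShuffles]
  | cons C Cs ih =>
    rw [List.flatten_cons] at hn
    obtain ⟨-, hn₂, hdis⟩ := List.nodup_append.1 hn
    have key : ∀ L ∈ iterShuffles Cs, ∀ M ∈ halfShuffles C L, M.filter (· ∉ C) = L := by
      intro L hL M hM
      have hp := (isIterShuffle_of_mem hL).perm
      have hL' : ∀ x ∈ L, x ∉ C := fun x hx hxC => hdis x hxC x (hp.subset hx) rfl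
      have hs := filter_sublist (p := fun x => decide (x ∉ C))
        (sublist_of_mem_halfShuffles hM).2 fun x hx => by simpa using hL' x hx
      refine (hs.eq_of_length ?_).symm
      have := ((perm_of_mem_halfShuffles hM).filter (fun x => decide (x ∉ C))).length_eq
      rw [this, List.filter_append, List.filter_eq_nil_iff.2, List.nil_append,
        List.filter_eq_self.2]
      · intro x hx
        simpa using hL' x hx
      · intro x hx
        simpa using hx
    refine List.nodup_flatMap.2 ⟨fun L hL => nodup_halfShuffles ?_, ?_⟩
    · exact (((isIterShuffle_of_mem hL).perm.append_left C).nodup_iff).2 hn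
    · refine (ih hn₂).imp_of_mem fun {L L'} hL hL' hne => ?_
      intro M hM hM'
      exact hne ((key L hL M hM).symm.trans (key L' hL' M hM'))

end Iterated

end KnotDiagram

end

noncomputable section

namespace KnotDiagram

open Letter

/-! ### The divided products are iterated half shuffles -/

section Chains

variable {ℓ : ℕ} (n : Fin ℓ → ℕ)

/-- The points of the factors, in their order. -/
def chains : List (List (Σ i, Fin (n i))) :=
  (List.finRange ℓ).map fun i => (List.finRange (n i)).map (Sigma.mk i)

theorem nodup_flatten_chains : (chains n).flatten.Nodup :=
  List.Nodup.sigma (List.nodup_finRange ℓ) fun i => List.nodup_finRange (n i)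

theorem mem_flatten_chains (x : Σ i, Fin (n i)) : x ∈ (chains n).flatten :=
  List.mem_flatten.2 ⟨_, List.mem_map.2 ⟨x.1, List.mem_finRange _, rfl⟩,
    List.mem_map.2 ⟨x.2, List.mem_finRange _, rfl⟩⟩

/-- The list of all points in the order given by `e` is strictly increasing for `e`, so its sublists
are exactly the increasing lists of points. -/
theorem sublist_ofFn_iff {α : Type*} {N : ℕ} (e : α ≃ Fin N) (C : List α) :
    C.Sublist (List.ofFn e.symm) ↔ C.Pairwise fun a b => e a < e b := by
  have hL : (List.ofFn e.symm).Pairwise fun a b => e a < e b := by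
    rw [List.pairwise_ofFn]
    intro i j hij
    simpa using hij
  refine ⟨fun h => hL.sublist h, fun h => ?_⟩
  have : Std.Antisymm fun a b : α => e a < e b := ⟨fun a b h h' => absurd h' h.asymm⟩
  have hC : C.Nodup := h.imp fun {a b} hab => by
    rintro rfl
    exact lt_irrefl _ hab
  refine List.sublist_of_subperm_of_pairwise (List.subperm_of_subset hC fun a _ => ?_) h hL
  exact (List.mem_ofFn' _ _).2 ⟨e a, by simp⟩

theorem perm_ofFn {N : ℕ} (e : (Σ i, Fin (n i)) ≃ Fin N) :
    (List.ofFn e.symm).Perm (chains n).flatten := by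
  refine (List.perm_ext_iff_of_nodup (List.nodup_ofFn.2 e.symm.injective)
    (nodup_flatten_chains n)).2 fun x => ?_
  simp only [mem_flatten_chains, iff_true]
  exact (List.mem_ofFn' _ _).2 ⟨e x, by simp⟩

/-- Factors without points disappear from `heads`; this matches the positivity conditions in
`IsDividedShuffle`. -/
theorem heads_chains_pairwise {R : (Σ i, Fin (n i)) → (Σ i, Fin (n i)) → Prop} :
    (heads (chains n)).Pairwise R ↔
      ∀ i j, i < j → ∀ (hi : 0 < n i) (hj : 0 < n j), R ⟨i, ⟨0, hi⟩⟩ ⟨j, ⟨0, hj⟩⟩ := by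
  have hd : ∀ i (a : Σ i, Fin (n i)),
      ((List.finRange (n i)).map (Sigma.mk (β := fun i => Fin (n i)) i)).head? = some a ↔
      ∃ hi : 0 < n i, (⟨i, ⟨0, hi⟩⟩ : Σ i, Fin (n i)) = a := by
    intro i a
    rcases Nat.eq_zero_or_pos (n i) with h | h
    · have : (List.finRange (n i)).map (Sigma.mk (β := fun i => Fin (n i)) i) = [] := by simp [h]
      rw [this]
      simp [h]
    · have : ((List.finRange (n i)).map (Sigma.mk (β := fun i => Fin (n i)) i)).head? =
          some ⟨i, ⟨0, h⟩⟩ := by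
        rw [List.head?_eq_getElem?, List.getElem?_eq_getElem (by simpa using h)]
        simp
      rw [this]
      simp [h]
  rw [heads, List.pairwise_filterMap, chains, List.pairwise_map]
  have hf : (List.finRange ℓ).Pairwise (· < ·) := List.pairwise_lt_finRange ℓ
  simp only [hd]
  refine ⟨fun h i j hij hi hj => ?_, fun h => hf.imp ?_⟩
  · rw [List.pairwise_iff_getElem] at h
    have := h i j (by simp) (by simp) hij
    have ei : (List.finRange ℓ)[(i : ℕ)]'(by simp) = i := by simp
    have ej : (List.finRange ℓ)[(j : ℕ)]'(by simp) = j := by simp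
    rw [ei, ej] at this
    exact this _ ⟨hi, rfl⟩ _ ⟨hj, rfl⟩
  · rintro i j hij a ⟨hi, rfl⟩ b ⟨hj, rfl⟩
    exact h i j hij hi hj

theorem isIterShuffle_iff (e : (Σ i, Fin (n i)) ≃ Fin (∑ i, n i)) :
    IsIterShuffle (chains n) (List.ofFn e.symm) ↔ IsDividedShuffle n e := by
  have h₁ : (∀ C ∈ chains n, C.Sublist (List.ofFn e.symm)) ↔
      ∀ i, StrictMono fun a => e ⟨i, a⟩ := by
    simp only [chains, List.mem_map, List.mem_finRange, true_and, forall_exists_index,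
      forall_apply_eq_imp_iff, sublist_ofFn_iff, List.pairwise_map]
    refine forall_congr' fun i => ⟨fun h a b hab => ?_, fun h => ?_⟩
    · rw [List.pairwise_iff_getElem] at h
      simpa using h a b (by simp) (by simp) hab
    · exact (List.pairwise_lt_finRange (n i)).imp fun {a b} hab => h hab
  have h₂ := heads_chains_pairwise n (R := fun a b => e a < e b)
  rw [← sublist_ofFn_iff] at h₂
  exact ⟨fun h => ⟨h₁.1 h.sublist, h₂.1 h.heads⟩, fun h => ⟨perm_ofFn n e, h₁.2 h.1, h₂.2 h.2⟩⟩

theorem exists_equiv_of_perm {L : List (Σ i, Fin (n i))} (h : L.Perm (chains n).flatten) {N : ℕ}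
    (hN : L.length = N) : ∃ e : (Σ i, Fin (n i)) ≃ Fin N, List.ofFn e.symm = L := by
  classical
  subst hN
  refine ⟨(List.Nodup.getEquivOfForallMemList L (h.nodup_iff.2 (nodup_flatten_chains n))
    fun x => h.mem_iff.2 (mem_flatten_chains n x)).symm, ?_⟩
  refine List.ext_getElem (by simp) fun i hi hi' => ?_
  simp

theorem length_flatten_chains : (chains n).flatten.length = ∑ i, n i := by
  rw [List.length_flatten, chains, List.map_map, Fin.sum_univ_def]
  congr 1
  refine List.map_congr_left fun i _ => ?_
  simp

-- Reading the points from left to right is a bijection from the admissible numberings to the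
-- iterated half shuffles of the chains of points.
open Classical in
theorem sum_dividedShuffle {M : Type*} [AddCommMonoid M]
    (F : ((Σ i, Fin (n i)) ≃ Fin (∑ i, n i)) → M) (F' : List (Σ i, Fin (n i)) → M)
    (hF : ∀ e, F' (List.ofFn e.symm) = F e) :
    (∑ e : (Σ i, Fin (n i)) ≃ Fin (∑ i, n i) with IsDividedShuffle n e, F e) =
      ((iterShuffles (chains n)).map F').sum := by
  rw [← List.sum_toFinset _ (nodup_iterShuffles (nodup_flatten_chains n))]
  refine Finset.sum_nbij (fun e => List.ofFn e.symm) (fun e he => ?_) (fun e _ e' _ h => ?_)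
    (fun L hL => ?_) fun e _ => (hF e).symm
  · rw [List.mem_toFinset]
    exact mem_iterShuffles (nodup_flatten_chains n)
      ((isIterShuffle_iff n e).2 (Finset.mem_filter.1 he).2)
  · have := List.ofFn_injective h
    exact Equiv.symm_bijective.injective (Equiv.coe_fn_injective this)
  · have hL' := isIterShuffle_of_mem (List.mem_toFinset.1 hL)
    obtain ⟨e, rfl⟩ := exists_equiv_of_perm n hL'.perm
      (hL'.perm.length_eq.trans (length_flatten_chains n))
    exact ⟨e, by simpa using (isIterShuffle_iff n e).1 hL', rfl⟩

end Chains

/-! ### Divided products by repeated half shuffle products -/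

section Recursion

variable (k : Type*) [CommRing k] (d : ℕ)

open Classical in
/-- The concatenation of monomials, when the points are numbered by a list. -/
def listedCls {ℓ : ℕ} {n : Fin ℓ → ℕ} (w : ∀ i, Word (n i)) (L : List (Σ i, Fin (n i))) :
    TStar k d :=
  natCls k d L.length
    (List.ofFn fun i => (w i).map (Letter.map fun a => L.idxOf ⟨i, a⟩)).flatten

theorem idxOf_ofFn {α : Type*} [BEq α] [LawfulBEq α] {N : ℕ} (e : α ≃ Fin N) (x : α) :
    (List.ofFn e.symm).idxOf x = e x := by
  have h := (List.nodup_ofFn.2 e.symm.injective).idxOf_getElem (e x) (by simp)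
  simpa using h

theorem map_val_flatten {ℓ N : ℕ} {n : Fin ℓ → ℕ} (w : ∀ i, Word (n i)) (f : ∀ i, Fin (n i) → Fin N)
    {β : Type} (g : Fin N → β) :
    ((List.ofFn fun i => (w i).map (Letter.map (f i))).flatten).map (Letter.map g) =
      (List.ofFn fun i => (w i).map (Letter.map fun a => g (f i a))).flatten := by
  rw [List.map_flatten, List.map_ofFn]
  congr 2
  funext i
  simp [Letter.map_map]

theorem Letter.map_id {α : Type} (l : Letter α) : l.map (fun a => a) = l := by
  cases l <;> rfl

theorem listedCls_ofFn {ℓ N : ℕ} {n : Fin ℓ → ℕ} (w : ∀ i, Word (n i))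
    (e : (Σ i, Fin (n i)) ≃ Fin N) : listedCls k d w (List.ofFn e.symm) =
      cls k d (List.ofFn fun i => (w i).map (Letter.map fun a => e ⟨i, a⟩)).flatten := by
  classical
  rw [listedCls]
  simp only [idxOf_ofFn, List.length_ofFn]
  rw [← map_val_flatten w (fun i a => e ⟨i, a⟩) Fin.val]
  generalize (List.ofFn fun i => (w i).map (Letter.map fun a => e ⟨i, a⟩)).flatten = W
  cases N with
  | zero => rw [eq_nil_of_zero W, natCls]
  | succ N =>
    rw [natCls, List.map_map]
    congr 1
    conv_rhs => rw [← List.map_id W]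
    refine List.map_congr_left fun l _ => ?_
    rw [Function.comp_apply, Letter.map_map]
    simp only [Fin.ofNat_eq_cast, Fin.cast_val_eq_self, Letter.map_id]
    rfl

theorem mkQ_dividedWord {ℓ : ℕ} {n : Fin ℓ → ℕ} (w : ∀ i, Word (n i)) :
    (relations k d).mkQ (dividedWord k w) = ((iterShuffles (chains n)).map (listedCls k d w)).sum := by
  rw [dividedWord, map_sum]
  exact sum_dividedShuffle n _ _ fun e => listedCls_ofFn k d w e

theorem idxOf_map {α β : Type*} [BEq α] [LawfulBEq α] [BEq β] [LawfulBEq β] {f : α → β}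
    (hf : Function.Injective f) (L : List α) (x : α) : (L.map f).idxOf (f x) = L.idxOf x := by
  classical
  induction L with
  | nil => simp
  | cons a L ih =>
    rw [List.map_cons, List.idxOf_cons, List.idxOf_cons, ih]
    have : (f a == f x) = (a == x) := by
      rw [Bool.eq_iff_iff, beq_iff_eq, beq_iff_eq, hf.eq_iff]
    rw [this]

/-- The inclusion of the points of all factors but the first one. -/
def tailPoint {ℓ : ℕ} (n : Fin (ℓ + 1) → ℕ) (x : Σ i : Fin ℓ, Fin (n i.succ)) :
    Σ i, Fin (n i) := ⟨x.1.succ, x.2⟩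

theorem chains_succ {ℓ : ℕ} (n : Fin (ℓ + 1) → ℕ) :
    chains n = (List.finRange (n 0)).map (Sigma.mk 0) ::
      (chains fun i : Fin ℓ => n i.succ).map (List.map (tailPoint n)) := by
  rw [chains, List.finRange_succ, List.map_cons, chains, List.map_map, List.map_map]
  congr 1
  refine List.map_congr_left fun i _ => ?_
  rw [Function.comp_apply, Function.comp_apply, List.map_map]
  rfl

/-- The labels of the points of a product in terms of those of the first factor and of the product
of the other ones. -/
def splitPoint {ℓ N : ℕ} (n : Fin (ℓ + 1) → ℕ) (e : (Σ i : Fin ℓ, Fin (n i.succ)) ≃ Fin N)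
    (x : Σ i, Fin (n i)) : ℕ ⊕ ℕ :=
  Fin.cases (motive := fun i => Fin (n i) → ℕ ⊕ ℕ) (fun a => Sum.inl (a : ℕ))
    (fun i a => Sum.inr (e ⟨i, a⟩ : ℕ)) x.1 x.2

theorem splitPoint_injective {ℓ N : ℕ} (n : Fin (ℓ + 1) → ℕ)
    (e : (Σ i : Fin ℓ, Fin (n i.succ)) ≃ Fin N) : Function.Injective (splitPoint n e) := by
  rintro ⟨i, a⟩ ⟨j, b⟩ h
  induction i using Fin.cases with
  | zero =>
    induction j using Fin.cases with
    | zero =>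
      have : (a : ℕ) = b := by simpa [splitPoint] using h
      rw [Fin.ext this]
    | succ j => simp [splitPoint] at h
  | succ i =>
    induction j using Fin.cases with
    | zero => simp [splitPoint] at h
    | succ j =>
      have h' : (e ⟨i, a⟩ : ℕ) = e ⟨j, b⟩ := by simpa [splitPoint] using h
      have := e.injective (Fin.ext h')
      rw [Sigma.mk.injEq] at this
      obtain ⟨rfl, h⟩ := this
      rw [eq_of_heq h]

theorem isFull_flatten {ℓ N : ℕ} {n : Fin ℓ → ℕ} {w : ∀ i, Word (n i)} (hw : ∀ i, IsFull (w i))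
    (e : (Σ i, Fin (n i)) ≃ Fin N) :
    IsFull (List.ofFn fun i => (w i).map (Letter.map fun a => e ⟨i, a⟩)).flatten := by
  have hm : ∀ i, ∀ l ∈ w i, l.map (fun a => e ⟨i, a⟩) ∈
      (List.ofFn fun i => (w i).map (Letter.map fun a => e ⟨i, a⟩)).flatten := fun i l hl =>
    List.mem_flatten.2 ⟨_, (List.mem_ofFn' _ _).2 ⟨i, rfl⟩, List.mem_map.2 ⟨l, hl, rfl⟩⟩
  have hs : ∀ a, ∃ i b, e ⟨i, b⟩ = a := fun a => ⟨(e.symm a).1, (e.symm a).2, by simp⟩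
  refine ⟨fun a => ?_, fun a => ?_⟩
  · obtain ⟨i, b, rfl⟩ := hs a
    exact hm i _ ((hw i).pt_mem b)
  · obtain ⟨i, b, rfl⟩ := hs a
    rcases (hw i).touched b with h | ⟨c, h⟩
    · exact Or.inl (hm i _ h)
    · exact Or.inr ⟨e ⟨i, c⟩, h.imp (hm i _) (hm i _)⟩

/-- The product of the remaining factors has its own numbering `e` of points; `splitPoint`
translates the points of all factors into the labels of a binary product. Being injective, it
preserves positions in lists, and the concatenated monomials coincide. -/
theorem half_listedCls {ℓ : ℕ} {n : Fin (ℓ + 1) → ℕ} {w : ∀ i, Word (n i)}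
    (hw : ∀ i, IsFull (w i)) {L' : List (Σ i : Fin ℓ, Fin (n i.succ))}
    (h : L'.Perm (chains fun i : Fin ℓ => n i.succ).flatten) :
    TStar.half k d (cls k d (w 0)) (listedCls k d (fun i : Fin ℓ => w i.succ) L') =
      ((halfShuffles ((List.finRange (n 0)).map (Sigma.mk 0)) (L'.map (tailPoint n))).map
        (listedCls k d w)).sum := by
  classical
  obtain ⟨N, hN⟩ : ∃ N, L'.length = N := ⟨_, rfl⟩
  obtain ⟨e, rfl⟩ := exists_equiv_of_perm _ h hN
  rw [listedCls_ofFn, TStar.half, op_cls k d _ (hw 0) (isFull_flatten (fun i => hw i.succ) e), opWord]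
  have h₁ : inls (n 0) = ((List.finRange (n 0)).map (Sigma.mk 0)).map (splitPoint n e) := by
    rw [List.map_map, inls, ← List.map_coe_finRange_eq_range, List.map_map]
    rfl
  have h₂ : inrs N = ((List.ofFn e.symm).map (tailPoint n)).map (splitPoint n e) := by
    rw [List.map_map, inrs, ← List.map_coe_finRange_eq_range, List.map_map, List.map_ofFn,
      List.ofFn_eq_map]
    refine List.map_congr_left fun a _ => ?_
    simp [tailPoint, splitPoint]
  rw [h₁, h₂, halfFamily]
  simp only
  rw [halfShuffles_map, List.map_map]
  congr 1
  refine List.map_congr_left fun L _ => ?_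
  rw [Function.comp_apply, listedCls, List.length_map]
  congr 1
  rw [List.ofFn_succ, List.flatten_cons]
  congr 1
  · simp only [← idxOf_map (splitPoint_injective n e)]
    rfl
  · rw [map_val_flatten (fun i : Fin ℓ => w i.succ) (fun i a => e ⟨i, a⟩)]
    simp only [← idxOf_map (splitPoint_injective n e)]
    rfl

theorem mkQ_dividedWord_succ {ℓ : ℕ} {n : Fin (ℓ + 1) → ℕ} {w : ∀ i, Word (n i)}
    (hw : ∀ i, IsFull (w i)) : (relations k d).mkQ (dividedWord k w) =
      TStar.half k d (cls k d (w 0))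
        ((relations k d).mkQ (dividedWord k fun i : Fin ℓ => w i.succ)) := by
  rw [mkQ_dividedWord, mkQ_dividedWord, chains_succ, iterShuffles, iterShuffles_map,
    List.flatMap_map, map_list_sum, List.map_map, List.map_flatMap,
    List.flatMap, List.sum_flatten, List.map_map]
  congr 1
  refine List.map_congr_left fun L' hL' => ?_
  exact (half_listedCls k d hw (isIterShuffle_of_mem hL').perm).symm

theorem TStar.dividedProduct_mkQ {ℓ : ℕ} (x : Fin ℓ → Free k) :
    TStar.dividedProduct k d ℓ (fun i => (relations k d).mkQ (x i)) =
      (relations k d).mkQ (dividedFree k ℓ x) :=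
  multilinearMapQ_mkQ _ _ _ _ x

theorem TStar.dividedProduct_succ (ℓ : ℕ) (x : Fin (ℓ + 1) → TStar k d) :
    TStar.dividedProduct k d (ℓ + 1) x =
      TStar.half k d (x 0) (TStar.dividedProduct k d ℓ fun i => x i.succ) := by
  choose y hy using fun i => (relations k d).mkQ_surjective (x i)
  obtain rfl : (fun i => (relations k d).mkQ (y i)) = x := funext hy
  simp only [TStar.dividedProduct_mkQ]
  let f : Free k →ₗ[k] MultilinearMap k (fun _ : Fin ℓ => Free k) (TStar k d) :=
    { toFun := fun x => (TStar.half k d ((relations k d).mkQ x)).compMultilinearMap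
        ((relations k d).mkQ.compMultilinearMap (dividedFree k ℓ))
      map_add' := fun x y => by
        ext
        simp
      map_smul' := fun c x => by
        ext
        simp }
  -- Both sides are multilinear on the free module, so it suffices to compare them on diagrams.
  have key : (relations k d).mkQ.compMultilinearMap (dividedFree k (ℓ + 1)) = f.uncurryLeft := by
    refine Module.Basis.ext_multilinear (fun _ => Finsupp.basisSingleOne) fun D => ?_
    rw [LinearMap.uncurryLeft_apply]
    simp only [Finsupp.coe_basisSingleOne, LinearMap.compMultilinearMap_apply, f, LinearMap.coe_mk,
      AddHom.coe_mk]
    have ht : Fin.tail (fun i => Finsupp.single (D i) (1 : k)) =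
        fun i : Fin ℓ => Finsupp.single (D i.succ) (1 : k) := rfl
    rw [ht, dividedFree_single, dividedFree_single k (fun i : Fin ℓ => D i.succ),
      mkQ_dividedWord_succ k d fun i => (D i).isDiagram.isFull, cls, ofWord_diagram]
  exact congrArg (fun g => g y) key

/-- The combinatorics of shuffles of many factors enters the later arguments on `T_*` only through
this recursion and `TStar.dividedPower_zero`. -/
theorem TStar.dividedPower_succ (ℓ : ℕ) (x : TStar k d) :
    TStar.dividedPower k d (ℓ + 1) x = TStar.half k d x (TStar.dividedPower k d ℓ x) :=
  TStar.dividedProduct_succ k d ℓ fun _ => x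

/-- The class of the trivial diagram. -/
def TStar.trivial : TStar k d := cls k d ([] : Word 0)

theorem TStar.dividedPower_zero (x : TStar k d) :
    TStar.dividedPower k d 0 x = TStar.trivial k d := by
  have h : (fun _ : Fin 0 => x) = fun i => (relations k d).mkQ (Finsupp.single
      (Fin.elim0 i : Diagram) 1) := funext fun i => i.elim0
  rw [TStar.dividedPower, h, TStar.dividedProduct_mkQ, dividedFree_single, mkQ_dividedWord]
  simp [chains, iterShuffles, listedCls, natCls, TStar.trivial]

/-- The half shuffles of the empty list with `w` consist of `w` alone: a factor without points gives
no condition on left-most points. -/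
theorem TStar.half_trivial_left (x : TStar k d) : TStar.half k d (TStar.trivial k d) x = x := by
  have key : TStar.half k d (TStar.trivial k d) ∘ₗ (relations k d).mkQ = (relations k d).mkQ := by
    ext D
    have hD : (relations k d).mkQ (Finsupp.single D 1) = cls k d D.word := by
      rw [cls, ofWord_diagram]
    simp only [LinearMap.comp_apply, Finsupp.lsingle_apply, hD]
    rw [TStar.trivial, TStar.half, op_cls_of_isDiagram k d _ isDiagram_nil D.isDiagram, opWord]
    have hi : ∀ a : Fin D.n, (inrs D.n).idxOf (Sum.inr (a : ℕ)) = a := fun a => by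
      rw [inrs, idxOf_map Sum.inr_injective]
      simpa using (List.nodup_range (n := D.n)).idxOf_getElem a (by simp)
    simp only [inls, List.range_zero, List.map_nil, halfFamily, halfShuffles, List.map_cons,
      List.sum_cons, List.sum_nil, add_zero, List.nil_append, hi]
    generalize D.word = W
    rw [inrs, List.length_map, List.length_range]
    generalize D.n = N at W ⊢
    cases N with
    | zero => rw [eq_nil_of_zero W, natCls]
    | succ N =>
      rw [natCls, List.map_map]
      congr 1
      conv_rhs => rw [← List.map_id W]
      refine List.map_congr_left fun l _ => ?_
      rw [Function.comp_apply, Letter.map_map]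
      simp only [Fin.ofNat_eq_cast, Fin.cast_val_eq_self, Letter.map_id]
      rfl
  obtain ⟨y, rfl⟩ := (relations k d).mkQ_surjective x
  exact LinearMap.congr_fun key y

end Recursion

end KnotDiagram

end

noncomputable section

namespace KnotDiagram

open Letter

/-! ### Identities between the operations on diagrams with blocks of labels -/

section BarSquare

variable {R M : Type*} [SemilatticeSup R] [AddCommGroup M]

/-- Joins at distant places cancel by their signs, and the two ways to join three neighbours cancel
by associativity of the supremum. -/
theorem bd_bd (L : List R) (φ : List R → M) : bd L (fun u => bd u φ) = 0 := by
  induction L generalizing φ with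
  | nil => rfl
  | cons a L ih =>
    cases L with
    | nil => rfl
    | cons b L =>
      have h : bd (b :: L) (fun u => bd (a :: u) φ) =
          bd ((a ⊔ b) :: L) φ - bd (b :: L) (fun u => bd u fun v => φ (a :: v)) := by
        have e : (fun u => bd (a :: u) φ) = fun u => joinHead a u φ +
            (-1 : ℤ) • bd u (fun v => φ (a :: v)) := by
          funext u
          rw [bd_cons]
          module
        rw [e, bd_add, bd_smul, ih]
        cases L with
        | nil => simp [bd]
        | cons c L =>
          rw [bd, bd, joinHead, sup_assoc]
          simp only [joinHead]
          module
      rw [bd, h, ih]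
      simp

end BarSquare

theorem neg_one_pow_congr {m n : ℕ} (a b : ℕ) (h : m + 2 * a = n + 2 * b) :
    (-1 : ℤ) ^ m = (-1) ^ n :=
  neg_one_pow_eq (by omega)

section LinearMaps

variable {k α R M N : Type*} [CommRing k] [SemilatticeSup R] [AddCommGroup M] [Module k M]
  [AddCommGroup N] [Module k N]

theorem linear_sh (f : M →ₗ[k] N) (u w : List α) (φ : List α → M) :
    f (sh u w φ) = sh u w fun L => f (φ L) := map_sh f.toAddMonoidHom u w φ

theorem linear_hs (f : M →ₗ[k] N) (u w : List α) (φ : List α → M) :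
    f (hs u w φ) = hs u w fun L => f (φ L) := map_hs f.toAddMonoidHom u w φ

theorem linear_bd (f : M →ₗ[k] N) (u : List R) (φ : List R → M) :
    f (bd u φ) = bd u fun L => f (φ L) := map_bd f.toAddMonoidHom u φ

theorem sh_apply (u w : List α) (φ : List α → M →ₗ[k] N) (x : M) :
    sh u w φ x = sh u w fun L => φ L x := linear_sh (LinearMap.applyₗ (R := k) x) u w φ

theorem hs_apply (u w : List α) (φ : List α → M →ₗ[k] N) (x : M) :
    hs u w φ x = hs u w fun L => φ L x := linear_hs (LinearMap.applyₗ (R := k) x) u w φ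

theorem bd_apply (u : List R) (φ : List R → M →ₗ[k] N) (x : M) :
    bd u φ x = bd u fun L => φ L x := linear_bd (LinearMap.applyₗ (R := k) x) u φ

end LinearMaps

section Identities

variable {Q : Type} (k : Type*) [CommRing k] (d : ℕ)

theorem supp_of_mem_shuffles {u w L : List (Set Q)} (h : L ∈ shuffles u w) :
    supp L = supp u ∪ supp w := by
  rw [supp_perm (perm_of_mem_shuffles h), supp_append]

theorem supp_of_mem_halfShuffles {u w L : List (Set Q)} (h : L ∈ halfShuffles u w) :
    supp L = supp u ∪ supp w := by
  rw [supp_perm (perm_of_mem_halfShuffles h), supp_append]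

theorem cons_mem_halfShuffles {u w L : List (Set Q)} (a : Set Q) (h : L ∈ shuffles u w) :
    a :: L ∈ halfShuffles (a :: u) w := List.mem_map.2 ⟨L, h, rfl⟩

theorem supp_join {a b : Set Q} {u w L : List (Set Q)} (h : L ∈ shuffles u w) :
    supp ((a ⊔ b) :: L) = supp (a :: u) ∪ supp (b :: w) := by
  rw [supp_cons, supp_of_mem_shuffles h, supp_cons, supp_cons]
  exact Set.union_union_union_comm _ _ _ _

variable {V₁ V₂ V₃ : List (Q × Q)} {L₁ L₂ L₃ : List (Set Q)}

theorem half_boundary_left (h₁ : Fits V₁ L₁) (h₂ : Fits V₂ L₂) (hd : Disjoint (supp L₁) (supp L₂)) :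
    TStar.half k d (TStar.boundary k d (blockCls k d V₁ L₁)) (blockCls k d V₂ L₂) =
      (-1 : ℤ) ^ ((d + 1) * V₁.length * L₂.length) •
        bd L₁ (fun v => hs v L₂ (blockCls k d (V₁ ++ V₂))) := by
  rw [boundary_blockCls k d h₁, linear_bd, bd_apply, ← bd_smul]
  refine bd_congr_joinAt fun i hi => ?_
  rw [half_blockCls k d (h₁.joinAt hi) h₂ (by rwa [supp_joinAt])]
  have := length_joinAt hi
  exact List.ne_nil_of_length_pos (by omega)

theorem half_boundary_right (h₁ : Fits V₁ L₁) (h₂ : Fits V₂ L₂)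
    (hd : Disjoint (supp L₁) (supp L₂)) (hL : L₁ ≠ []) :
    TStar.half k d (blockCls k d V₁ L₁) (TStar.boundary k d (blockCls k d V₂ L₂)) =
      (-1 : ℤ) ^ ((d + 1) * V₁.length * (L₂.length + 1)) •
        bd L₂ (fun v => hs L₁ v (blockCls k d (V₁ ++ V₂))) := by
  rw [boundary_blockCls k d h₂, linear_bd, ← bd_smul]
  refine bd_congr_joinAt fun i hi => ?_
  rw [half_blockCls k d h₁ (h₂.joinAt hi) (by rwa [supp_joinAt]) hL, ← length_joinAt hi]
  congr 1
  exact neg_one_pow_congr ((d + 1) * V₁.length) 0 (by ring)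

theorem join_eq_joinHeads (h₁ : Fits V₁ L₁) (h₂ : Fits V₂ L₂)
    (hd : Disjoint (supp L₁) (supp L₂)) (hL : L₁ ≠ []) :
    TStar.join k d (blockCls k d V₁ L₁) (blockCls k d V₂ L₂) =
      (-1 : ℤ) ^ ((d + 1) * V₁.length * L₂.length) •
        joinHeads L₁ L₂ (blockCls k d (V₁ ++ V₂)) := by
  obtain ⟨a, u, rfl⟩ := List.exists_cons_of_ne_nil hL
  cases L₂ with
  | nil => rw [join_nil k d h₁ h₂ hL, joinHeads, smul_zero]; simp
  | cons b w => rw [join_blockCls k d h₁ h₂ hd, joinHeads, smul_smul, ← pow_add]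

/-- The differential of a half shuffle product of diagrams. -/
theorem boundary_half_blockCls (h₁ : Fits V₁ L₁) (h₂ : Fits V₂ L₂)
    (hd : Disjoint (supp L₁) (supp L₂)) (hL : L₁ ≠ []) :
    TStar.boundary k d (TStar.half k d (blockCls k d V₁ L₁) (blockCls k d V₂ L₂)) =
      TStar.half k d (TStar.boundary k d (blockCls k d V₁ L₁)) (blockCls k d V₂ L₂) +
        (-1 : ℤ) ^ ((d + 1) * V₁.length + L₁.length) •
          TStar.half k d (blockCls k d V₁ L₁) (TStar.boundary k d (blockCls k d V₂ L₂)) +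
        TStar.join k d (blockCls k d V₁ L₁) (blockCls k d V₂ L₂) := by
  rw [half_boundary_left k d h₁ h₂ hd, half_boundary_right k d h₁ h₂ hd hL,
    join_eq_joinHeads k d h₁ h₂ hd hL, half_blockCls k d h₁ h₂ hd hL, map_zsmul, linear_hs,
    hs_congr fun L hL' => boundary_blockCls k d (h₁.halfShuffle h₂ hd hL'), hs_bd hL,
    smul_add, smul_add, smul_smul, smul_smul, ← pow_add, ← pow_add]
  congr 3
  exact neg_one_pow_congr ((d + 1) * V₁.length) 0 (by ring)

theorem boundary_boundary_blockCls (h₁ : Fits V₁ L₁) :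
    TStar.boundary k d (TStar.boundary k d (blockCls k d V₁ L₁)) = 0 := by
  rw [boundary_blockCls k d h₁, linear_bd, ← bd_bd L₁ (blockCls k d V₁)]
  exact bd_congr_joinAt fun i hi => boundary_blockCls k d (h₁.joinAt hi)

/-- On both sides the three remaining lists are shuffled behind the joined head `a ⊔ b`;
associativity of shuffles and a count of signs do the rest. -/
theorem join_half_blockCls (h₁ : Fits V₁ L₁) (h₂ : Fits V₂ L₂) (h₃ : Fits V₃ L₃)
    (d₁₂ : Disjoint (supp L₁) (supp L₂)) (d₁₃ : Disjoint (supp L₁) (supp L₃))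
    (d₂₃ : Disjoint (supp L₂) (supp L₃)) (hL₁ : L₁ ≠ []) (hL₂ : L₂ ≠ []) :
    TStar.join k d (blockCls k d V₁ L₁) (TStar.half k d (blockCls k d V₂ L₂) (blockCls k d V₃ L₃)) =
      TStar.half k d (TStar.join k d (blockCls k d V₁ L₁) (blockCls k d V₂ L₂))
        (blockCls k d V₃ L₃) := by
  obtain ⟨a, u, rfl⟩ := List.exists_cons_of_ne_nil hL₁
  obtain ⟨b, w, rfl⟩ := List.exists_cons_of_ne_nil hL₂
  have e₁ : TStar.join k d (blockCls k d V₁ (a :: u))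
      (TStar.half k d (blockCls k d V₂ (b :: w)) (blockCls k d V₃ L₃)) =
      (-1 : ℤ) ^ ((d + 1) * V₂.length * L₃.length +
        ((d + 1) * V₁.length * (w.length + L₃.length + 1) + u.length)) •
        sh w L₃ fun L => sh u L fun M => blockCls k d (V₁ ++ (V₂ ++ V₃)) ((a ⊔ b) :: M) := by
    rw [half_blockCls k d h₂ h₃ d₂₃ hL₂, map_zsmul, hs, linear_sh, pow_add, mul_smul]
    congr 1
    rw [← sh_smul]
    refine sh_congr fun L hL => ?_
    have hL' := cons_mem_halfShuffles b hL
    rw [join_blockCls k d h₁ (h₂.halfShuffle h₃ d₂₃ hL') (by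
      rw [supp_of_mem_halfShuffles hL', Set.disjoint_union_right]
      exact ⟨d₁₂, d₁₃⟩), List.length_cons, length_of_mem_shuffles hL]
  have e₂ : TStar.half k d (TStar.join k d (blockCls k d V₁ (a :: u)) (blockCls k d V₂ (b :: w)))
      (blockCls k d V₃ L₃) =
      (-1 : ℤ) ^ ((d + 1) * V₁.length * (w.length + 1) + u.length +
        ((d + 1) * (V₁ ++ V₂).length * L₃.length)) •
        sh u w fun L => sh L L₃ fun M => blockCls k d ((V₁ ++ V₂) ++ V₃) ((a ⊔ b) :: M) := by
    rw [join_blockCls k d h₁ h₂ d₁₂, map_zsmul, linear_sh, LinearMap.smul_apply, sh_apply, List.length_cons,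
      pow_add _ (_ + _), mul_smul]
    congr 1
    rw [← sh_smul]
    refine sh_congr fun L hL => ?_
    rw [half_blockCls k d (h₁.joinHeads h₂ d₁₂ hL) h₃ (by
      rw [supp_join hL, Set.disjoint_union_left]
      exact ⟨d₁₃, d₂₃⟩) (by simp), hs]
  rw [e₁, e₂, sh_assoc, List.append_assoc]
  congr 1
  rw [List.length_append]
  congr 1
  ring

end Identities

end KnotDiagram

end

/-! ### Exchange of factors, relabelling and doubled edges -/

noncomputable section

namespace KnotDiagram

open Letter

/-- Exponents are compared in `ZMod 2`, where they become polynomial expressions in finitely many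
residues and can be decided by running through all values. -/
theorem neg_one_pow_of_cast {m n : ℕ} (h : (m : ZMod 2) = n) : (-1 : ℤ) ^ m = (-1) ^ n :=
  neg_one_pow_eq ((ZMod.natCast_eq_natCast_iff' m n 2).1 h)

theorem neg_one_pow_neg_of_cast {m n : ℕ} (h : (m : ZMod 2) = n + 1) :
    (-1 : ℤ) ^ m = -(-1) ^ n :=
  neg_one_pow_eq_neg ((ZMod.natCast_eq_natCast_iff' m (n + 1) 2).1 (by rw [h]; push_cast; rfl))

section Commutation

variable {Q : Type} (k : Type*) [CommRing k] (d : ℕ)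

/-- For an empty list of blocks the class is that of the trivial diagram whatever the edges are, so
the sign rule needs at least one block. -/
theorem blockCls_swap (V₁ V₂ V₃ : List (Q × Q)) {L : List (Set Q)} (hL : L ≠ []) :
    blockCls k d (V₁ ++ V₂ ++ V₃) L =
      (-1 : ℤ) ^ ((d + 1) * V₁.length * V₂.length) • blockCls k d (V₂ ++ V₁ ++ V₃) L := by
  obtain ⟨n, hn⟩ : ∃ n, L.length = n + 1 :=
    ⟨L.length - 1, by have := List.length_pos_iff.2 hL; omega⟩
  rw [blockCls, blockCls, hn, normalCls, normalCls, nf, nf]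
  simp only [List.map_append, ← List.append_assoc]
  rw [cls_swap_edges]
  simp only [List.length_map]

theorem blockCls_swap_two (V₁ V₂ : List (Q × Q)) {L : List (Set Q)} (hL : L ≠ []) :
    blockCls k d (V₁ ++ V₂) L =
      (-1 : ℤ) ^ ((d + 1) * V₁.length * V₂.length) • blockCls k d (V₂ ++ V₁) L := by
  simpa using blockCls_swap k d V₁ V₂ [] hL

theorem idx_map_image {τ : Q → Q} (hτ : Function.Injective τ) (L : List (Set Q)) (p : Q) :
    idx (L.map (Set.image τ)) (τ p) = idx L p := by
  induction L with
  | nil => rfl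
  | cons B L ih =>
    rw [List.map_cons]
    by_cases h : p ∈ B
    · rw [idx_cons_of_mem h, idx_cons_of_mem (Set.mem_image_of_mem τ h)]
    · rw [idx_cons_of_not_mem h, idx_cons_of_not_mem ((hτ.mem_set_image).not.2 h), ih]

theorem blockCls_map {τ : Q → Q} (hτ : Function.Injective τ) (V : List (Q × Q))
    (L : List (Set Q)) :
    blockCls k d (V.map (Prod.map τ τ)) (L.map (Set.image τ)) = blockCls k d V L := by
  rw [blockCls, blockCls, List.length_map, List.map_map]
  congr 1
  refine List.map_congr_left fun e _ => ?_
  simp [Prod.map, idx_map_image hτ]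

theorem Fits.map {τ : Q → Q} (hτ : Function.Injective τ) {V : List (Q × Q)} {L : List (Set Q)}
    (h : Fits V L) : Fits (V.map (Prod.map τ τ)) (L.map (Set.image τ)) := by
  refine ⟨?_, ?_, ?_, ?_⟩
  · exact h.disjoint.map _ fun A B hAB => (Set.disjoint_image_iff hτ).2 hAB
  · intro e he
    obtain ⟨e, he', rfl⟩ := List.mem_map.1 he
    simpa [idx_map_image hτ] using h.idx_lt e he'
  · intro e he
    obtain ⟨e, he', rfl⟩ := List.mem_map.1 he
    simpa [idx_map_image hτ] using h.idx_le e he'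
  · intro B hB
    obtain ⟨B, hB', rfl⟩ := List.mem_map.1 hB
    obtain ⟨e, he, h'⟩ := h.covering B hB'
    exact ⟨_, List.mem_map.2 ⟨e, he, rfl⟩, h'.imp (Set.mem_image_of_mem τ) (Set.mem_image_of_mem τ)⟩

theorem sh_swap_heads (V₁ V₂ : List (Q × Q)) (a b : Set Q) (u w : List (Set Q)) :
    sh w u (fun L => blockCls k d (V₂ ++ V₁) ((b ⊔ a) :: L)) =
      (-1 : ℤ) ^ (w.length * u.length + (d + 1) * V₂.length * V₁.length) •
        sh u w fun L => blockCls k d (V₁ ++ V₂) ((a ⊔ b) :: L) := by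
  rw [sh_comm, pow_add, mul_smul]
  congr 1
  rw [← sh_smul]
  refine sh_congr fun L _ => ?_
  rw [blockCls_swap_two k d V₂ V₁ (List.cons_ne_nil _ L), sup_comm]

theorem hs_swap_heads (V₁ V₂ : List (Q × Q)) (a b : Set Q) (u w : List (Set Q)) :
    hs w u (fun L => blockCls k d (V₂ ++ V₁) ((b ⊔ a) :: L)) =
      (-1 : ℤ) ^ ((d + 1) * V₂.length * V₁.length) •
        hs w u fun L => blockCls k d (V₁ ++ V₂) ((a ⊔ b) :: L) := by
  rw [← hs_smul]
  refine hs_congr fun L _ => ?_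
  rw [blockCls_swap_two k d V₂ V₁ (List.cons_ne_nil _ L), sup_comm]

variable {V₁ V₂ V₃ : List (Q × Q)} {L₁ L₂ L₃ : List (Set Q)}

/-- The joined head is symmetric in `a` and `b`; exchanging the tails and the two groups of edges
accounts for the sign. The two factors of the exponent have the parities of the degrees. -/
theorem join_comm_blockCls (h₁ : Fits V₁ L₁) (h₂ : Fits V₂ L₂)
    (hd : Disjoint (supp L₁) (supp L₂)) (hL₁ : L₁ ≠ []) (hL₂ : L₂ ≠ []) :
    TStar.join k d (blockCls k d V₂ L₂) (blockCls k d V₁ L₁) =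
      -((-1 : ℤ) ^ (((d + 1) * V₁.length + L₁.length) * ((d + 1) * V₂.length + L₂.length)) •
        TStar.join k d (blockCls k d V₁ L₁) (blockCls k d V₂ L₂)) := by
  obtain ⟨a, u, rfl⟩ := List.exists_cons_of_ne_nil hL₁
  obtain ⟨b, w, rfl⟩ := List.exists_cons_of_ne_nil hL₂
  rw [join_blockCls k d h₁ h₂ hd, join_blockCls k d h₂ h₁ hd.symm, sh_swap_heads, smul_smul,
    smul_smul, ← neg_smul, ← pow_add, ← pow_add]
  congr 1
  refine neg_one_pow_neg_of_cast ?_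
  simp only [List.length_cons]
  push_cast
  generalize (d : ZMod 2) = d
  generalize (V₁.length : ZMod 2) = x
  generalize (V₂.length : ZMod 2) = y
  generalize (u.length : ZMod 2) = z
  generalize (w.length : ZMod 2) = t
  decide +revert

/-- Relabelling the whole diagram by `τ` does not change its class, but it exchanges the edges `V`
with their copy. Restoring their order costs the sign, as |V|² has the parity of |V|. -/
theorem blockCls_cons_copy {τ : Q → Q} (hτ : ∀ p, τ (τ p) = p) (V W : List (Q × Q))
    (hW : W.map (Prod.map τ τ) = W) {H : List (Set Q)} (hne : H ≠ [])
    (hH : H.map (Set.image τ) = H) (L : List (Set Q)) :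
    blockCls k d (V ++ V.map (Prod.map τ τ) ++ W) (H ++ L.map (Set.image τ)) =
      (-1 : ℤ) ^ ((d + 1) * V.length) •
        blockCls k d (V ++ V.map (Prod.map τ τ) ++ W) (H ++ L) := by
  have hinj : Function.Injective τ := Function.LeftInverse.injective hτ
  have e : (V.map (Prod.map τ τ)).map (Prod.map τ τ) = V := by
    rw [List.map_map]
    conv_rhs => rw [← List.map_id V]
    exact List.map_congr_left fun e _ => Prod.ext (hτ _) (hτ _)
  have := blockCls_map k d hinj (V.map (Prod.map τ τ) ++ V ++ W) (H ++ L)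
  rw [List.map_append, List.map_append, List.map_append, e, hW, hH] at this
  rw [this, blockCls_swap k d _ _ _ (by simp [hne]), List.length_map]
  congr 1
  refine neg_one_pow_of_cast ?_
  push_cast
  generalize (d : ZMod 2) = d
  generalize (V.length : ZMod 2) = x
  decide +revert

theorem sup_image_copy {τ : Q → Q} (hτ : ∀ p, τ (τ p) = p) (a : Set Q) :
    τ '' (a ⊔ τ '' a) = a ⊔ τ '' a := by
  rw [show a ⊔ τ '' a = a ∪ τ '' a from rfl, Set.image_union, Set.image_image, Set.union_comm]
  simp [hτ]

theorem cls_of_not_nodup {n : ℕ} {w : Word n} (h : ¬ w.Nodup) : cls k d w = 0 :=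
  cls_of_not k d fun h' => h h'.nodup

/-- A diagram in which all edges of a diagram are doubled vanishes. -/
theorem blockCls_double {V V' W : List (Q × Q)} {L : List (Set Q)} (hL : L ≠ [])
    (hV : V ≠ []) (h : V.map (Prod.map (idx L) (idx L)) = V'.map (Prod.map (idx L) (idx L))) :
    blockCls k d (V ++ V' ++ W) L = 0 := by
  obtain ⟨n, hn⟩ : ∃ n, L.length = n + 1 :=
    ⟨L.length - 1, by have := List.length_pos_iff.2 hL; omega⟩
  rw [blockCls, hn, normalCls]
  refine cls_of_not_nodup k d fun hnd => ?_
  rw [nf, List.map_append, List.map_append (l₁ := V), ← h] at hnd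
  obtain ⟨e, V, rfl⟩ := List.exists_cons_of_ne_nil hV
  have := (List.nodup_append.1 hnd).2.1
  simp at this

end Commutation

end KnotDiagram

end

/-! ### Self-products and the defect of the Leibniz rule for joined heads -/

noncomputable section

namespace KnotDiagram

open Letter

section Signs

variable {k : Type*} [CommRing k] {M : Type*} [AddCommGroup M] [Module k M]

/-- If 2 = 0, signs do not matter. The alternative in the hypothesis lets the even case and
characteristic 2 share one argument. -/
theorem sign_smul {m n : ℕ} (h : (2 : k) = 0 ∨ m % 2 = n % 2) (x : M) :
    (-1 : ℤ) ^ m • x = (-1 : ℤ) ^ n • x := by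
  rcases h with h | h
  · have h2 : x = -x := by
      rw [eq_neg_iff_add_eq_zero, ← two_smul k, h, zero_smul]
    have key : ∀ n : ℕ, (-1 : ℤ) ^ n • x = x := by
      intro n
      rcases neg_one_pow_eq_or ℤ n with h | h
      · rw [h, one_smul]
      · rw [h, neg_smul, one_smul, ← h2]
    rw [key, key]
  · rw [neg_one_pow_eq h]

end Signs

theorem mem_shuffles_of_mem_halfShuffles {α : Type*} {u w L : List α}
    (h : L ∈ halfShuffles u w) : L ∈ shuffles u w := by
  cases u with
  | nil => simpa [halfShuffles] using h
  | cons a u =>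
    cases w with
    | nil => simpa [halfShuffles] using h
    | cons b w =>
      rw [shuffles_cons_cons]
      exact List.mem_append_left _ h

section JoinIdentities

variable {Q : Type} (k : Type*) [CommRing k] (d : ℕ)

/-- The part of the differential which does not glue the left-most points. -/
def TStar.rest : TStar k d →ₗ[k] TStar k d := TStar.boundary k d - TStar.glueNext k d 0

theorem rest_blockCls {V : List (Q × Q)} {a : Set Q} {L : List (Set Q)}
    (h : Fits V (a :: L)) (hL : L ≠ []) : TStar.rest k d (blockCls k d V (a :: L)) =
      -bd L (fun u => blockCls k d V (a :: u)) :=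
  boundary_sub_glueNext_blockCls k d h hL

theorem Fits.cons_joinAt {V : List (Q × Q)} {a : Set Q} {L : List (Set Q)} (h : Fits V (a :: L))
    {i : ℕ} (hi : i + 1 < L.length) : Fits V (a :: KnotDiagram.joinAt i L) := by
  have := h.joinAt (i := i + 1) (by simpa using hi)
  obtain ⟨b, L, rfl⟩ := List.exists_cons_of_ne_nil
    (List.ne_nil_of_length_pos (by omega : 0 < L.length))
  exact this

theorem supp_cons_joinAt (a : Set Q) (L : List (Set Q)) (i : ℕ) :
    supp (a :: joinAt i L) = supp (a :: L) := by
  rw [supp_cons, supp_joinAt, supp_cons]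

theorem image_image_of_involutive {τ : Q → Q} (hτ : ∀ p, τ (τ p) = p) (B : Set Q) :
    τ '' (τ '' B) = B := by
  simp [Set.image_image, hτ]

/-- The shuffles of a list of blocks with its copy cancel each other. -/
theorem sh_copy_blockCls {τ : Q → Q} (hτ : ∀ p, τ (τ p) = p) {V W : List (Q × Q)}
    (hW : W.map (Prod.map τ τ) = W) (hV : V ≠ []) {H C : List (Set Q)} (hne : H ≠ [])
    (hH : H.map (Set.image τ) = H) (hC : C.map (Set.image τ) = C) (u : List (Set Q))
    (hp : (2 : k) = 0 ∨ ((d + 1) * V.length) % 2 = (u.length + 1) % 2) :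
    sh u (u.map (Set.image τ)) (fun X => sh X C fun Y =>
      blockCls k d (V ++ V.map (Prod.map τ τ) ++ W) (H ++ Y)) = 0 := by
  have hinj : Function.Injective τ := Function.LeftInverse.injective hτ
  -- With nothing to shuffle there are no pairs to cancel; but then all blocks are invariant under
  -- `τ`, and each edge occurs together with its copy at the same positions.
  by_cases hu : u = []
  · subst hu
    rw [List.map_nil, sh_nil_left, sh_nil_left]
    refine blockCls_double k d (by simp [hne]) hV ?_
    have hHC : (H ++ C).map (Set.image τ) = H ++ C := by rw [List.map_append, hH, hC]
    rw [List.map_map]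
    refine List.map_congr_left fun e _ => ?_
    have key : ∀ p, idx (H ++ C) (τ p) = idx (H ++ C) p := fun p => by
      rw [← idx_map_image hinj (H ++ C) p, hHC]
    simp [Prod.map, key]
  -- The parity hypothesis turns the sign (-1)^((d+1)|V|) of the exchange into −(-1)^|u|, the
  -- antisymmetry required for cancellation.
  · refine sh_copy_eq_zero _ (image_image_of_involutive hτ) hu _ fun X => ?_
    calc _ = sh (X.map (Set.image τ)) (C.map (Set.image τ)) (fun Y =>
          blockCls k d (V ++ V.map (Prod.map τ τ) ++ W) (H ++ Y)) := by rw [hC]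
      _ = _ := ?_
    rw [sh_map]
    simp only [blockCls_cons_copy k d hτ V W hW hne hH]
    rw [sh_smul, sign_smul hp, pow_succ, mul_neg_one]

theorem Fits.ne_nil {V : List (Q × Q)} {L : List (Set Q)} (h : Fits V L) (hL : L ≠ []) :
    V ≠ [] := by
  obtain ⟨a, u, rfl⟩ := List.exists_cons_of_ne_nil hL
  obtain ⟨e, he, -⟩ := h.covering a (by simp)
  exact List.ne_nil_of_mem he

/-- The second factor is replaced by its copy under `τ`. The joined head is invariant under `τ`, and
the shuffles of the tail with its copy cancel; for an even degree the tail has the required parity.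
-/
theorem join_self_blockCls {τ : Q → Q} (hτ : ∀ p, τ (τ p) = p) {V : List (Q × Q)}
    {L : List (Set Q)} (h : Fits V L) (hL : L ≠ [])
    (hd : Disjoint (supp L) (supp (L.map (Set.image τ))))
    (hp : (2 : k) = 0 ∨ ((d + 1) * V.length + L.length) % 2 = 0) :
    TStar.join k d (blockCls k d V L) (blockCls k d V L) = 0 := by
  have hinj : Function.Injective τ := Function.LeftInverse.injective hτ
  have hV := h.ne_nil hL
  obtain ⟨a, u, rfl⟩ := List.exists_cons_of_ne_nil hL
  have := join_blockCls k d h (h.map hinj) hd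
  have hz := sh_copy_blockCls k d hτ (W := []) (by simp) hV (List.cons_ne_nil (a ⊔ τ '' a) [])
    (by rw [List.map_cons, sup_image_copy hτ, List.map_nil]) (C := []) (by simp) u
    (hp.imp_right fun hp => by rw [List.length_cons] at hp; omega)
  simp only [sh_nil_right, List.append_nil, List.cons_append, List.nil_append] at hz
  rw [← List.map_cons (f := Set.image τ), blockCls_map k d hinj] at this
  rw [this, hz, smul_zero]

variable {V₁ V₂ V₃ : List (Q × Q)} {a b c : Set Q} {u w t : List (Set Q)}

/-- In every term the joined head is followed by the second point of the first factor, so the two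
gluings can be performed in either order. The minus sign comes from the first factor having one
point fewer when its own gluing is performed before the join. -/
theorem glueNext_joinHalf_blockCls (h₁ : Fits V₁ (a :: u)) (h₂ : Fits V₂ (b :: w))
    (hd : Disjoint (supp (a :: u)) (supp (b :: w))) (hu : u ≠ []) :
    TStar.glueNext k d 0 (TStar.joinHalf k d (blockCls k d V₁ (a :: u))
      (blockCls k d V₂ (b :: w))) =
      -TStar.join k d (TStar.glueNext k d 0 (blockCls k d V₁ (a :: u)))
        (blockCls k d V₂ (b :: w)) := by
  obtain ⟨c, u, rfl⟩ := List.exists_cons_of_ne_nil hu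
  rw [joinHalf_blockCls k d h₁ h₂ hd, glueNext_zero_blockCls k d h₁,
    join_blockCls k d h₁.joinHead h₂ (by
      have := supp_joinAt 0 (a :: c :: u)
      rw [joinAt] at this
      rwa [this]), map_zsmul, hs, linear_sh, List.length_cons (a := c), ← add_assoc, pow_succ,
      mul_neg_one, neg_smul]
  congr 2
  refine sh_congr fun L hL => ?_
  rw [glueNext_zero_blockCls k d (h₁.joinHeads h₂ hd
    (mem_shuffles_of_mem_halfShuffles (cons_mem_halfShuffles c hL))), sup_right_comm]

/-- Behind the joined head, the next point belongs to one of the two tails; both are nonempty, so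
this is `sh_eq_hs_add_hs` for the tails. -/
theorem join_eq_joinHalf_blockCls (h₁ : Fits V₁ (a :: u)) (h₂ : Fits V₂ (b :: w))
    (hd : Disjoint (supp (a :: u)) (supp (b :: w))) (hu : u ≠ []) (hw : w ≠ []) :
    TStar.join k d (blockCls k d V₁ (a :: u)) (blockCls k d V₂ (b :: w)) =
      TStar.joinHalf k d (blockCls k d V₁ (a :: u)) (blockCls k d V₂ (b :: w)) -
        (-1 : ℤ) ^ (((d + 1) * V₁.length + (a :: u).length) *
          ((d + 1) * V₂.length + (b :: w).length)) •
        TStar.joinHalf k d (blockCls k d V₂ (b :: w)) (blockCls k d V₁ (a :: u)) := by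
  rw [join_blockCls k d h₁ h₂ hd, joinHalf_blockCls k d h₁ h₂ hd,
    joinHalf_blockCls k d h₂ h₁ hd.symm, hs_swap_heads k d V₁ V₂ a b u w, sh_eq_hs_add_hs hu hw, smul_add, smul_smul,
    smul_smul, smul_smul, ← pow_add, ← pow_add, ← pow_add, sub_eq_add_neg, ← neg_smul]
  congr 2
  refine neg_one_pow_neg_of_cast ?_
  simp only [List.length_cons]
  push_cast
  generalize (d : ZMod 2) = d
  generalize (V₁.length : ZMod 2) = x
  generalize (V₂.length : ZMod 2) = y
  generalize (u.length : ZMod 2) = z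
  generalize (w.length : ZMod 2) = t
  decide +revert

/-- The heads of all three factors are united on both sides; for the tails this is the Zinbiel
identity `hs_hs`. -/
theorem joinHalf_joinHalf_blockCls (h₁ : Fits V₁ (a :: u)) (h₂ : Fits V₂ (b :: w))
    (h₃ : Fits V₃ (c :: t)) (d₁₂ : Disjoint (supp (a :: u)) (supp (b :: w)))
    (d₁₃ : Disjoint (supp (a :: u)) (supp (c :: t)))
    (d₂₃ : Disjoint (supp (b :: w)) (supp (c :: t))) (hu : u ≠ []) :
    TStar.joinHalf k d (TStar.joinHalf k d (blockCls k d V₁ (a :: u)) (blockCls k d V₂ (b :: w)))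
      (blockCls k d V₃ (c :: t)) =
      -((-1 : ℤ) ^ ((d + 1) * V₁.length + (a :: u).length) •
        TStar.joinHalf k d (blockCls k d V₁ (a :: u))
          (TStar.join k d (blockCls k d V₂ (b :: w)) (blockCls k d V₃ (c :: t)))) := by
  have hmem : ∀ L ∈ halfShuffles u w, L ∈ shuffles u w :=
    fun L => mem_shuffles_of_mem_halfShuffles
  have e₁ : TStar.joinHalf k d
      (TStar.joinHalf k d (blockCls k d V₁ (a :: u)) (blockCls k d V₂ (b :: w)))
      (blockCls k d V₃ (c :: t)) =
      (-1 : ℤ) ^ ((d + 1) * V₁.length * (w.length + 1) + u.length +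
        ((d + 1) * (V₁ ++ V₂).length * (t.length + 1) + (u.length + w.length))) •
        hs u w fun L => hs L t fun M => blockCls k d ((V₁ ++ V₂) ++ V₃) ((a ⊔ b ⊔ c) :: M) := by
    rw [joinHalf_blockCls k d h₁ h₂ d₁₂, map_zsmul, linear_hs, LinearMap.smul_apply, hs_apply,
      List.length_cons, pow_add _ (_ + _), mul_smul]
    congr 1
    rw [← hs_smul]
    refine hs_congr fun L hL => ?_
    rw [joinHalf_blockCls k d (h₁.joinHeads h₂ d₁₂ (hmem L hL)) h₃ (by
      rw [supp_join (hmem L hL), Set.disjoint_union_left]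
      exact ⟨d₁₃, d₂₃⟩), length_of_mem_shuffles (hmem L hL), List.length_cons]
  have e₂ : TStar.joinHalf k d (blockCls k d V₁ (a :: u))
      (TStar.join k d (blockCls k d V₂ (b :: w)) (blockCls k d V₃ (c :: t))) =
      (-1 : ℤ) ^ ((d + 1) * V₂.length * (t.length + 1) + w.length +
        ((d + 1) * V₁.length * (w.length + t.length + 1) + u.length)) •
        sh w t fun L => hs u L fun M => blockCls k d (V₁ ++ (V₂ ++ V₃)) ((a ⊔ (b ⊔ c)) :: M) := by
    rw [join_blockCls k d h₂ h₃ d₂₃, map_zsmul, linear_sh, List.length_cons, pow_add _ (_ + _),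
      mul_smul]
    congr 1
    rw [← sh_smul]
    refine sh_congr fun L hL => ?_
    rw [joinHalf_blockCls k d h₁ (h₂.joinHeads h₃ d₂₃ hL) (by
      rw [supp_join hL, Set.disjoint_union_right]
      exact ⟨d₁₂, d₁₃⟩), List.length_cons, length_of_mem_shuffles hL]
  rw [e₁, e₂, hs_hs hu, List.append_assoc, sup_assoc, smul_smul, ← pow_add, ← neg_smul]
  congr 1
  refine neg_one_pow_neg_of_cast ?_
  simp only [List.length_cons, List.length_append]
  push_cast
  generalize (d : ZMod 2) = d
  generalize (V₁.length : ZMod 2) = x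
  generalize (V₂.length : ZMod 2) = y
  generalize (u.length : ZMod 2) = z
  generalize (w.length : ZMod 2) = r
  generalize (t.length : ZMod 2) = s
  decide +revert

theorem joinHalf_rest_left (h₁ : Fits V₁ (a :: u)) (h₂ : Fits V₂ (b :: w))
    (hd : Disjoint (supp (a :: u)) (supp (b :: w))) (hu : u ≠ []) :
    TStar.joinHalf k d (TStar.rest k d (blockCls k d V₁ (a :: u))) (blockCls k d V₂ (b :: w)) =
      (-1 : ℤ) ^ ((d + 1) * V₁.length * (w.length + 1) + u.length) •
        bd u fun v => hs v w fun L => blockCls k d (V₁ ++ V₂) ((a ⊔ b) :: L) := by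
  rw [rest_blockCls k d h₁ hu, map_neg, linear_bd, LinearMap.neg_apply, bd_apply,
    ← neg_one_zsmul, ← bd_smul, ← bd_smul]
  refine bd_congr_joinAt fun i hi => ?_
  rw [joinHalf_blockCls k d (h₁.cons_joinAt hi) h₂ (by rwa [supp_cons_joinAt]), neg_one_smul,
    ← neg_smul, List.length_cons]
  congr 1
  have := length_joinAt hi
  exact (neg_one_pow_eq_neg (by omega)).symm

theorem joinHalf_rest_right (h₁ : Fits V₁ (a :: u)) (h₂ : Fits V₂ (b :: w))
    (hd : Disjoint (supp (a :: u)) (supp (b :: w))) (hw : w ≠ []) :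
    TStar.joinHalf k d (blockCls k d V₁ (a :: u)) (TStar.rest k d (blockCls k d V₂ (b :: w))) =
      -((-1 : ℤ) ^ ((d + 1) * V₁.length * w.length + u.length) •
        bd w fun v => hs u v fun L => blockCls k d (V₁ ++ V₂) ((a ⊔ b) :: L)) := by
  rw [rest_blockCls k d h₂ hw, map_neg, linear_bd, ← bd_smul]
  congr 1
  refine bd_congr_joinAt fun i hi => ?_
  rw [joinHalf_blockCls k d h₁ (h₂.cons_joinAt hi) (by rwa [supp_cons_joinAt]), List.length_cons,
    length_joinAt hi]

/-- The failure of the Leibniz rule. -/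
theorem rest_joinHalf_blockCls (h₁ : Fits V₁ (a :: u)) (h₂ : Fits V₂ (b :: w))
    (hd : Disjoint (supp (a :: u)) (supp (b :: w))) (hu : u ≠ []) (hw : w ≠ [])
    (hp : (2 : k) = 0 ∨ ((d + 1) * V₁.length + (a :: u).length) % 2 = 1) :
    TStar.rest k d (TStar.joinHalf k d (blockCls k d V₁ (a :: u)) (blockCls k d V₂ (b :: w))) +
      TStar.joinHalf k d (TStar.rest k d (blockCls k d V₁ (a :: u))) (blockCls k d V₂ (b :: w)) -
      TStar.joinHalf k d (blockCls k d V₁ (a :: u)) (TStar.rest k d (blockCls k d V₂ (b :: w))) =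
      -((-1 : ℤ) ^ ((d + 1) * V₁.length * (w.length + 1) + u.length) •
        joinHeads u w fun L => blockCls k d (V₁ ++ V₂) ((a ⊔ b) :: L)) := by
  have hmem : ∀ L ∈ halfShuffles u w, L ∈ shuffles u w ∧ L ≠ [] := by
    intro L hL
    refine ⟨mem_shuffles_of_mem_halfShuffles hL, ?_⟩
    obtain ⟨x, u, rfl⟩ := List.exists_cons_of_ne_nil hu
    obtain ⟨L, -, rfl⟩ := List.mem_map.1 hL
    exact List.cons_ne_nil _ _
  rw [joinHalf_rest_left k d h₁ h₂ hd hu, joinHalf_rest_right k d h₁ h₂ hd hw,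
    joinHalf_blockCls k d h₁ h₂ hd, map_zsmul, linear_hs, hs_congr fun L hL =>
      (rest_blockCls k d (h₁.joinHeads h₂ hd (hmem L hL).1) (hmem L hL).2).trans
        (neg_one_zsmul _).symm, hs_smul, hs_bd hu]
  simp only [List.length_cons]
  generalize bd u (fun v => hs v w fun L => blockCls k d (V₁ ++ V₂) ((a ⊔ b) :: L)) = x
  generalize bd w (fun v => hs u v fun L => blockCls k d (V₁ ++ V₂) ((a ⊔ b) :: L)) = y
  generalize joinHeads u w (fun L => blockCls k d (V₁ ++ V₂) ((a ⊔ b) :: L)) = z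
  -- This is where odd degree of the first factor enters: (d+1)|V₁| + |u| is then even.
  have hy : (-1 : ℤ) ^ ((d + 1) * V₁.length * (w.length + 1) + u.length) • (-1 : ℤ) ^ u.length • y =
      (-1 : ℤ) ^ ((d + 1) * V₁.length * w.length + u.length) • y := by
    rw [smul_smul, ← pow_add]
    refine sign_smul (hp.imp_right fun hp => ?_) y
    rw [List.length_cons] at hp
    have : (d + 1) * V₁.length * (w.length + 1) = (d + 1) * V₁.length * w.length +
      (d + 1) * V₁.length := by ring
    rw [this]
    omega
  rw [neg_one_smul, smul_neg, smul_add, smul_add, hy]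
  abel

/-- The defect joins the heads of the two tails as well. For a diagram and its copy the first two
blocks become invariant under `τ`, and the shuffles of what remains cancel. -/
theorem rest_joinHalf_self {τ : Q → Q} (hτ : ∀ p, τ (τ p) = p) {V : List (Q × Q)}
    {a : Set Q} {u : List (Set Q)} (h : Fits V (a :: u)) (hu : u ≠ [])
    (hd : Disjoint (supp (a :: u)) (supp ((a :: u).map (Set.image τ))))
    (hp : (2 : k) = 0 ∨ ((d + 1) * V.length + (a :: u).length) % 2 = 1) :
    TStar.rest k d (TStar.joinHalf k d (blockCls k d V (a :: u)) (blockCls k d V (a :: u))) +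
      TStar.joinHalf k d (TStar.rest k d (blockCls k d V (a :: u))) (blockCls k d V (a :: u)) -
      TStar.joinHalf k d (blockCls k d V (a :: u)) (TStar.rest k d (blockCls k d V (a :: u))) =
      0 := by
  have hinj : Function.Injective τ := Function.LeftInverse.injective hτ
  have := rest_joinHalf_blockCls k d h (h.map hinj) hd hu (by simpa using hu) hp
  rw [← List.map_cons (f := Set.image τ), blockCls_map k d hinj] at this
  rw [this]
  obtain ⟨b, u, rfl⟩ := List.exists_cons_of_ne_nil hu
  have hz := sh_copy_blockCls k d hτ (W := []) (by simp) (h.ne_nil (List.cons_ne_nil _ _))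
    (List.cons_ne_nil (a ⊔ τ '' a) [b ⊔ τ '' b])
    (by simp only [List.map_cons, sup_image_copy hτ, List.map_nil]) (C := []) (by simp) u
    (hp.imp_right fun hp => by simp only [List.length_cons] at hp; omega)
  simp only [sh_nil_right, List.append_nil, List.cons_append, List.nil_append] at hz
  rw [List.map_cons, joinHeads, hz, smul_zero, smul_zero, neg_zero]

/-- The inner product starts, behind its head, with the second point of the copy. Hence the defect
of the outer product again joins the second points of the diagram and of its copy, and the shuffles
of the remaining tails cancel, the third factor being invariant under `τ`. -/
theorem rest_joinHalf_joinHalf {τ : Q → Q} (hτ : ∀ p, τ (τ p) = p) (h : Fits V₁ (a :: u))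
    (hu : u ≠ []) (hd : Disjoint (supp (a :: u)) (supp ((a :: u).map (Set.image τ))))
    (hp : (2 : k) = 0 ∨ ((d + 1) * V₁.length + (a :: u).length) % 2 = 1)
    (h₃ : Fits V₃ (c :: t)) (d₁₃ : Disjoint (supp (a :: u)) (supp (c :: t)))
    (d₂₃ : Disjoint (supp ((a :: u).map (Set.image τ))) (supp (c :: t)))
    (hV₃ : V₃.map (Prod.map τ τ) = V₃) (hc : (c :: t).map (Set.image τ) = c :: t) :
    TStar.rest k d (TStar.joinHalf k d (blockCls k d V₁ (a :: u))
        (TStar.joinHalf k d (blockCls k d V₁ (a :: u)) (blockCls k d V₃ (c :: t)))) +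
      TStar.joinHalf k d (TStar.rest k d (blockCls k d V₁ (a :: u)))
        (TStar.joinHalf k d (blockCls k d V₁ (a :: u)) (blockCls k d V₃ (c :: t))) -
      TStar.joinHalf k d (blockCls k d V₁ (a :: u))
        (TStar.rest k d
          (TStar.joinHalf k d (blockCls k d V₁ (a :: u)) (blockCls k d V₃ (c :: t)))) = 0 := by
  have hinj : Function.Injective τ := Function.LeftInverse.injective hτ
  -- The defect is a linear function of its second argument, so it can be evaluated on each term of
  -- the inner product separately.
  let E : TStar k d →ₗ[k] TStar k d :=
    TStar.rest k d ∘ₗ TStar.joinHalf k d (blockCls k d V₁ (a :: u)) +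
      TStar.joinHalf k d (TStar.rest k d (blockCls k d V₁ (a :: u))) -
      TStar.joinHalf k d (blockCls k d V₁ (a :: u)) ∘ₗ TStar.rest k d
  change E (TStar.joinHalf k d (blockCls k d V₁ (a :: u)) (blockCls k d V₃ (c :: t))) = 0
  obtain ⟨b, u, rfl⟩ := List.exists_cons_of_ne_nil hu
  have h₂ := h.map hinj
  have e := joinHalf_blockCls k d h₂ h₃ d₂₃
  rw [← List.map_cons (f := Set.image τ), blockCls_map k d hinj] at e
  rw [e, map_zsmul, linear_hs, List.map_cons, hs]
  have key : ∀ X ∈ shuffles (u.map (Set.image τ)) t,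
      E (blockCls k d (V₁.map (Prod.map τ τ) ++ V₃) ((τ '' a ⊔ c) :: τ '' b :: X)) =
      (-1 : ℤ) ^ ((d + 1) * V₁.length * (u.length + t.length + 1 + 1) + (u.length + 1) + 1 +
        u.length) • sh u X fun L => blockCls k d (V₁ ++ V₁.map (Prod.map τ τ) ++ V₃)
          ([a ⊔ τ '' a ⊔ c, b ⊔ τ '' b] ++ L) := by
    intro X hX
    have hX' := cons_mem_halfShuffles (τ '' b) hX
    have hX'' := mem_shuffles_of_mem_halfShuffles hX'
    have := rest_joinHalf_blockCls k d h (h₂.joinHeads h₃ d₂₃ hX'') (by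
      rw [supp_join hX'', Set.disjoint_union_right]
      exact ⟨hd, d₁₃⟩) hu (List.cons_ne_nil _ _) hp
    refine this.trans ?_
    rw [joinHeads, smul_smul, ← pow_add, ← neg_smul, List.length_cons, List.length_cons,
      length_of_mem_shuffles hX, List.length_map, ← mul_neg_one, ← pow_succ, List.append_assoc,
      sup_assoc]
    congr 1
    rw [add_right_comm]
  -- Associativity lets the tail `u` be shuffled with its copy first and with `t` afterwards.
  rw [sh_congr key, sh_smul, ← sh_assoc, sh_copy_blockCls k d hτ hV₃
    (h.ne_nil (List.cons_ne_nil _ _)) (List.cons_ne_nil _ _) ?_ (List.cons_eq_cons.1 hc).2 u,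
    smul_zero, smul_zero]
  · exact hp.imp_right fun hp => by simp only [List.length_cons] at hp; omega
  · have hc' : τ '' c = c := (List.cons_eq_cons.1 hc).1
    have hac : τ '' (a ⊔ τ '' a ⊔ c) = a ⊔ τ '' a ⊔ c := by
      have : τ '' (a ⊔ τ '' a ⊔ c) = τ '' (a ⊔ τ '' a) ⊔ τ '' c := Set.image_union _ _ _
      rw [this, sup_image_copy hτ, hc']
    simp only [List.map_cons, sup_image_copy hτ, hac, List.map_nil]

end JoinIdentities

end KnotDiagram

end

noncomputable section

namespace KnotDiagram

open Letter

/-! ### Diagrams in normal form span -/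

section Sums

variable {α R M S : Type*} [SemilatticeSup R] [AddCommGroup M] [SetLike S M] [AddSubgroupClass S M]
  {s : S}

theorem sh_mem {u w : List α} {φ : List α → M} (h : ∀ L ∈ shuffles u w, φ L ∈ s) :
    sh u w φ ∈ s := by
  induction u, w using shuffle_induction generalizing φ with
  | left w => simpa using h
  | right u => simpa using h
  | cons a b u w h1 h2 =>
    rw [shuffles_cons_cons] at h
    rw [sh_cons_cons]
    refine add_mem (h1 fun L hL => h _ ?_) (zsmul_mem (h2 fun L hL => h _ ?_) _)
    · exact List.mem_append_left _ (List.mem_map.2 ⟨L, hL, rfl⟩)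
    · exact List.mem_append_right _ (List.mem_map.2 ⟨L, hL, rfl⟩)

theorem hs_mem {u w : List α} {φ : List α → M} (h : ∀ L ∈ halfShuffles u w, φ L ∈ s) :
    hs u w φ ∈ s := by
  cases u with
  | nil => exact h _ (by simp [halfShuffles])
  | cons a u => exact sh_mem fun L hL => h _ (List.mem_map.2 ⟨L, hL, rfl⟩)

theorem bd_mem {L : List R} {φ : List R → M} (h : ∀ i, i + 1 < L.length → φ (joinAt i L) ∈ s) :
    bd L φ ∈ s := by
  rw [bd_eq_sum]
  refine sum_mem fun i hi => zsmul_mem (h i ?_) _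
  rw [Finset.mem_range] at hi
  omega

end Sums

/-- The edges define an oriented monomial on the points `0, …, n - 1`. -/
structure IsNormal (n : ℕ) (v : List (ℕ × ℕ)) : Prop where
  le : ∀ e ∈ v, e.1 ≤ e.2
  lt : ∀ e ∈ v, e.2 < n
  covering : ∀ j < n, ∃ e ∈ v, e.1 = j ∨ e.2 = j

theorem Fits.isNormal {Q : Type} {V : List (Q × Q)} {L : List (Set Q)} (h : Fits V L) :
    IsNormal L.length (V.map (Prod.map (idx L) (idx L))) := by
  refine ⟨fun e he => ?_, fun e he => ?_, fun j hj => ?_⟩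
  · obtain ⟨e, he', rfl⟩ := List.mem_map.1 he
    exact h.idx_le e he'
  · obtain ⟨e, he', rfl⟩ := List.mem_map.1 he
    exact h.idx_lt e he'
  · obtain ⟨e, he, h'⟩ := h.covering (L[j]) (List.getElem_mem _)
    exact ⟨_, List.mem_map.2 ⟨e, he, rfl⟩, h'.imp (idx_eq h.disjoint _) (idx_eq h.disjoint _)⟩

/-- The labels with a given tag. -/
def tagged (t : ℕ) : Set (ℕ × ℕ) := {q | q.1 = t}

theorem disjoint_tagged {s t : ℕ} (h : s ≠ t) : Disjoint (tagged s) (tagged t) :=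
  Set.disjoint_left.2 fun _ h₁ h₂ => h (h₁.symm.trans h₂)

/-- The points `0, …, n - 1` as blocks of labels with a given tag. -/
def tagBlocks (t n : ℕ) : List (Set (ℕ × ℕ)) := (List.range n).map fun i => {(t, i)}

/-- The edges between the labels with a given tag. -/
def tagEdges (t : ℕ) (v : List (ℕ × ℕ)) : List ((ℕ × ℕ) × (ℕ × ℕ)) :=
  v.map (Prod.map (Prod.mk t) (Prod.mk t))

theorem length_tagBlocks (t n : ℕ) : (tagBlocks t n).length = n := by simp [tagBlocks]

theorem supp_tagBlocks (t n : ℕ) : supp (tagBlocks t n) ⊆ tagged t := by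
  rintro p ⟨B, hB, hp⟩
  obtain ⟨i, -, rfl⟩ := List.mem_map.1 hB
  rw [Set.mem_singleton_iff.1 hp]
  rfl

theorem pairwise_tagBlocks (t n : ℕ) : (tagBlocks t n).Pairwise Disjoint := by
  refine List.Pairwise.map _ (R := fun i j => i ≠ j) (fun i j hij => ?_) List.nodup_range
  simpa using hij

theorem idx_tagBlocks {t n i : ℕ} (hi : i < n) : idx (tagBlocks t n) (t, i) = i :=
  idx_eq (pairwise_tagBlocks t n) (by rwa [length_tagBlocks]) (by simp [tagBlocks])

theorem IsNormal.fits {n : ℕ} {v : List (ℕ × ℕ)} (h : IsNormal n v) (t : ℕ) :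
    Fits (tagEdges t v) (tagBlocks t n) := by
  refine ⟨pairwise_tagBlocks t n, fun e he => ?_, fun e he => ?_, fun B hB => ?_⟩
  · obtain ⟨e, he', rfl⟩ := List.mem_map.1 he
    rw [Prod.map_snd, idx_tagBlocks (h.lt e he'), length_tagBlocks]
    exact h.lt e he'
  · obtain ⟨e, he', rfl⟩ := List.mem_map.1 he
    rw [Prod.map_snd, Prod.map_fst, idx_tagBlocks (h.lt e he'),
      idx_tagBlocks ((h.le e he').trans_lt (h.lt e he'))]
    exact h.le e he'
  · obtain ⟨i, hi, rfl⟩ := List.mem_map.1 hB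
    obtain ⟨e, he, h'⟩ := h.covering i (List.mem_range.1 hi)
    refine ⟨_, List.mem_map.2 ⟨e, he, rfl⟩, h'.imp (fun h => ?_) (fun h => ?_)⟩
    · simp [h]
    · simp [h]

variable (k : Type*) [CommRing k] (d : ℕ)

theorem IsNormal.blockCls {n : ℕ} {v : List (ℕ × ℕ)} (h : IsNormal n v) (t : ℕ) :
    blockCls k d (tagEdges t v) (tagBlocks t n) = normalCls k d n v := by
  rw [KnotDiagram.blockCls, length_tagBlocks, tagEdges, List.map_map]
  congr 1
  conv_rhs => rw [← List.map_id v]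
  refine List.map_congr_left fun e he => ?_
  have h₂ := h.lt e he
  have h₁ := (h.le e he).trans_lt h₂
  simp [Prod.map, idx_tagBlocks h₁, idx_tagBlocks h₂]

/-- The span of the diagrams with at least `j` active points whose degree has the parity of `p`
(no condition if `2 = 0`). -/
def paritySpan (j p : ℕ) : Submodule k (TStar k d) :=
  Submodule.span k {x | ∃ n v, IsNormal n v ∧ j ≤ n ∧
    ((2 : k) = 0 ∨ ((d + 1) * v.length + n) % 2 = p % 2) ∧ x = normalCls k d n v}

/-- A diagram with blocks of labels with the tag `t`, with at least `j` active points, whose degree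
has the parity of `p`. -/
structure IsGenerator (t j p : ℕ) (V : List ((ℕ × ℕ) × (ℕ × ℕ))) (L : List (Set (ℕ × ℕ))) :
    Prop where
  fits : Fits V L
  supp : supp L ⊆ tagged t
  le : j ≤ L.length
  parity : (2 : k) = 0 ∨ ((d + 1) * V.length + L.length) % 2 = p % 2

variable {k d}

theorem blockCls_mem {Q : Type} {V : List (Q × Q)} {L : List (Set Q)} {j p : ℕ} (h : Fits V L)
    (hj : j ≤ L.length) (hp : (2 : k) = 0 ∨ ((d + 1) * V.length + L.length) % 2 = p % 2) :
    blockCls k d V L ∈ paritySpan k d j p :=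
  Submodule.subset_span ⟨_, _, h.isNormal, hj, by rwa [List.length_map], rfl⟩

/-- The tag is free: different arguments of an operation receive different tags and hence disjoint
labels. -/
theorem paritySpan_induction {j p : ℕ} (t : ℕ) {P : TStar k d → Prop}
    (gen : ∀ V L, IsGenerator k d t j p V L → P (blockCls k d V L)) (zero : P 0)
    (add : ∀ x y, P x → P y → P (x + y)) (smul : ∀ (c : k) x, P x → P (c • x)) {x : TStar k d}
    (hx : x ∈ paritySpan k d j p) : P x := by
  refine Submodule.span_induction ?_ zero (fun x y _ _ => add x y) (fun c x _ => smul c x) hx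
  rintro _ ⟨n, v, h, hj, hp, rfl⟩
  rw [← h.blockCls k d t]
  exact gen _ _ ⟨h.fits t, supp_tagBlocks t n, by rwa [length_tagBlocks],
    by rwa [tagEdges, List.length_map, length_tagBlocks]⟩

theorem IsGenerator.disjoint {s t j p j' p' : ℕ} {V V' : List ((ℕ × ℕ) × (ℕ × ℕ))}
    {L L' : List (Set (ℕ × ℕ))} (h : IsGenerator k d s j p V L) (h' : IsGenerator k d t j' p' V' L')
    (hst : s ≠ t) : Disjoint (KnotDiagram.supp L) (KnotDiagram.supp L') :=
  (disjoint_tagged hst).mono h.supp h'.supp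

theorem paritySpan_mono {i j p : ℕ} (h : i ≤ j) : paritySpan k d j p ≤ paritySpan k d i p := by
  refine Submodule.span_mono ?_
  rintro _ ⟨n, v, hv, hj, hp, rfl⟩
  exact ⟨n, v, hv, h.trans hj, hp, rfl⟩

theorem paritySpan_congr {j p q : ℕ} (h : p % 2 = q % 2) :
    paritySpan k d j p = paritySpan k d j q := by
  rw [paritySpan, paritySpan, h]

/-- The points and edges of a letter which is not a point, in their order. -/
def orient {n : ℕ} : Letter (Fin n) → Fin n × Fin n
  | pt a => (a, a)
  | chord a b => (min a b, max a b)
  | ast a => (a, a)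

-- Each chord pointing to the left is reversed, at the cost of (-1)^d; in the induction the letters
-- already treated move into the prefix `X`.
variable (k d) in
theorem exists_cls_orient {n : ℕ} (X w : Word n) (h₁ : ∀ a, pt a ∉ w)
    (h₂ : ∀ a b, chord a b ∈ w → a ≠ b) :
    ∃ s : ℤˣ, cls k d (X ++ w) = s • cls k d (X ++ (w.map orient).map edge) := by
  induction w generalizing X with
  | nil => exact ⟨1, by simp⟩
  | cons l w ih =>
    obtain ⟨s, hs⟩ := ih (X ++ [edge (orient l)]) (fun a ha => h₁ a (List.mem_cons_of_mem _ ha))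
      fun a b hab => h₂ a b (List.mem_cons_of_mem _ hab)
    simp only [List.append_assoc, List.cons_append, List.nil_append] at hs
    rw [List.map_cons, List.map_cons]
    have key : ∃ s : ℤˣ, cls k d (X ++ l :: w) = s • cls k d (X ++ edge (orient l) :: w) := by
      cases l with
      | pt a => exact absurd (List.mem_cons_self ..) (h₁ a)
      | ast a => exact ⟨1, by simp [orient, edge]⟩
      | chord a b =>
        have hab : a ≠ b := h₂ a b (List.mem_cons_self ..)
        rcases lt_or_gt_of_ne hab with h | h
        · exact ⟨1, by simp [orient, edge, min_eq_left h.le, max_eq_right h.le, hab]⟩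
        · refine ⟨(d : ℤ).negOnePow, ?_⟩
          have := cls_reverse k d X w a b
          simp only [List.append_assoc, List.cons_append, List.nil_append] at this
          rw [this]
          simp [orient, edge, min_eq_right h.le, max_eq_left h.le, hab.symm]
    obtain ⟨s', hs'⟩ := key
    exact ⟨s' * s, by rw [hs', hs, mul_smul]⟩

theorem normalCls_map_val {n : ℕ} (v : List (Fin n × Fin n)) :
    normalCls k d n (v.map (Prod.map Fin.val Fin.val)) = cls k d (nf v) := by
  cases n with
  | zero => rw [eq_nil_of_zero (nf v), normalCls]
  | succ n =>
    rw [normalCls, List.map_map]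
    congr 2
    conv_rhs => rw [← List.map_id v]
    refine List.map_congr_left fun e _ => ?_
    simp [Prod.map]

variable (k d) in
/-- Each diagram is up to sign in normal form. -/
theorem exists_normal (D : Diagram) : ∃ (s : ℤˣ) (v : List (ℕ × ℕ)), IsNormal D.n v ∧
    cls k d D.word = s • normalCls k d D.n v ∧ D.deg d = ((d : ℤ) - 1) * v.length - D.n := by
  classical
  obtain ⟨n, w, hw⟩ := D
  simp only [Diagram.deg]
  let isPt : Letter (Fin n) → Bool := fun l => decide (∃ a, l = pt a)
  let r := w.filter fun l => !isPt l
  have hp : w.Perm (pts n ++ r) := by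
    refine (List.filter_append_perm isPt w).symm.trans (List.Perm.append_right _ ?_)
    refine (List.perm_ext_iff_of_nodup (hw.nodup.filter _) ?_).2 fun l => ?_
    · exact (List.nodup_finRange n).map fun a b h => by injection h
    · simp only [List.mem_filter, isPt, decide_eq_true_eq, pts, List.mem_map, List.mem_finRange,
        true_and]
      constructor
      · rintro ⟨-, a, rfl⟩
        exact ⟨a, rfl⟩
      · rintro ⟨a, rfl⟩
        exact ⟨hw.pt_mem a, a, rfl⟩
  have hr : ∀ l ∈ r, l ∈ w ∧ ∀ a, l ≠ pt a := by
    intro l hl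
    simpa [r, isPt] using hl
  obtain ⟨s₁, h₁⟩ := exists_cls_perm k d hp
  obtain ⟨s₂, h₂⟩ := exists_cls_orient k d (pts n) r (fun a ha => (hr _ ha).2 a rfl)
    fun a b hab => hw.chord_ne a b (hr _ hab).1
  refine ⟨s₁ * s₂, (r.map orient).map (Prod.map Fin.val Fin.val), ⟨fun e he => ?_, fun e he => ?_,
    fun j hj => ?_⟩, ?_, ?_⟩
  · simp only [List.map_map, List.mem_map] at he
    obtain ⟨l, -, rfl⟩ := he
    cases l <;> simp [orient]
  · obtain ⟨e, -, rfl⟩ := List.mem_map.1 he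
    exact e.2.isLt
  · have hmem : ∀ l ∈ w, (∀ a, l ≠ pt a) → Prod.map Fin.val Fin.val (orient l) ∈
        (r.map orient).map (Prod.map Fin.val Fin.val) := fun l hl hne =>
      List.mem_map.2 ⟨_, List.mem_map.2 ⟨l, by simpa [r, isPt] using ⟨hl, hne⟩, rfl⟩, rfl⟩
    rcases hw.touched ⟨j, hj⟩ with h | ⟨b, h | h⟩
    · exact ⟨_, hmem _ h (by simp), Or.inl rfl⟩
    · refine ⟨_, hmem _ h (by simp), ?_⟩
      simp only [orient, Prod.map]
      rcases le_total (⟨j, hj⟩ : Fin n) b with h | h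
      · exact Or.inl (by rw [min_eq_left h])
      · exact Or.inr (by rw [max_eq_left h])
    · refine ⟨_, hmem _ h (by simp), ?_⟩
      simp only [orient, Prod.map]
      rcases le_total (⟨j, hj⟩ : Fin n) b with h | h
      · exact Or.inl (by rw [min_eq_right h])
      · exact Or.inr (by rw [max_eq_right h])
  · rw [h₁, h₂, mul_smul, normalCls_map_val]
    rfl
  · have hdeg : w.deg d = Word.deg d (pts n ++ r) := by
      rw [Word.deg, Word.deg]
      exact (hp.map _).sum_eq
    have hrd : Word.deg d r = ((d : ℤ) - 1) * r.length := by
      rw [Word.deg, List.map_congr_left (g := fun _ => (d : ℤ) - 1)]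
      · simp [mul_comm]
      · intro l hl
        cases l with
        | pt a => exact absurd rfl ((hr _ hl).2 a)
        | chord a b => rfl
        | ast a => rfl
    have hpd : Word.deg d (pts n) = -n := by
      rw [Word.deg, pts, List.map_map]
      simp [Function.comp_def, Letter.deg]
    rw [hdeg]
    rw [Word.deg] at hrd hpd ⊢
    rw [List.map_append, List.sum_append, hrd, hpd]
    simp only [List.length_map]
    ring

theorem ofDiagram_mem {D : Diagram} {p : ℕ} (h : (2 : k) = 0 ∨ Even (D.deg d - p)) :
    TStar.ofDiagram k d D ∈ paritySpan k d 0 p := by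
  obtain ⟨s, v, hv, hc, hd⟩ := exists_normal k d D
  rw [← cls_diagram, hc, Units.smul_def]
  have key : normalCls k d D.n v ∈ paritySpan k d 0 p := by
    refine Submodule.subset_span ⟨D.n, v, hv, Nat.zero_le _, h.imp_right fun h => ?_, rfl⟩
    rw [hd] at h
    have h' : (((d : ℤ) - 1) * v.length - D.n - p : ℤ) % 2 = 0 := Int.even_iff.1 h
    have e : (((d + 1) * v.length : ℕ) : ℤ) = ((d : ℤ) - 1) * v.length + 2 * v.length := by
      push_cast
      ring
    omega
  exact zsmul_mem key _

theorem mem_sup_paritySpan (x : TStar k d) : x ∈ paritySpan k d 0 0 ⊔ paritySpan k d 0 1 := by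
  obtain ⟨y, rfl⟩ := (relations k d).mkQ_surjective x
  induction y using Finsupp.induction_linear with
  | zero => simp
  | add x y hx hy =>
    rw [map_add]
    exact add_mem hx hy
  | single D c =>
    rw [← mul_one c, ← smul_eq_mul, ← Finsupp.smul_single, map_smul]
    refine Submodule.smul_mem _ c ?_
    rcases Int.even_or_odd (D.deg d) with h | h
    · exact Submodule.mem_sup_left (ofDiagram_mem (p := 0) (Or.inr (by simpa using h)))
    · exact Submodule.mem_sup_right (ofDiagram_mem (p := 1) (Or.inr (by
        simpa using h.sub_odd odd_one)))

/-- The only normal form without points is the trivial diagram. It is split off because the formula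
for the differential of a half shuffle needs a left-most point in the first factor. -/
theorem exists_trivial_add {p : ℕ} {x : TStar k d} (hx : x ∈ paritySpan k d 0 p) :
    ∃ c : k, ∃ y ∈ paritySpan k d 1 p, x = c • TStar.trivial k d + y := by
  refine Submodule.span_induction ?_ ⟨0, 0, zero_mem _, by simp⟩ ?_ ?_ hx
  · rintro _ ⟨n, v, hv, -, hp, rfl⟩
    cases n with
    | zero => exact ⟨1, 0, zero_mem _, by simp [normalCls, TStar.trivial]⟩
    | succ n =>
      exact ⟨0, _, Submodule.subset_span ⟨n + 1, v, hv, by omega, hp, rfl⟩, by simp⟩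
  · rintro _ _ - - ⟨c, y, hy, rfl⟩ ⟨c', y', hy', rfl⟩
    exact ⟨c + c', y + y', add_mem hy hy', by module⟩
  · rintro a _ - ⟨c, y, hy, rfl⟩
    exact ⟨a * c, a • y, Submodule.smul_mem _ _ hy, by module⟩

theorem exists_boundary_eq {p : ℕ} {x : TStar k d} (hx : x ∈ paritySpan k d 0 p) :
    ∃ y ∈ paritySpan k d 2 p, TStar.boundary k d x = TStar.boundary k d y := by
  refine Submodule.span_induction ?_ ⟨0, zero_mem _, rfl⟩ ?_ ?_ hx
  · rintro _ ⟨n, v, hv, -, hp, rfl⟩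
    by_cases hn : 2 ≤ n
    · exact ⟨_, Submodule.subset_span ⟨n, v, hv, hn, hp, rfl⟩, rfl⟩
    · refine ⟨0, zero_mem _, ?_⟩
      rw [boundary_normalCls, show n - 1 = 0 by omega]
      simp
  · rintro x x' - - ⟨y, hy, h⟩ ⟨y', hy', h'⟩
    exact ⟨y + y', add_mem hy hy', by rw [map_add, map_add, h, h']⟩
  · rintro c x - ⟨y, hy, h⟩
    exact ⟨c • y, Submodule.smul_mem _ _ hy, by rw [map_smul, map_smul, h]⟩

theorem boundary_trivial : TStar.boundary k d (TStar.trivial k d) = 0 := by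
  have := boundary_normalCls k d 0 []
  rw [TStar.trivial]
  simpa only [normalCls, Nat.zero_sub, Finset.range_zero, Finset.sum_empty] using this

end KnotDiagram

end

noncomputable section

namespace KnotDiagram

open Letter TStar

/-! ### Identities between the operations -/

variable {k : Type*} [CommRing k] {d : ℕ}

theorem IsGenerator.ne_nil {t j p : ℕ} {V : List ((ℕ × ℕ) × (ℕ × ℕ))} {L : List (Set (ℕ × ℕ))}
    (h : IsGenerator k d t (j + 1) p V L) : L ≠ [] :=
  List.ne_nil_of_length_pos (by have := h.le; omega)

theorem IsGenerator.exists_cons {t j p : ℕ} {V : List ((ℕ × ℕ) × (ℕ × ℕ))}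
    {L : List (Set (ℕ × ℕ))} (h : IsGenerator k d t (j + 1) p V L) : ∃ a u, L = a :: u :=
  List.exists_cons_of_ne_nil h.ne_nil

theorem IsNormal.exists_generator {n : ℕ} {v : List (ℕ × ℕ)} (h : IsNormal n v) {j p : ℕ}
    (hj : j ≤ n) (hp : (2 : k) = 0 ∨ ((d + 1) * v.length + n) % 2 = p % 2) (t : ℕ) :
    ∃ V L, IsGenerator k d t j p V L ∧ KnotDiagram.blockCls k d V L = normalCls k d n v :=
  ⟨_, _, ⟨h.fits t, supp_tagBlocks t n, by rwa [length_tagBlocks],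
        by rwa [tagEdges, List.length_map, length_tagBlocks]⟩, h.blockCls k d t⟩

/-- A bilinear map takes values in a submodule if it does so on generators. -/
theorem bilinear_mem {S : Submodule k (TStar k d)} {j p i q : ℕ}
    (B : TStar k d →ₗ[k] TStar k d →ₗ[k] TStar k d)
    (h : ∀ V L W M, IsGenerator k d 0 j p V L → IsGenerator k d 1 i q W M →
      B (blockCls k d V L) (blockCls k d W M) ∈ S) {x y : TStar k d}
    (hx : x ∈ paritySpan k d j p) (hy : y ∈ paritySpan k d i q) : B x y ∈ S := by
  refine paritySpan_induction 0 (P := fun x => B x y ∈ S) (fun V L hL => ?_) ?_ ?_ ?_ hx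
  · refine paritySpan_induction 1 (P := fun y => B _ y ∈ S) (fun W M hM => h _ _ _ _ hL hM) ?_ ?_ ?_
      hy
    · simp
    · intro x y hx hy
      rw [map_add]
      exact add_mem hx hy
    · intro c x hx
      rw [map_smul]
      exact Submodule.smul_mem _ _ hx
  · simp
  · intro x y hx hy
    rw [map_add]
    exact add_mem hx hy
  · intro c x hx
    rw [map_smul]
    exact Submodule.smul_mem _ _ hx

/-- Bilinear maps which agree on generators are equal. -/
theorem bilinear_eq {j p i q : ℕ} (A B : TStar k d →ₗ[k] TStar k d →ₗ[k] TStar k d)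
    (h : ∀ V L W M, IsGenerator k d 0 j p V L → IsGenerator k d 1 i q W M →
      A (blockCls k d V L) (blockCls k d W M) = B (blockCls k d V L) (blockCls k d W M))
    {x y : TStar k d} (hx : x ∈ paritySpan k d j p) (hy : y ∈ paritySpan k d i q) :
    A x y = B x y := by
  have := bilinear_mem (S := ⊥) (A - B) (fun V L W M hL hM => by
    simpa [sub_eq_zero] using h V L W M hL hM) hx hy
  simpa [sub_eq_zero] using this

theorem boundary_mem {j p : ℕ} {x : TStar k d} (hx : x ∈ paritySpan k d (j + 1) p) :
    boundary k d x ∈ paritySpan k d j (p + 1) := by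
  refine paritySpan_induction 0 (P := fun x => boundary k d x ∈ paritySpan k d j (p + 1))
    (fun V L hL => ?_) (by simp) (fun x y hx hy => by rw [map_add]; exact add_mem hx hy)
    (fun c x hx => by rw [map_smul]; exact Submodule.smul_mem _ _ hx) hx
  rw [boundary_blockCls k d hL.fits]
  refine bd_mem fun i hi => ?_
  have := length_joinAt hi
  refine blockCls_mem (hL.fits.joinAt hi) (by have := hL.le; omega)
    (hL.parity.imp_right fun h => by omega)

theorem boundary_mem_zero {p : ℕ} {x : TStar k d} (hx : x ∈ paritySpan k d 0 p) :
    boundary k d x ∈ paritySpan k d 0 (p + 1) := by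
  obtain ⟨y, hy, h⟩ := exists_boundary_eq hx
  rw [h]
  exact paritySpan_mono (Nat.zero_le _) (boundary_mem hy)

/-- Unlike the full differential, this part preserves the bound of two points: a diagram with
exactly two points has no gluing besides the first one. -/
theorem rest_mem {p : ℕ} {x : TStar k d} (hx : x ∈ paritySpan k d 2 p) :
    rest k d x ∈ paritySpan k d 2 (p + 1) := by
  refine paritySpan_induction 0 (P := fun x => rest k d x ∈ paritySpan k d 2 (p + 1))
    (fun V L hL => ?_) (by simp) (fun x y hx hy => by rw [map_add]; exact add_mem hx hy)
    (fun c x hx => by rw [map_smul]; exact Submodule.smul_mem _ _ hx) hx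
  obtain ⟨a, u, rfl⟩ := hL.exists_cons
  have hle := hL.le
  have hpar := hL.parity
  rw [List.length_cons] at hle hpar
  have hu : u ≠ [] := List.ne_nil_of_length_pos (by omega)
  rw [rest_blockCls k d hL.fits hu]
  refine neg_mem (bd_mem fun i hi => ?_)
  have := length_joinAt hi
  refine blockCls_mem (hL.fits.cons_joinAt hi) (by rw [List.length_cons]; omega)
    (hpar.imp_right fun h => by rw [List.length_cons]; omega)

/-- Two points become one, which changes the parity; the second point of the first factor survives,
so at least two points remain. -/
theorem joinHalf_mem {p q : ℕ} {x y : TStar k d} (hx : x ∈ paritySpan k d 2 p)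
    (hy : y ∈ paritySpan k d 1 q) : joinHalf k d x y ∈ paritySpan k d 2 (p + q + 1) := by
  refine bilinear_mem (joinHalf k d) (fun V L W M hL hM => ?_) hx hy
  have hd := hL.disjoint hM (by norm_num)
  obtain ⟨a, u, rfl⟩ := hL.exists_cons
  obtain ⟨b, w, rfl⟩ := hM.exists_cons
  rw [joinHalf_blockCls k d hL.fits hM.fits hd]
  refine zsmul_mem (hs_mem fun X hX => ?_) _
  have hX' := mem_shuffles_of_mem_halfShuffles hX
  have hlen := length_of_mem_shuffles hX'
  have h₁ := hL.parity
  have h₂ := hM.parity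
  have h₃ := hL.le
  rw [List.length_cons] at h₁ h₂ h₃
  refine blockCls_mem (hL.fits.joinHeads hM.fits hd hX') (by rw [List.length_cons]; omega) ?_
  rcases h₁ with h | h
  · exact Or.inl h
  refine h₂.imp_right fun h' => ?_
  rw [List.length_append, mul_add, List.length_cons]
  omega

theorem boundary_boundary (x : TStar k d) : boundary k d (boundary k d x) = 0 := by
  have key : ∀ p, ∀ x ∈ paritySpan k d 0 p, boundary k d (boundary k d x) = 0 := by
    intro p x hx
    refine paritySpan_induction 0 (P := fun x => boundary k d (boundary k d x) = 0)
      (fun V L hL => boundary_boundary_blockCls k d hL.fits) (by simp)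
      (fun x y hx hy => by rw [map_add, map_add, hx, hy, add_zero])
      (fun c x hx => by rw [map_smul, map_smul, hx, smul_zero]) hx
  obtain ⟨y, hy, z, hz, rfl⟩ := Submodule.mem_sup.1 (mem_sup_paritySpan x)
  rw [map_add, map_add, key 0 y hy, key 1 z hz, add_zero]

/-- The differential of a half shuffle product. -/
theorem boundary_half {p : ℕ} {x : TStar k d} (hx : x ∈ paritySpan k d 1 p) (y : TStar k d) :
    boundary k d (half k d x y) = half k d (boundary k d x) y +
      (-1 : ℤ) ^ p • half k d x (boundary k d y) + join k d x y := by
  have key : ∀ q, ∀ y ∈ paritySpan k d 0 q, boundary k d (half k d x y) =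
      half k d (boundary k d x) y + (-1 : ℤ) ^ p • half k d x (boundary k d y) +
      join k d x y := by
    intro q y hy
    refine bilinear_eq ((half k d).compr₂ (boundary k d)) (half k d ∘ₗ boundary k d +
      (-1 : ℤ) ^ p • (half k d).compl₂ (boundary k d) + join k d) (fun V L W M hL hM => ?_) hx hy
    refine (boundary_half_blockCls k d hL.fits hM.fits (hL.disjoint hM (by norm_num))
      hL.ne_nil).trans ?_
    rw [sign_smul hL.parity]
    rfl
  obtain ⟨y, hy, z, hz, rfl⟩ := Submodule.mem_sup.1 (mem_sup_paritySpan y)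
  simp only [map_add, key 0 y hy, key 1 z hz, smul_add]
  abel

/-- Since `y` has a point, the left-most point of the half shuffle product of `y` and `z` is that of
`y`, and the join only concerns `x` and `y`. -/
theorem join_half {p q : ℕ} {x y : TStar k d} (hx : x ∈ paritySpan k d 1 p)
    (hy : y ∈ paritySpan k d 1 q) (z : TStar k d) :
    join k d x (half k d y z) = half k d (join k d x y) z := by
  have key : ∀ r, ∀ z ∈ paritySpan k d 0 r,
      join k d x (half k d y z) = half k d (join k d x y) z := by
    intro r z hz
    refine paritySpan_induction 2
      (P := fun z => join k d x (half k d y z) = half k d (join k d x y) z) (fun U N hN => ?_) (by simp)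
      (fun x y hx hy => by simp only [map_add, hx, hy])
      (fun c x hx => by simp only [map_smul, hx]) hz
    refine bilinear_eq ((join k d).compl₂ ((half k d).flip (blockCls k d U N)))
      ((join k d).compr₂ ((half k d).flip (blockCls k d U N))) (fun V L W M hL hM => ?_) hx hy
    exact join_half_blockCls k d hL.fits hM.fits hN.fits (hL.disjoint hM (by norm_num))
      (hL.disjoint hN (by norm_num)) (hM.disjoint hN (by norm_num)) hL.ne_nil hM.ne_nil
  obtain ⟨y, hy, z, hz, rfl⟩ := Submodule.mem_sup.1 (mem_sup_paritySpan z)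
  rw [map_add, map_add, map_add, key 0 y hy, key 1 z hz]

theorem parity_mul {l m p q : ℕ} (h₁ : (2 : k) = 0 ∨ l % 2 = p % 2)
    (h₂ : (2 : k) = 0 ∨ m % 2 = q % 2) : (2 : k) = 0 ∨ (l * m) % 2 = (p * q) % 2 := by
  rcases h₁ with h | h
  · exact Or.inl h
  · exact h₂.imp_right fun h' => Nat.ModEq.mul h h'

theorem join_comm {p q : ℕ} {x y : TStar k d} (hx : x ∈ paritySpan k d 1 p)
    (hy : y ∈ paritySpan k d 1 q) : join k d y x = -((-1 : ℤ) ^ (p * q) • join k d x y) := by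
  refine bilinear_eq (join k d).flip (-((-1 : ℤ) ^ (p * q) • join k d)) (fun V L W M hL hM => ?_)
    hx hy
  refine (join_comm_blockCls k d hL.fits hM.fits (hL.disjoint hM (by norm_num)) hL.ne_nil
    hM.ne_nil).trans ?_
  rw [sign_smul (parity_mul hL.parity hM.parity)]
  rfl

theorem join_trivial {p : ℕ} {x : TStar k d} (hx : x ∈ paritySpan k d 1 p) :
    join k d x (trivial k d) = 0 := by
  refine paritySpan_induction 0 (P := fun x => join k d x (trivial k d) = 0)
    (fun V L hL => ?_) (by simp)
    (fun x y hx hy => by rw [map_add, LinearMap.add_apply, hx, hy, add_zero])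
    (fun c x hx => by rw [map_smul, LinearMap.smul_apply, hx, smul_zero]) hx
  have h : Fits ([] : List ((ℕ × ℕ) × (ℕ × ℕ))) [] := ⟨by simp, by simp, by simp, by simp⟩
  exact join_nil k d hL.fits h hL.ne_nil

/-- Exchange the tags `0` and `1`. -/
def swapTags (q : ℕ × ℕ) : ℕ × ℕ := (Equiv.swap 0 1 q.1, q.2)

theorem swapTags_swapTags (q : ℕ × ℕ) : swapTags (swapTags q) = q := by
  simp [swapTags]

theorem supp_map_swapTags {L : List (Set (ℕ × ℕ))} (h : supp L ⊆ tagged 0) :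
    supp (L.map (Set.image swapTags)) ⊆ tagged 1 := by
  rintro p ⟨B, hB, hp⟩
  obtain ⟨B, hB', rfl⟩ := List.mem_map.1 hB
  obtain ⟨q, hq, rfl⟩ := hp
  have : q.1 = 0 := h ⟨B, hB', hq⟩
  simp [tagged, swapTags, this]

theorem IsGenerator.disjoint_copy {j p : ℕ} {V : List ((ℕ × ℕ) × (ℕ × ℕ))}
    {L : List (Set (ℕ × ℕ))} (h : IsGenerator k d 0 j p V L) :
    Disjoint (KnotDiagram.supp L) (KnotDiagram.supp (L.map (Set.image swapTags))) :=
  (disjoint_tagged zero_ne_one).mono h.supp (supp_map_swapTags h.supp)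

theorem swapTags_of_tagged {q : ℕ × ℕ} (h : q ∈ tagged 2) : swapTags q = q := by
  have : q.1 = 2 := h
  simp [swapTags, this, Equiv.swap_apply_of_ne_of_ne, Prod.ext_iff]

/-- The statement is quadratic in `x`, so generators alone do not suffice: squares of diagrams
vanish by the cancellation with a copy, and mixed terms cancel by `join_comm`. This avoids dividing
by 2. -/
theorem join_self {p : ℕ} (hp : (2 : k) = 0 ∨ p % 2 = 0) {x : TStar k d}
    (hx : x ∈ paritySpan k d 1 p) : join k d x x = 0 := by
  refine (Submodule.span_induction (p := fun x _ => join k d x x = 0) ?_ (by simp) ?_ ?_ hx)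
  · rintro _ ⟨n, v, h, hj, hv, rfl⟩
    obtain ⟨V, L, hL, e⟩ := h.exists_generator hj hv 0
    rw [← e]
    refine join_self_blockCls k d swapTags_swapTags hL.fits hL.ne_nil hL.disjoint_copy ?_
    rcases hp with hp | hp
    · exact Or.inl hp
    · exact hL.parity.imp_right fun h => h.trans hp
  · intro x y hx hy h₁ h₂
    rw [map_add, map_add, LinearMap.add_apply, LinearMap.add_apply, h₁, h₂, join_comm hy hx,
      sign_smul (n := 0) (hp.imp_right fun hp => by rw [Nat.mul_mod, hp])]
    simp
  · intro c x _ h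
    simp [h]

theorem glueNext_joinHalf {p q : ℕ} {x y : TStar k d} (hx : x ∈ paritySpan k d 2 p)
    (hy : y ∈ paritySpan k d 1 q) : glueNext k d 0 (joinHalf k d x y) =
      -join k d (glueNext k d 0 x) y := by
  refine bilinear_eq ((joinHalf k d).compr₂ (glueNext k d 0)) (-(join k d ∘ₗ glueNext k d 0))
    (fun V L W M hL hM => ?_) hx hy
  have hd := hL.disjoint hM (by norm_num)
  obtain ⟨a, u, rfl⟩ := hL.exists_cons
  obtain ⟨b, w, rfl⟩ := hM.exists_cons
  have hle := hL.le
  rw [List.length_cons] at hle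
  exact glueNext_joinHalf_blockCls k d hL.fits hM.fits hd (List.ne_nil_of_length_pos (by omega))

theorem join_eq_joinHalf {p q : ℕ} {x y : TStar k d} (hx : x ∈ paritySpan k d 2 p)
    (hy : y ∈ paritySpan k d 2 q) : join k d x y =
      joinHalf k d x y - (-1 : ℤ) ^ (p * q) • joinHalf k d y x := by
  refine bilinear_eq (join k d) (joinHalf k d - (-1 : ℤ) ^ (p * q) • (joinHalf k d).flip)
    (fun V L W M hL hM => ?_) hx hy
  have hd := hL.disjoint hM (by norm_num)
  have hs := parity_mul hL.parity hM.parity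
  obtain ⟨a, u, rfl⟩ := hL.exists_cons
  obtain ⟨b, w, rfl⟩ := hM.exists_cons
  have h₁ := hL.le
  have h₂ := hM.le
  rw [List.length_cons] at h₁ h₂
  rw [join_eq_joinHalf_blockCls k d hL.fits hM.fits hd (List.ne_nil_of_length_pos (by omega))
    (List.ne_nil_of_length_pos (by omega)), sign_smul hs]
  rfl

theorem joinHalf_joinHalf {p q r : ℕ} {x y z : TStar k d} (hx : x ∈ paritySpan k d 2 p)
    (hy : y ∈ paritySpan k d 1 q) (hz : z ∈ paritySpan k d 1 r) :
    joinHalf k d (joinHalf k d x y) z =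
      -((-1 : ℤ) ^ p • joinHalf k d x (join k d y z)) := by
  refine paritySpan_induction 2
      (P := fun z => joinHalf k d (joinHalf k d x y) z =
        -((-1 : ℤ) ^ p • joinHalf k d x (join k d y z))) (fun U N hN => ?_) (by simp)
      (fun x y hx hy => by simp only [map_add, hx, hy, smul_add, neg_add])
      (fun c x hx => by simp only [map_smul, hx, smul_neg, smul_comm c]) hz
  refine bilinear_eq ((joinHalf k d).compr₂ ((joinHalf k d).flip (blockCls k d U N)))
      (-((-1 : ℤ) ^ p • (joinHalf k d).compl₂ ((join k d).flip (blockCls k d U N))))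
      (fun V L W M hL hM => ?_) hx hy
  have d₁ := hL.disjoint hM (by norm_num)
  have d₂ := hL.disjoint hN (by norm_num)
  have d₃ := hM.disjoint hN (by norm_num)
  have hs := hL.parity
  obtain ⟨a, u, rfl⟩ := hL.exists_cons
  obtain ⟨b, w, rfl⟩ := hM.exists_cons
  obtain ⟨c, t, rfl⟩ := hN.exists_cons
  have h₁ := hL.le
  rw [List.length_cons] at h₁
  refine (joinHalf_joinHalf_blockCls k d hL.fits hM.fits hN.fits d₁ d₂ d₃
    (List.ne_nil_of_length_pos (by omega))).trans ?_
  rw [sign_smul hs]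
  rfl

/-- The same diagram occurs twice and the cancellation uses its copy; the identity is established
for single diagrams only, and the homotopy is arranged so that this is enough. -/
theorem rest_joinHalf_normal {n : ℕ} {v : List (ℕ × ℕ)} (hv : IsNormal n v) (hn : 2 ≤ n)
    (hp : (2 : k) = 0 ∨ ((d + 1) * v.length + n) % 2 = 1) :
    rest k d (joinHalf k d (normalCls k d n v) (normalCls k d n v)) =
      joinHalf k d (normalCls k d n v) (rest k d (normalCls k d n v)) -
        joinHalf k d (rest k d (normalCls k d n v)) (normalCls k d n v) := by
  obtain ⟨V, L, hL, e⟩ := hv.exists_generator (k := k) (d := d) (p := 1) hn hp 0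
  rw [← e]
  have hd := hL.disjoint_copy
  have hs := hL.parity
  obtain ⟨a, u, rfl⟩ := hL.exists_cons
  have h₁ := hL.le
  rw [List.length_cons] at h₁
  have := rest_joinHalf_self k d swapTags_swapTags hL.fits (List.ne_nil_of_length_pos (by omega))
    hd hs
  rwa [sub_eq_zero, ← eq_sub_iff_add_eq] at this

theorem rest_joinHalf_joinHalf_normal {n : ℕ} {v : List (ℕ × ℕ)} (hv : IsNormal n v) (hn : 2 ≤ n)
    (hp : (2 : k) = 0 ∨ ((d + 1) * v.length + n) % 2 = 1) {q : ℕ} {z : TStar k d}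
    (hz : z ∈ paritySpan k d 1 q) :
    rest k d (joinHalf k d (normalCls k d n v) (joinHalf k d (normalCls k d n v) z)) =
      joinHalf k d (normalCls k d n v) (rest k d (joinHalf k d (normalCls k d n v) z)) -
        joinHalf k d (rest k d (normalCls k d n v)) (joinHalf k d (normalCls k d n v) z) := by
  obtain ⟨V, L, hL, e⟩ := hv.exists_generator (k := k) (d := d) (p := 1) hn hp 0
  rw [← e]
  have hd := hL.disjoint_copy
  have hs := hL.parity
  have hsup := hL.supp
  obtain ⟨a, u, rfl⟩ := hL.exists_cons
  have h₁ := hL.le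
  rw [List.length_cons] at h₁
  refine paritySpan_induction 2 (P := fun z =>
    rest k d (joinHalf k d (blockCls k d V (a :: u)) (joinHalf k d (blockCls k d V (a :: u)) z)) =
      joinHalf k d (blockCls k d V (a :: u))
        (rest k d (joinHalf k d (blockCls k d V (a :: u)) z)) -
        joinHalf k d (rest k d (blockCls k d V (a :: u)))
          (joinHalf k d (blockCls k d V (a :: u)) z)) (fun W M hM => ?_) (by simp)
      (fun x y hx hy => by simp only [map_add, hx, hy]; abel)
      (fun c x hx => by simp only [map_smul, hx, smul_sub]) hz
  have d₁ := hL.disjoint hM (by norm_num)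
  have d₂ : Disjoint (supp ((a :: u).map (Set.image swapTags))) (supp M) :=
    (disjoint_tagged (by norm_num : 1 ≠ 2)).mono (supp_map_swapTags hsup) hM.supp
  -- The third factor carries the tag 2, which the exchange of the tags 0 and 1 fixes.
  have hfix : ∀ q ∈ supp M, swapTags q = q := fun q hq => swapTags_of_tagged (hM.supp hq)
  have hW : W.map (Prod.map swapTags swapTags) = W := by
    conv_rhs => rw [← List.map_id W]
    refine List.map_congr_left fun e he => ?_
    have g₂ := hM.fits.idx_lt e he
    have g₁ := (hM.fits.idx_le e he).trans_lt g₂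
    exact Prod.ext (hfix _ (idx_lt_iff.1 g₁)) (hfix _ (idx_lt_iff.1 g₂))
  have hM' : M.map (Set.image swapTags) = M := by
    conv_rhs => rw [← List.map_id M]
    refine List.map_congr_left fun B hB => ?_
    rw [Set.image_congr fun q hq => hfix q ⟨B, hB, hq⟩, Set.image_id']
    rfl
  obtain ⟨c, t, rfl⟩ := hM.exists_cons
  have := rest_joinHalf_joinHalf k d swapTags_swapTags hL.fits
    (List.ne_nil_of_length_pos (by omega)) hd hs hM.fits d₁ d₂ hW hM'
  rwa [sub_eq_zero, ← eq_sub_iff_add_eq] at this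

end KnotDiagram

end

noncomputable section

namespace KnotDiagram

open Letter TStar

/-! ### The divided powers of cycles -/

variable {k : Type*} [CommRing k] {d : ℕ}

/-- The iterated products of an odd diagram with itself. -/
def iterJoinHalf (y : TStar k d) : ℕ → TStar k d
  | 0 => y
  | m + 1 => joinHalf k d y (iterJoinHalf y m)

theorem iterJoinHalf_mem {y : TStar k d} (hy : y ∈ paritySpan k d 2 1) (m : ℕ) :
    iterJoinHalf y m ∈ paritySpan k d 2 1 := by
  induction m with
  | zero => exact hy
  | succ m ih =>
    have := joinHalf_mem hy (paritySpan_mono one_le_two ih)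
    rwa [paritySpan_congr (q := 1) (by norm_num)] at this

/-- The multiples of odd diagrams with at least two points. -/
def IsOddDiagram (y : TStar k d) : Prop :=
  ∃ (c : k) (n : ℕ) (v : List (ℕ × ℕ)), IsNormal n v ∧ 2 ≤ n ∧
    ((2 : k) = 0 ∨ ((d + 1) * v.length + n) % 2 = 1) ∧ y = c • normalCls k d n v

theorem IsOddDiagram.mem {y : TStar k d} (hy : IsOddDiagram y) : y ∈ paritySpan k d 2 1 := by
  obtain ⟨c, n, v, hv, hn, hp, rfl⟩ := hy
  exact Submodule.smul_mem _ _ (Submodule.subset_span ⟨n, v, hv, hn, hp, rfl⟩)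

theorem IsOddDiagram.rest_joinHalf {y : TStar k d} (hy : IsOddDiagram y) :
    rest k d (joinHalf k d y y) = joinHalf k d y (rest k d y) - joinHalf k d (rest k d y) y := by
  obtain ⟨c, n, v, hv, hn, hp, rfl⟩ := hy
  simp only [map_smul, LinearMap.smul_apply, rest_joinHalf_normal hv hn hp, smul_sub]

theorem IsOddDiagram.rest_joinHalf_joinHalf {y : TStar k d} (hy : IsOddDiagram y) {q : ℕ}
    {z : TStar k d} (hz : z ∈ paritySpan k d 1 q) :
    rest k d (joinHalf k d y (joinHalf k d y z)) =
      joinHalf k d y (rest k d (joinHalf k d y z)) -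
        joinHalf k d (rest k d y) (joinHalf k d y z) := by
  obtain ⟨c, n, v, hv, hn, hp, rfl⟩ := hy
  simp only [map_smul, LinearMap.smul_apply, rest_joinHalf_joinHalf_normal hv hn hp hz, smul_sub]

/-- With w_{m+1} = y ∗ w_m, the Leibniz rule and induction express the left side as −y ∗ (ry ∘ w_m)
− ry ∗ w_{m+1}, where ry denotes `rest` of y. The right side is split by `join_eq_joinHalf`, and its
second part w_{m+1} ∗ ry is brought to the same form by `joinHalf_joinHalf` and `join_comm`. -/
theorem rest_iterJoinHalf {y : TStar k d} (hy : IsOddDiagram y) (m : ℕ) :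
    rest k d (iterJoinHalf y (m + 1)) = -join k d (rest k d y) (iterJoinHalf y m) := by
  have hr : rest k d y ∈ paritySpan k d 2 2 := rest_mem hy.mem
  induction m with
  | zero =>
    change rest k d (joinHalf k d y y) = -join k d (rest k d y) y
    rw [hy.rest_joinHalf, join_eq_joinHalf hr hy.mem]
    simp
  | succ m ih =>
    have hm := iterJoinHalf_mem hy.mem m
    have hm' := iterJoinHalf_mem hy.mem (m + 1)
    have e₁ := hy.rest_joinHalf_joinHalf (paritySpan_mono one_le_two hm)
    have e₂ := join_eq_joinHalf hr hm'
    have e₃ := joinHalf_joinHalf hy.mem (paritySpan_mono one_le_two hm)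
      (paritySpan_mono one_le_two hr)
    have e₄ := join_comm (paritySpan_mono one_le_two hr) (paritySpan_mono one_le_two hm)
    rw [iterJoinHalf] at ih ⊢
    rw [iterJoinHalf] at e₂ ⊢
    rw [e₁, ih, e₂, e₃, e₄]
    simp
    abel

theorem boundary_eq (x : TStar k d) : boundary k d x = rest k d x + glueNext k d 0 x := by
  simp [rest]

/-- The gluing of the first two points contributes the analogous term for the first gluing of y.
Together they give −∂y ∘ w_m, which equals w_m ∘ ∂y because ∂y is even. -/
theorem boundary_iterJoinHalf {y : TStar k d} (hy : IsOddDiagram y) (m : ℕ) :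
    boundary k d (iterJoinHalf y (m + 1)) = join k d (iterJoinHalf y m) (boundary k d y) := by
  have hm := iterJoinHalf_mem hy.mem m
  have hb : boundary k d y ∈ paritySpan k d 1 2 := boundary_mem hy.mem
  rw [join_comm hb (paritySpan_mono one_le_two hm), boundary_eq (iterJoinHalf y (m + 1)),
    rest_iterJoinHalf hy, iterJoinHalf, glueNext_joinHalf hy.mem (paritySpan_mono one_le_two hm),
    boundary_eq y]
  simp
  abel

variable (k d) in
/-- The ideals of the half shuffle product. -/
structure IsStable (J : Submodule k (TStar k d)) : Prop where
  half_left : ∀ x ∈ J, ∀ y, half k d x y ∈ J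
  half_right : ∀ x ∈ J, ∀ y, half k d y x ∈ J

/-! ### Divided powers and the chain homotopy modulo a stable submodule -/

section Cycles

variable {J : Submodule k (TStar k d)}

/-- x ∘ (x ≺ z) = (x ∘ x) ≺ z = 0 for even x. -/
theorem join_dividedPower {x : TStar k d} (hx : x ∈ paritySpan k d 1 0) (l : ℕ) :
    join k d x (dividedPower k d l x) = 0 := by
  cases l with
  | zero => rw [dividedPower_zero, join_trivial hx]
  | succ l => rw [dividedPower_succ, join_half hx hx, join_self (Or.inr rfl) hx, map_zero,
      LinearMap.zero_apply]

/-- In the Leibniz formula for x ≺ x^⟨l⟩ the defect vanishes by `join_dividedPower`, and the other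
terms lie in the stable submodule by induction. -/
theorem boundary_dividedPower_mem_of_pos (hJ : IsStable k d J) {x : TStar k d}
    (hx : x ∈ paritySpan k d 1 0) (hb : boundary k d x ∈ J) (l : ℕ) :
    boundary k d (dividedPower k d l x) ∈ J := by
  induction l with
  | zero => rw [dividedPower_zero, boundary_trivial]; exact zero_mem _
  | succ l ih =>
    rw [dividedPower_succ, boundary_half hx, join_dividedPower hx, add_zero]
    exact add_mem (hJ.half_left _ hb _) (zsmul_mem (hJ.half_right _ ih _) _)

/-- The terms of the chain homotopy coming from the iterated products. -/
def homotopyTerm (w Γ : ℕ → TStar k d) : ℕ → ℕ → TStar k d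
  | _, 0 => 0
  | m, l + 1 => half k d (w m) (Γ l) - homotopyTerm w Γ (m + 1) l

theorem mkQ_eq_zero {x : TStar k d} (hx : x ∈ J) : J.mkQ x = 0 :=
  (Submodule.Quotient.mk_eq_zero J).2 hx

/-- A telescoping sum. The defect w_m ∘ Γ_{l+1} of the leading term splits into (w_m ∘ x) ≺ Γ_l and
(w_m ∘ ∂y) ≺ Γ_l. The latter is ∂w_{m+1} ≺ Γ_l and cancels against the next term; the former, as w_m
∘ x = −x ∘ w_m, completes the join with x. -/
theorem boundary_homotopyTerm (hJ : IsStable k d J) {x y : TStar k d}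
    (hx : x ∈ paritySpan k d 1 0) (hb : boundary k d x ∈ J) (hy : IsOddDiagram y) (m l : ℕ) :
    J.mkQ (boundary k d (homotopyTerm (iterJoinHalf y)
        (fun l => dividedPower k d l (x + boundary k d y)) m (l + 1))) =
      J.mkQ (half k d (boundary k d (iterJoinHalf y m))
        (dividedPower k d l (x + boundary k d y))) -
      J.mkQ (join k d x (homotopyTerm (iterJoinHalf y)
        (fun l => dividedPower k d l (x + boundary k d y)) m l)) := by
  have hyb : boundary k d y ∈ paritySpan k d 1 0 := by
    have := boundary_mem hy.mem
    rwa [paritySpan_congr (q := 0) (by norm_num)] at this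
  have hX : x + boundary k d y ∈ paritySpan k d 1 0 := add_mem hx hyb
  have hXb : boundary k d (x + boundary k d y) ∈ J := by
    rwa [map_add, boundary_boundary, add_zero]
  have hΓ := boundary_dividedPower_mem_of_pos hJ hX hXb
  have hw : ∀ m, iterJoinHalf y m ∈ paritySpan k d 1 1 := fun m =>
    paritySpan_mono one_le_two (iterJoinHalf_mem hy.mem m)
  induction l generalizing m with
  | zero =>
    simp only [homotopyTerm, sub_zero, map_zero, dividedPower_zero, boundary_half (hw m),
      boundary_trivial, join_trivial (hw m), smul_zero, add_zero]
  | succ l ih =>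
    have e₁ := boundary_half (hw m) (dividedPower k d (l + 1) (x + boundary k d y))
    have e₂ : join k d (iterJoinHalf y m) (dividedPower k d (l + 1) (x + boundary k d y)) =
        half k d (join k d (iterJoinHalf y m) x) (dividedPower k d l (x + boundary k d y)) +
        half k d (join k d (iterJoinHalf y m) (boundary k d y))
          (dividedPower k d l (x + boundary k d y)) := by
      rw [dividedPower_succ, join_half (hw m) hX, map_add, map_add, LinearMap.add_apply]
    have e₃ := join_comm hx (hw m)
    have e₄ := join_half hx (hw m) (dividedPower k d l (x + boundary k d y))
    have e₅ := mkQ_eq_zero (hJ.half_right _ (hΓ (l + 1)) (iterJoinHalf y m))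
    rw [homotopyTerm, map_sub, map_sub, ih, e₁, boundary_iterJoinHalf hy, e₂, e₃, homotopyTerm,
      map_sub (join k d x), e₄]
    simp only [map_add, map_sub, map_neg, map_zsmul, e₅, zero_mul, pow_zero, one_smul,
      LinearMap.neg_apply, smul_zero, add_zero]
    abel

/-- The chain homotopy between the divided powers of homologous cycles. -/
def homotopy (x : TStar k d) (w Γ : ℕ → TStar k d) : ℕ → TStar k d
  | 0 => 0
  | l + 1 => half k d x (homotopy x w Γ l) + homotopyTerm w Γ 0 (l + 1)

/-- The join of x with the previous homotopy is cancelled by the correction in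
`boundary_homotopyTerm` for m = 0. What remains is x ≺ (Γ_l − x^⟨l⟩) + ∂y ≺ Γ_l, which is the
difference for l + 1. -/
theorem boundary_homotopy (hJ : IsStable k d J) {x y : TStar k d}
    (hx : x ∈ paritySpan k d 1 0) (hb : boundary k d x ∈ J) (hy : IsOddDiagram y) (l : ℕ) :
    J.mkQ (boundary k d (homotopy x (iterJoinHalf y)
        (fun l => dividedPower k d l (x + boundary k d y)) l)) =
      J.mkQ (dividedPower k d l (x + boundary k d y)) - J.mkQ (dividedPower k d l x) := by
  induction l with
  | zero => simp [homotopy, dividedPower_zero]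
  | succ l ih =>
    have e₁ := boundary_homotopyTerm hJ hx hb hy 0 l
    -- Joining x with the part of the homotopy of the form x ≺ z gives (x ∘ x) ≺ z = 0, so only the
    -- iterated terms contribute.
    have e₂ : join k d x (homotopy x (iterJoinHalf y)
        (fun l => dividedPower k d l (x + boundary k d y)) l) =
        join k d x (homotopyTerm (iterJoinHalf y)
          (fun l => dividedPower k d l (x + boundary k d y)) 0 l) := by
      cases l with
      | zero => rfl
      | succ l =>
        rw [homotopy, map_add, join_half hx hx, join_self (Or.inr rfl) hx, map_zero,
          LinearMap.zero_apply, zero_add]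
    have e₃ : J.mkQ (half k d x (boundary k d (homotopy x (iterJoinHalf y)
        (fun l => dividedPower k d l (x + boundary k d y)) l))) =
        J.mkQ (half k d x (dividedPower k d l (x + boundary k d y))) -
          J.mkQ (half k d x (dividedPower k d l x)) := by
      rw [← sub_eq_zero, ← map_sub, ← map_sub, ← map_sub, ← map_sub]
      refine mkQ_eq_zero (hJ.half_right _ ?_ x)
      rw [← map_sub] at ih
      exact (Submodule.Quotient.eq J).1 ih
    rw [homotopy, map_add, map_add, e₁, boundary_half hx, e₂, dividedPower_succ, dividedPower_succ]
    simp only [map_add, pow_zero, one_smul, e₃, mkQ_eq_zero (hJ.half_left _ hb _), iterJoinHalf,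
      LinearMap.add_apply]
    abel

theorem dividedPower_add_oddDiagram (hJ : IsStable k d J) {x y : TStar k d}
    (hx : x ∈ paritySpan k d 1 0) (hb : boundary k d x ∈ J) (hy : IsOddDiagram y) (l : ℕ) :
    dividedPower k d l (x + boundary k d y) - dividedPower k d l x ∈
      LinearMap.range (boundary k d) ⊔ J := by
  have := boundary_homotopy hJ hx hb hy l
  rw [← map_sub] at this
  have h := (Submodule.Quotient.eq J).1 this
  rw [← neg_mem_iff, neg_sub] at h
  rw [← sub_add_cancel (dividedPower k d l (x + boundary k d y) - dividedPower k d l x)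
    (boundary k d (homotopy x (iterJoinHalf y)
        (fun l => dividedPower k d l (x + boundary k d y)) l))]
  exact add_mem (Submodule.mem_sup_right h) (Submodule.mem_sup_left ⟨_, rfl⟩)

/-- The chain is added one multiple of a diagram at a time. The induction hypothesis ranges over all
x, since the base point moves to x + ∂y after each step. -/
theorem dividedPower_add_boundary_of_pos (hJ : IsStable k d J) {x y : TStar k d}
    (hx : x ∈ paritySpan k d 1 0) (hb : boundary k d x ∈ J) (hy : y ∈ paritySpan k d 2 1) (l : ℕ) :
    dividedPower k d l (x + boundary k d y) - dividedPower k d l x ∈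
      LinearMap.range (boundary k d) ⊔ J := by
  refine Submodule.closure_induction (p := fun y _ => ∀ x ∈ paritySpan k d 1 0,
    boundary k d x ∈ J → dividedPower k d l (x + boundary k d y) - dividedPower k d l x ∈
      LinearMap.range (boundary k d) ⊔ J) ?_ ?_ ?_ hy x hx hb
  · intro x _ _
    simp
  · intro y z hy hz h₁ h₂ x hx hb
    have hyb := boundary_mem (j := 1) hy
    rw [paritySpan_congr (q := 0) (by norm_num)] at hyb
    have := h₂ (x + boundary k d y) (add_mem hx hyb) (by
      rwa [map_add, boundary_boundary, add_zero])
    rw [map_add, ← add_assoc]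
    rw [← sub_add_sub_cancel]
    exact add_mem this (h₁ x hx hb)
  · rintro c _ ⟨n, v, hv, hn, hp, rfl⟩ x hx hb
    exact dividedPower_add_oddDiagram hJ hx hb ⟨c, n, v, hv, hn, hp, rfl⟩ l

/-- As powers of one operator, divided powers are accessible to the binomial theorem: adding a
multiple of the trivial diagram to x adds a scalar to this operator. -/
theorem dividedPower_eq_pow (x : TStar k d) (l : ℕ) :
    dividedPower k d l x = ((half k d x) ^ l : Module.End k (TStar k d)) (trivial k d) := by
  induction l with
  | zero => rw [dividedPower_zero, pow_zero, Module.End.one_apply]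
  | succ l ih => rw [dividedPower_succ, pow_succ', Module.End.mul_apply, ih]

/-- The divided powers of the sum with a multiple of the trivial diagram. -/
theorem dividedPower_trivial_add (c : k) (x : TStar k d) (l : ℕ) :
    dividedPower k d l (c • trivial k d + x) = ∑ m ∈ Finset.range (l + 1),
      (c ^ m * (l.choose m : k)) • dividedPower k d (l - m) x := by
  have h : half k d (c • trivial k d + x) =
      algebraMap k (Module.End k (TStar k d)) c + half k d x := by
    refine LinearMap.ext fun z => ?_
    simp [half_trivial_left, Module.algebraMap_end_apply]
  rw [dividedPower_eq_pow, h, (Algebra.commute_algebraMap_left c _).add_pow, LinearMap.sum_apply]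
  refine Finset.sum_congr rfl fun m _ => ?_
  rw [dividedPower_eq_pow, ← map_pow, mul_assoc, Module.End.mul_apply, Module.End.mul_apply,
    Module.algebraMap_end_apply, mul_smul]
  congr 1
  rw [Nat.cast_smul_eq_nsmul, ← map_nsmul, Module.End.natCast_apply]

theorem boundary_trivial_add (c : k) (x : TStar k d) :
    boundary k d (c • trivial k d + x) = boundary k d x := by
  rw [map_add, map_smul, boundary_trivial, smul_zero, zero_add]

/-- The divided powers of even cycles are cycles. -/
theorem boundary_dividedPower_mem (hJ : IsStable k d J) {x : TStar k d}
    (hx : x ∈ paritySpan k d 0 0) (hb : boundary k d x ∈ J) (l : ℕ) :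
    boundary k d (dividedPower k d l x) ∈ J := by
  obtain ⟨c, x₀, hx₀, rfl⟩ := exists_trivial_add hx
  rw [boundary_trivial_add] at hb
  rw [dividedPower_trivial_add, map_sum]
  refine sum_mem fun m _ => ?_
  rw [map_smul]
  exact Submodule.smul_mem _ _ (boundary_dividedPower_mem_of_pos hJ hx₀ hb _)

/-- Needed for `T`, where an equation between chains lifts to `T_*` only up to diagrams with
asterisks. -/
theorem dividedPower_add_mem (hJ : IsStable k d J) {j : TStar k d} (x : TStar k d)
    (hj : j ∈ J) (l : ℕ) : dividedPower k d l (x + j) - dividedPower k d l x ∈ J := by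
  induction l with
  | zero => simp [dividedPower_zero]
  | succ l ih =>
    have : dividedPower k d (l + 1) (x + j) - dividedPower k d (l + 1) x =
        half k d j (dividedPower k d l (x + j)) +
          half k d x (dividedPower k d l (x + j) - dividedPower k d l x) := by
      rw [dividedPower_succ, dividedPower_succ, map_add, map_sub, LinearMap.add_apply]
      abel
    rw [this]
    exact add_mem (hJ.half_left _ hj _) (hJ.half_right _ ih _)

/-- The divided powers of homologous even cycles are homologous. -/
theorem dividedPower_add_boundary (hJ : IsStable k d J) {x y j : TStar k d}
    (hx : x ∈ paritySpan k d 0 0) (hb : boundary k d x ∈ J) (hy : y ∈ paritySpan k d 0 1)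
    (hj : j ∈ J) (l : ℕ) :
    dividedPower k d l (x + boundary k d y + j) - dividedPower k d l x ∈
      LinearMap.range (boundary k d) ⊔ J := by
  rw [← sub_add_sub_cancel _ (dividedPower k d l (x + boundary k d y))]
  refine add_mem (Submodule.mem_sup_right (dividedPower_add_mem hJ _ hj l)) ?_
  -- The chain is replaced by one with at least two points in each diagram, and the trivial part of
  -- x is split off; the binomial formula then compares the two sides term by term.
  obtain ⟨z, hz, h⟩ := exists_boundary_eq hy
  obtain ⟨c, x₀, hx₀, rfl⟩ := exists_trivial_add hx
  rw [boundary_trivial_add] at hb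
  rw [h, add_assoc, dividedPower_trivial_add, dividedPower_trivial_add, ← Finset.sum_sub_distrib]
  refine sum_mem fun m _ => ?_
  rw [← smul_sub]
  exact Submodule.smul_mem _ _ (dividedPower_add_boundary_of_pos hJ hx₀ hb hz _)

end Cycles

end KnotDiagram

end

noncomputable section

namespace KnotDiagram

open Letter TStar

/-! ### Degrees -/

variable {k : Type*} [CommRing k] {d : ℕ}

theorem Word.deg_map {n N : ℕ} (f : Fin n → Fin N) (w : Word n) :
    Word.deg d (w.map (Letter.map f)) = Word.deg d w := by
  rw [Word.deg, Word.deg, List.map_map]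
  congr 1
  refine List.map_congr_left fun l _ => ?_
  cases l <;> rfl

theorem cls_mem_degreePart {n : ℕ} (w : Word n) : cls k d w ∈ degreePart k d (Word.deg d w) := by
  by_cases h : IsDiagram w
  · have : cls k d w = ofDiagram k d ⟨n, w, h⟩ := cls_diagram k d ⟨n, w, h⟩
    rw [this]
    exact Submodule.subset_span ⟨_, rfl, rfl⟩
  · rw [cls_of_not k d h]
    exact zero_mem _

theorem exists_natCls_eq {n m : ℕ} {w₁ : Word n} {w₂ : Word m} {L : List (ℕ ⊕ ℕ)}
    (hL : L.length = n + m) : ∃ (N : ℕ) (f : Fin n → Fin N) (g : Fin m → Fin N),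
      natCls k d L.length (w₁.map (Letter.map fun a : Fin n => L.idxOf (Sum.inl (a : ℕ))) ++
        w₂.map (Letter.map fun a : Fin m => L.idxOf (Sum.inr (a : ℕ)))) =
      cls k d (w₁.map (Letter.map f) ++ w₂.map (Letter.map g)) := by
  rcases Nat.eq_zero_or_pos L.length with h | h
  · obtain rfl : n = 0 := by omega
    obtain rfl : m = 0 := by omega
    refine ⟨0, fun a => a, fun a => a, ?_⟩
    rw [eq_nil_of_zero w₁, eq_nil_of_zero w₂, h]
    rfl
  · obtain ⟨N, hN⟩ := Nat.exists_eq_succ_of_ne_zero h.ne'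
    exact ⟨N + 1, _, _, by rw [hN, natCls_append_map]⟩

/-- Each term is the concatenation of the two monomials with renamed points. For degrees and
asterisks the nature of the renaming is irrelevant, so `f` and `g` are arbitrary. -/
theorem half_ofDiagram_mem {S : Submodule k (TStar k d)} (D E : Diagram)
    (h : ∀ (N : ℕ) (f : Fin D.n → Fin N) (g : Fin E.n → Fin N),
      cls k d (D.word.map (Letter.map f) ++ E.word.map (Letter.map g)) ∈ S) :
    half k d (ofDiagram k d D) (ofDiagram k d E) ∈ S := by
  rw [← cls_diagram, ← cls_diagram, half, op_cls_of_isDiagram k d _ D.isDiagram E.isDiagram, opWord]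
  refine list_sum_mem fun x hx => ?_
  obtain ⟨L, hL, rfl⟩ := List.mem_map.1 hx
  obtain ⟨N, f, g, e⟩ := exists_natCls_eq (k := k) (d := d) (w₁ := D.word) (w₂ := E.word)
    (length_of_perm_labels (halfFamily.perm _ _ L hL))
  rw [e]
  exact h N f g

theorem half_mem_degreePart {p q : ℤ} {x y : TStar k d} (hx : x ∈ degreePart k d p)
    (hy : y ∈ degreePart k d q) : half k d x y ∈ degreePart k d (p + q) := by
  refine Submodule.span_induction₂ (p := fun x y _ _ => half k d x y ∈ degreePart k d (p + q))
    ?_ (by simp) (by simp) ?_ ?_ ?_ ?_ hx hy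
  · rintro _ _ ⟨D, rfl, rfl⟩ ⟨E, rfl, rfl⟩
    refine half_ofDiagram_mem D E fun N f g => ?_
    have := cls_mem_degreePart (k := k) (d := d)
      (D.word.map (Letter.map f) ++ E.word.map (Letter.map g))
    rwa [Word.deg_append, Word.deg_map, Word.deg_map] at this
  · intro x y z _ _ _ h₁ h₂
    rw [map_add, LinearMap.add_apply]
    exact add_mem h₁ h₂
  · intro x y z _ _ _ h₁ h₂
    rw [map_add]
    exact add_mem h₁ h₂
  · intro c x y _ _ h
    rw [map_smul, LinearMap.smul_apply]
    exact Submodule.smul_mem _ _ h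
  · intro c x y _ _ h
    rw [map_smul]
    exact Submodule.smul_mem _ _ h

theorem trivial_mem_degreePart : trivial k d ∈ degreePart k d 0 :=
  cls_mem_degreePart ([] : Word 0)

theorem dividedPower_mem_degreePart {q : ℤ} {x : TStar k d} (hx : x ∈ degreePart k d q) (l : ℕ) :
    dividedPower k d l x ∈ degreePart k d (l * q) := by
  induction l with
  | zero =>
    rw [dividedPower_zero, Nat.cast_zero, zero_mul]
    exact trivial_mem_degreePart
  | succ l ih =>
    rw [dividedPower_succ, Nat.cast_succ, add_mul, one_mul, add_comm]
    exact half_mem_degreePart hx ih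

theorem degreePart_le_evenPart {q : ℤ} (hq : Even q) : degreePart k d q ≤ evenPart k d :=
  le_iSup (fun q : {q : ℤ // Even q} => degreePart k d q) ⟨q, hq⟩

theorem evenPart_eq_span : evenPart k d =
    Submodule.span k {x | ∃ D : Diagram, Even (D.deg d) ∧ x = ofDiagram k d D} := by
  refine le_antisymm (iSup_le fun q => Submodule.span_mono ?_) (Submodule.span_le.2 ?_)
  · rintro _ ⟨D, h, rfl⟩
    exact ⟨D, h ▸ q.2, rfl⟩
  · rintro _ ⟨D, h, rfl⟩
    exact degreePart_le_evenPart h (Submodule.subset_span ⟨D, rfl, rfl⟩)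

theorem half_mem_evenPart {x y : TStar k d} (hx : x ∈ evenPart k d) (hy : y ∈ evenPart k d) :
    half k d x y ∈ evenPart k d := by
  rw [evenPart_eq_span] at hx hy
  refine Submodule.span_induction₂ (p := fun x y _ _ => half k d x y ∈ evenPart k d)
    ?_ (by simp) (by simp) ?_ ?_ ?_ ?_ hx hy
  · rintro _ _ ⟨D, hD, rfl⟩ ⟨E, hE, rfl⟩
    exact degreePart_le_evenPart (hD.add hE) (half_mem_degreePart
      (Submodule.subset_span ⟨D, rfl, rfl⟩) (Submodule.subset_span ⟨E, rfl, rfl⟩))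
  · intro x y z _ _ _ h₁ h₂
    rw [map_add, LinearMap.add_apply]
    exact add_mem h₁ h₂
  · intro x y z _ _ _ h₁ h₂
    rw [map_add]
    exact add_mem h₁ h₂
  · intro c x y _ _ h
    rw [map_smul, LinearMap.smul_apply]
    exact Submodule.smul_mem _ _ h
  · intro c x y _ _ h
    rw [map_smul]
    exact Submodule.smul_mem _ _ h

theorem dividedPower_mem_evenPart {x : TStar k d} (hx : x ∈ evenPart k d) (l : ℕ) :
    dividedPower k d l x ∈ evenPart k d := by
  induction l with
  | zero =>
    rw [dividedPower_zero]
    exact degreePart_le_evenPart Even.zero trivial_mem_degreePart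
  | succ l ih =>
    rw [dividedPower_succ]
    exact half_mem_evenPart hx ih

theorem evenPart_le_paritySpan : evenPart k d ≤ paritySpan k d 0 0 := by
  rw [evenPart_eq_span]
  refine Submodule.span_le.2 ?_
  rintro _ ⟨D, h, rfl⟩
  exact ofDiagram_mem (Or.inr (by simpa using h))

/-- If 2 = 0, the parity condition is void, so the even and the odd span coincide. -/
theorem paritySpan_eq_top (h2 : (2 : k) = 0) (p : ℕ) : paritySpan k d 0 p = ⊤ := by
  have h : ∀ p, paritySpan k d 0 p ≤ paritySpan k d 0 0 ∧
      paritySpan k d 0 0 ≤ paritySpan k d 0 p := fun p => by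
    constructor <;>
    · refine Submodule.span_mono ?_
      rintro _ ⟨n, v, hv, hj, -, rfl⟩
      exact ⟨n, v, hv, hj, Or.inl h2, rfl⟩
  refine eq_top_iff.2 fun x _ => (h p).2 ?_
  exact sup_le le_rfl (h 1).1 (mem_sup_paritySpan x)

/-! ### Even components -/

variable (k d) in
open Classical in
/-- The projection of the free module onto the span of the diagrams of even degrees. -/
def evenFree : Free k →ₗ[k] Free k :=
  Finsupp.linearCombination k fun D : Diagram => if Even (D.deg d) then Finsupp.single D 1 else 0

open Classical in
theorem evenFree_ofWord {n : ℕ} (w : Word n) :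
    evenFree k d (ofWord k w) = if Even (Word.deg d w) then ofWord k w else 0 := by
  by_cases h : IsDiagram w
  · have : ofWord k w = Finsupp.single ⟨n, w, h⟩ 1 := by simp [ofWord, h]
    rw [this, evenFree, Finsupp.linearCombination_single, one_smul]
    rfl
  · simp [ofWord_of_not k h]

/-- The relations are homogeneous, so the projection keeps or kills each of them as a whole. -/
theorem evenFree_relation {n : ℕ} {x : Free k} (hx : Relation k d n x) :
    evenFree k d x = x ∨ evenFree k d x = 0 := by
  cases hx with
  | swap u v a b =>
    have h : Word.deg d (u ++ [a, b] ++ v) = Word.deg d (u ++ [b, a] ++ v) := by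
      simp only [Word.deg, List.map_append, List.map_cons, List.map_nil, List.sum_append,
        List.sum_cons, List.sum_nil]
      ring
    rw [map_sub, map_sign_smul, evenFree_ofWord, evenFree_ofWord, h]
    split_ifs
    · exact Or.inl rfl
    · exact Or.inr (by simp)
  | reverse u v a b =>
    have h : Word.deg d (u ++ [chord a b] ++ v) = Word.deg d (u ++ [chord b a] ++ v) := by
      simp [Word.deg, Letter.deg]
    rw [map_sub, map_sign_smul, evenFree_ofWord, evenFree_ofWord, h]
    split_ifs
    · exact Or.inl rfl
    · exact Or.inr (by simp)
  | arnold u v a b c =>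
    have h : Word.deg d (u ++ [chord a b, chord b c] ++ v) =
        Word.deg d (u ++ [chord c a, chord a b] ++ v) := by
      simp [Word.deg, Letter.deg]
    have h' : Word.deg d (u ++ [chord b c, chord c a] ++ v) =
        Word.deg d (u ++ [chord c a, chord a b] ++ v) := by
      simp [Word.deg, Letter.deg]
    rw [map_add, map_add, evenFree_ofWord, evenFree_ofWord, evenFree_ofWord, h, h']
    split_ifs
    · exact Or.inl rfl
    · exact Or.inr (by simp)

theorem evenFree_relations : relations k d ≤ (relations k d).comap (evenFree k d) := by
  refine Submodule.span_le.2 ?_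
  rintro x ⟨n, hx⟩
  rw [SetLike.mem_coe, Submodule.mem_comap]
  rcases evenFree_relation hx with h | h
  · rw [h]
    exact Submodule.subset_span ⟨n, hx⟩
  · rw [h]
    exact zero_mem _

variable (k d) in
/-- The projection onto the span of the diagrams of even degrees. -/
def evenProjection : TStar k d →ₗ[k] TStar k d :=
  (relations k d).mapQ (relations k d) (evenFree k d) evenFree_relations

open Classical in
theorem evenProjection_cls {n : ℕ} (w : Word n) :
    evenProjection k d (cls k d w) = if Even (Word.deg d w) then cls k d w else 0 := by
  rw [evenProjection, cls, Submodule.mkQ_apply, Submodule.mapQ_apply, evenFree_ofWord]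
  split_ifs <;> rfl


theorem exists_normalCls_eq_cls {n : ℕ} {v : List (ℕ × ℕ)} (hv : IsNormal n v) :
    ∃ w : Word n, normalCls k d n v = cls k d w ∧
      Word.deg d w = ((d : ℤ) - 1) * v.length - n := by
  cases n with
  | zero =>
    have : v = [] := List.eq_nil_iff_forall_not_mem.2 fun e he => by simpa using hv.lt e he
    subst this
    exact ⟨[], rfl, by simp [Word.deg]⟩
  | succ n =>
    refine ⟨_, rfl, ?_⟩
    rw [nf, Word.deg_append, deg_map_edge]
    have := deg_map_pt d (fun a : Fin (n + 1) => a) (List.finRange (n + 1))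
    rw [List.length_finRange] at this
    rw [pts, this, List.length_map]
    ring

theorem even_deg_iff (m n : ℕ) :
    Even (((d : ℤ) - 1) * m - n) ↔ ((d + 1) * m + n) % 2 = 0 := by
  have e : (((d + 1) * m : ℕ) : ℤ) = ((d : ℤ) - 1) * m + 2 * m := by
    push_cast
    ring
  rw [Int.even_iff]
  omega

/-- The hypothesis 2 ≠ 0 makes the parity condition in `paritySpan` effective. -/
theorem evenProjection_of_even (h2 : (2 : k) ≠ 0) {x : TStar k d}
    (hx : x ∈ paritySpan k d 0 0) : evenProjection k d x = x := by
  refine Submodule.span_induction (p := fun x _ => evenProjection k d x = x) ?_ (by simp) ?_ ?_ hx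
  · rintro _ ⟨n, v, hv, -, hp, rfl⟩
    obtain ⟨w, e, hw⟩ := exists_normalCls_eq_cls (k := k) (d := d) hv
    rw [e, evenProjection_cls, if_pos]
    rw [hw, even_deg_iff]
    exact hp.resolve_left h2
  · intro x y _ _ hx hy
    rw [map_add, hx, hy]
  · intro c x _ hx
    rw [map_smul, hx]

theorem evenProjection_of_odd (h2 : (2 : k) ≠ 0) {x : TStar k d}
    (hx : x ∈ paritySpan k d 0 1) : evenProjection k d x = 0 := by
  refine Submodule.span_induction (p := fun x _ => evenProjection k d x = 0) ?_ (by simp) ?_ ?_ hx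
  · rintro _ ⟨n, v, hv, -, hp, rfl⟩
    obtain ⟨w, e, hw⟩ := exists_normalCls_eq_cls (k := k) (d := d) hv
    rw [e, evenProjection_cls, if_neg]
    rw [hw, even_deg_iff]
    have := hp.resolve_left h2
    omega
  · intro x y _ _ hx hy
    rw [map_add, hx, hy, add_zero]
  · intro c x _ hx
    rw [map_smul, hx, smul_zero]

/-- Even homologous cycles differ by the boundary of an odd chain. -/
theorem exists_odd_boundary {J : Submodule k (TStar k d)}
    (hJ : ∀ j ∈ J, evenProjection k d j ∈ J) {x y j : TStar k d} (hx : x ∈ paritySpan k d 0 0)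
    (hj : j ∈ J) (h : x = boundary k d y + j) :
    ∃ z ∈ paritySpan k d 0 1, ∃ i ∈ J, x = boundary k d z + i := by
  by_cases h2 : (2 : k) = 0
  · exact ⟨y, by rw [paritySpan_eq_top h2]; trivial, j, hj, h⟩
  · obtain ⟨y₀, hy₀, y₁, hy₁, rfl⟩ := Submodule.mem_sup.1 (mem_sup_paritySpan y)
    refine ⟨y₁, hy₁, _, hJ j hj, ?_⟩
    have b₁ := boundary_mem_zero hy₁
    rw [paritySpan_congr (q := 0) (by norm_num)] at b₁
    -- Applying the projection to the equation removes the boundary of the even part of the chain,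
    -- which is odd, and fixes the rest up to the stable submodule.
    rw [← evenProjection_of_even h2 hx, h, map_add, map_add, map_add,
      evenProjection_of_odd h2 (boundary_mem_zero hy₀), evenProjection_of_even h2 b₁, zero_add]

theorem evenProjection_asteriskPart : ∀ j ∈ asteriskPart k d,
    evenProjection k d j ∈ asteriskPart k d := by
  classical
  intro j hj
  refine Submodule.span_induction (p := fun x _ => evenProjection k d x ∈ asteriskPart k d) ?_
    (by simp) ?_ ?_ hj
  · rintro _ ⟨D, ⟨a, ha⟩, rfl⟩
    rw [← cls_diagram, evenProjection_cls]
    split_ifs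
    · exact cls_mem_asteriskPart k d _ a ha
    · exact zero_mem _
  · intro x y _ _ hx hy
    rw [map_add]
    exact add_mem hx hy
  · intro c x _ hx
    rw [map_smul]
    exact Submodule.smul_mem _ _ hx

theorem ofDiagram_induction {P : TStar k d → Prop} (gen : ∀ D, P (ofDiagram k d D)) (zero : P 0)
    (add : ∀ x y, P x → P y → P (x + y)) (smul : ∀ (c : k) x, P x → P (c • x)) (x : TStar k d) :
    P x := by
  obtain ⟨y, rfl⟩ := (relations k d).mkQ_surjective x
  induction y using Finsupp.induction_linear with
  | zero => simpa using zero
  | add x y hx hy =>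
    rw [map_add]
    exact add _ _ hx hy
  | single D c =>
    rw [← mul_one c, ← smul_eq_mul, ← Finsupp.smul_single, map_smul]
    exact smul c _ (gen D)

/-- No letter is lost in a half shuffle, so an asterisk of either factor appears in every term. -/
theorem isStable_asteriskPart : IsStable k d (asteriskPart k d) where
  half_left := fun x hx y => by
    refine ofDiagram_induction (P := fun y => half k d x y ∈ asteriskPart k d) (fun E => ?_)
      (by simp) (fun x y hx hy => by rw [map_add]; exact add_mem hx hy)
      (fun c x hx => by rw [map_smul]; exact Submodule.smul_mem _ _ hx) y
    refine Submodule.span_induction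
      (p := fun x _ => half k d x (ofDiagram k d E) ∈ asteriskPart k d) ?_ (by simp)
      (fun x y _ _ hx hy => by rw [map_add]; exact add_mem hx hy)
      (fun c x _ hx => by rw [map_smul]; exact Submodule.smul_mem _ _ hx) hx
    rintro _ ⟨D, ⟨a, ha⟩, rfl⟩
    refine half_ofDiagram_mem D E fun N f g => cls_mem_asteriskPart k d _ (f a) ?_
    exact List.mem_append_left _ (List.mem_map.2 ⟨_, ha, rfl⟩)
  half_right := fun x hx y => by
    refine ofDiagram_induction (P := fun y => half k d y x ∈ asteriskPart k d) (fun E => ?_)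
      (by simp) (fun x y hx hy => by rw [map_add]; exact add_mem hx hy)
      (fun c x hx => by rw [map_smul]; exact Submodule.smul_mem _ _ hx) y
    refine Submodule.span_induction
      (p := fun x _ => half k d (ofDiagram k d E) x ∈ asteriskPart k d) ?_ (by simp)
      (fun x y _ _ hx hy => by rw [map_add]; exact add_mem hx hy)
      (fun c x _ hx => by rw [map_smul]; exact Submodule.smul_mem _ _ hx) hx
    rintro _ ⟨D, ⟨a, ha⟩, rfl⟩
    refine half_ofDiagram_mem E D fun N f g => cls_mem_asteriskPart k d _ (g a) ?_
    exact List.mem_append_right _ (List.mem_map.2 ⟨_, ha, rfl⟩)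

theorem isStable_bot : IsStable k d ⊥ where
  half_left := by simp
  half_right := by simp

/-! ### Operations on homology -/

/-- The divided powers of homologous cycles, when a stable submodule is divided out. -/
theorem dividedPower_sub_mem {J : Submodule k (TStar k d)} (hJ : IsStable k d J)
    (hP : ∀ j ∈ J, evenProjection k d j ∈ J) {x X y : TStar k d} (hx : x ∈ paritySpan k d 0 0)
    (hX : X ∈ paritySpan k d 0 0) (hb : boundary k d x ∈ J) (h : X - x - boundary k d y ∈ J)
    (l : ℕ) : dividedPower k d l X - dividedPower k d l x ∈
      LinearMap.range (boundary k d) ⊔ J := by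
  obtain ⟨z, hz, i, hi, e⟩ := exists_odd_boundary hP (sub_mem hX hx) h
    (add_sub_cancel (boundary k d y) (X - x)).symm
  have : X = x + boundary k d z + i := by
    rw [add_assoc, ← e, add_sub_cancel]
  rw [this]
  exact dividedPower_add_boundary hJ hx hb hz hi l

/-- The map on homology is defined through a chosen representative in `S`; the second hypothesis
makes the result independent of the choice. -/
theorem descendsToHomology_of {M : Type*} [AddCommGroup M] [Module k M] {δ : M →ₗ[k] M}
    {φ : M → M} {S S' : Submodule k M} (h₁ : ∀ x ∈ S, δ x = 0 → φ x ∈ S' ∧ δ (φ x) = 0)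
    (h₂ : ∀ x ∈ S, ∀ y ∈ S, δ x = 0 → y - x ∈ LinearMap.range δ →
      φ y - φ x ∈ LinearMap.range δ) : DescendsToHomology δ φ S S' := by
  classical
  have heq : ∀ x y (hx : δ x = 0) (hy : δ y = 0), homologyClass δ y hy = homologyClass δ x hx ↔
      y - x ∈ LinearMap.range δ := fun x y hx hy => by
    rw [homologyClass, homologyClass, Submodule.Quotient.eq]
    rfl
  refine ⟨fun c => ⟨homologyClass δ (φ c.2.choose)
    (h₁ _ c.2.choose_spec.choose_spec.1 c.2.choose_spec.choose).2, _, _,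
    (h₁ _ c.2.choose_spec.choose_spec.1 c.2.choose_spec.choose).1, rfl⟩, fun x hS hx =>
      ⟨(h₁ x hS hx).1, (h₁ x hS hx).2, ?_⟩⟩
  have hc : homologyClass δ x hx ∈ homologyPart δ S := ⟨x, hx, hS, rfl⟩
  refine (heq _ _ _ _).2 (h₂ x hS _ hc.choose_spec.choose_spec.1 hx ?_)
  exact (heq _ _ _ _).1 hc.choose_spec.choose_spec.2.symm

theorem TStar.descendsToHomology_dividedPower {S S' : Submodule k (TStar k d)}
    (hS : S ≤ paritySpan k d 0 0) (l : ℕ) (h : ∀ x ∈ S, dividedPower k d l x ∈ S') :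
    DescendsToHomology (boundary k d) (dividedPower k d l) S S' := by
  refine descendsToHomology_of (fun x hx hb => ⟨h x hx, ?_⟩) fun x hx y hy hb hxy => ?_
  · exact (Submodule.mem_bot k).1
      (boundary_dividedPower_mem isStable_bot (hS hx) ((Submodule.mem_bot k).2 hb) l)
  · obtain ⟨z, hz⟩ := hxy
    have := dividedPower_sub_mem isStable_bot (by simp) (hS hx) (hS hy)
      ((Submodule.mem_bot k).2 hb) (y := z) (by simp [hz]) l
    rwa [sup_bot_eq] at this

theorem T.boundary_mkQ (x : TStar k d) : T.boundary k d ((asteriskPart k d).mkQ x) =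
    (asteriskPart k d).mkQ (TStar.boundary k d x) := rfl

theorem T.dividedPower_mkQ (l : ℕ) (x : TStar k d) :
    T.dividedPower k d l ((asteriskPart k d).mkQ x) =
      (asteriskPart k d).mkQ (TStar.dividedPower k d l x) :=
  multilinearMapQ_mkQ _ _ _ _ fun _ => x

theorem mkQ_eq_zero_iff {J : Submodule k (TStar k d)} {x : TStar k d} : J.mkQ x = 0 ↔ x ∈ J :=
  Submodule.Quotient.mk_eq_zero J

theorem T.sub_mem_range {x X : TStar k d}
    (h : X - x ∈ LinearMap.range (TStar.boundary k d) ⊔ asteriskPart k d) :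
    (asteriskPart k d).mkQ X - (asteriskPart k d).mkQ x ∈ LinearMap.range (T.boundary k d) := by
  obtain ⟨_, ⟨y, rfl⟩, j, hj, h⟩ := Submodule.mem_sup.1 h
  refine ⟨(asteriskPart k d).mkQ y, ?_⟩
  rw [T.boundary_mkQ, ← map_sub, ← h, map_add, mkQ_eq_zero hj, add_zero]

/-- A cycle of `T` is represented by a chain of `T_*` whose boundary lies in the span of the
diagrams with asterisks, so the statement modulo a stable submodule applies. -/
theorem T.dividedPower_sub_mem_range {x X : TStar k d} (hx : x ∈ paritySpan k d 0 0)
    (hX : X ∈ paritySpan k d 0 0) (hb : T.boundary k d ((asteriskPart k d).mkQ x) = 0)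
    (h : (asteriskPart k d).mkQ X - (asteriskPart k d).mkQ x ∈ LinearMap.range (T.boundary k d))
    (l : ℕ) : T.dividedPower k d l ((asteriskPart k d).mkQ X) -
      T.dividedPower k d l ((asteriskPart k d).mkQ x) ∈ LinearMap.range (T.boundary k d) := by
  obtain ⟨z, hz⟩ := h
  obtain ⟨z, rfl⟩ := (asteriskPart k d).mkQ_surjective z
  rw [T.boundary_mkQ, mkQ_eq_zero_iff] at hb
  rw [T.dividedPower_mkQ, T.dividedPower_mkQ]
  refine T.sub_mem_range (dividedPower_sub_mem isStable_asteriskPart evenProjection_asteriskPart hx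
    hX hb (y := z) ?_ l)
  rw [← mkQ_eq_zero_iff, map_sub, map_sub, ← hz, T.boundary_mkQ, sub_self]

theorem T.descendsToHomology_dividedPower {S S' : Submodule k (TStar k d)}
    (hS : S ≤ paritySpan k d 0 0) (l : ℕ) (h : ∀ x ∈ S, TStar.dividedPower k d l x ∈ S') :
    DescendsToHomology (T.boundary k d) (T.dividedPower k d l) (S.map (asteriskPart k d).mkQ)
      (S'.map (asteriskPart k d).mkQ) := by
  refine descendsToHomology_of ?_ ?_
  · rintro _ ⟨x, hx, rfl⟩ hb
    rw [T.boundary_mkQ, mkQ_eq_zero_iff] at hb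
    rw [T.dividedPower_mkQ, T.boundary_mkQ, mkQ_eq_zero_iff]
    exact ⟨⟨_, h x hx, rfl⟩, boundary_dividedPower_mem isStable_asteriskPart (hS hx) hb l⟩
  · rintro _ ⟨x, hx, rfl⟩ _ ⟨y, hy, rfl⟩ hb hxy
    exact T.dividedPower_sub_mem_range (hS hx) (hS hy) hb hxy l

theorem T.evenPart_eq_map : T.evenPart k d = (TStar.evenPart k d).map (asteriskPart k d).mkQ := by
  rw [T.evenPart, TStar.evenPart, Submodule.map_iSup]
  rfl

theorem two_eq_zero_of_charP (h : CharP k 2) : (2 : k) = 0 := by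
  exact_mod_cast CharP.cast_eq_zero k 2

theorem dividedPower_zero_right {l : ℕ} (hl : 1 ≤ l) : TStar.dividedPower k d l 0 = 0 := by
  obtain ⟨l, rfl⟩ := Nat.exists_eq_succ_of_ne_zero (by omega : l ≠ 0)
  rw [Nat.succ_eq_add_one, dividedPower_succ, map_zero, LinearMap.zero_apply]

theorem TStar.dividedPower_mem_range {l : ℕ} (hl : 1 ≤ l) {x : TStar k d}
    (hx : x ∈ paritySpan k d 0 0) (hr : x ∈ LinearMap.range (boundary k d)) :
    dividedPower k d l x ∈ LinearMap.range (boundary k d) := by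
  obtain ⟨z, hz⟩ := hr
  have := dividedPower_sub_mem isStable_bot (by simp) (zero_mem _) hx (by simp) (y := z)
    (by simp [hz]) l
  rwa [sup_bot_eq, dividedPower_zero_right hl, sub_zero] at this

theorem T.dividedPower_mem_range {l : ℕ} (hl : 1 ≤ l) {x : TStar k d}
    (hx : x ∈ paritySpan k d 0 0)
    (hr : (asteriskPart k d).mkQ x ∈ LinearMap.range (T.boundary k d)) :
    T.dividedPower k d l ((asteriskPart k d).mkQ x) ∈ LinearMap.range (T.boundary k d) := by
  have := T.dividedPower_sub_mem_range (zero_mem _) hx (by simp) (by simpa using hr) l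
  rwa [T.dividedPower_mkQ l 0, dividedPower_zero_right hl, map_zero, sub_zero] at this

end KnotDiagram

end

/-! ### The theorem for both complexes -/

open KnotDiagram KnotDiagram.TStar

theorem theorem11p1 (k : Type*) [CommRing k] (d : ℕ) (hd : 3 ≤ d) (ℓ : ℕ) :
    -- on homogeneous elements of degree `q`
    (∀ q : ℤ, Even q ∨ CharP k 2 →
      KnotDiagram.DescendsToHomology (KnotDiagram.TStar.boundary k d)
        (KnotDiagram.TStar.dividedPower k d ℓ)
        (KnotDiagram.TStar.degreePart k d q) (KnotDiagram.TStar.degreePart k d (ℓ * q)) ∧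
      KnotDiagram.DescendsToHomology (KnotDiagram.T.boundary k d)
        (KnotDiagram.T.dividedPower k d ℓ)
        (KnotDiagram.T.degreePart k d q) (KnotDiagram.T.degreePart k d (ℓ * q))) ∧
    -- on sums of homogeneous elements of even degrees
    (KnotDiagram.DescendsToHomology (KnotDiagram.TStar.boundary k d)
        (KnotDiagram.TStar.dividedPower k d ℓ)
        (KnotDiagram.TStar.evenPart k d) (KnotDiagram.TStar.evenPart k d) ∧
      KnotDiagram.DescendsToHomology (KnotDiagram.T.boundary k d)
        (KnotDiagram.T.dividedPower k d ℓ)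
        (KnotDiagram.T.evenPart k d) (KnotDiagram.T.evenPart k d)) ∧
    -- on all elements in characteristic 2
    (CharP k 2 →
      KnotDiagram.DescendsToHomology (KnotDiagram.TStar.boundary k d)
        (KnotDiagram.TStar.dividedPower k d ℓ) ⊤ ⊤ ∧
      KnotDiagram.DescendsToHomology (KnotDiagram.T.boundary k d)
        (KnotDiagram.T.dividedPower k d ℓ) ⊤ ⊤) ∧
    -- divided powers of boundaries are boundaries
    (1 ≤ ℓ →
      (∀ x : KnotDiagram.TStar k d,
        x ∈ KnotDiagram.TStar.evenPart k d ∨ CharP k 2 →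
        x ∈ LinearMap.range (KnotDiagram.TStar.boundary k d) →
        KnotDiagram.TStar.dividedPower k d ℓ x ∈
          LinearMap.range (KnotDiagram.TStar.boundary k d)) ∧
      (∀ x : KnotDiagram.T k d,
        x ∈ KnotDiagram.T.evenPart k d ∨ CharP k 2 →
        x ∈ LinearMap.range (KnotDiagram.T.boundary k d) →
        KnotDiagram.T.dividedPower k d ℓ x ∈ LinearMap.range (KnotDiagram.T.boundary k d))) := by
  -- In characteristic 2 every chain counts as even, which reduces that case to the even one.
  have top_le : CharP k 2 → ∀ S : Submodule k (TStar k d), S ≤ paritySpan k d 0 0 := fun h S =>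
    (paritySpan_eq_top (two_eq_zero_of_charP h) 0).symm ▸ le_top
  refine ⟨fun q hq => ?_, ⟨?_, ?_⟩, fun h => ⟨?_, ?_⟩, fun hl => ⟨fun x hx hr => ?_,
    fun x hx hr => ?_⟩⟩
  · have hS : TStar.degreePart k d q ≤ paritySpan k d 0 0 :=
      hq.elim (fun hq => (degreePart_le_evenPart hq).trans evenPart_le_paritySpan)
        fun h => top_le h _
    exact ⟨TStar.descendsToHomology_dividedPower hS ℓ fun x hx => dividedPower_mem_degreePart hx ℓ,
      T.descendsToHomology_dividedPower hS ℓ fun x hx => dividedPower_mem_degreePart hx ℓ⟩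
  · exact TStar.descendsToHomology_dividedPower evenPart_le_paritySpan ℓ
      fun x hx => dividedPower_mem_evenPart hx ℓ
  · rw [T.evenPart_eq_map]
    exact T.descendsToHomology_dividedPower evenPart_le_paritySpan ℓ
      fun x hx => dividedPower_mem_evenPart hx ℓ
  · exact TStar.descendsToHomology_dividedPower (top_le h ⊤) ℓ fun x _ => Submodule.mem_top
  · have := T.descendsToHomology_dividedPower (S' := ⊤) (top_le h ⊤) ℓ fun x _ => Submodule.mem_top
    rwa [Submodule.map_top, Submodule.range_mkQ] at this
  · exact TStar.dividedPower_mem_range hl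
      (hx.elim (fun hx => evenPart_le_paritySpan hx) fun h => top_le h ⊤ Submodule.mem_top) hr
  -- An even element of `T` has an even lift, because the even part of `T` is the image of that of
  -- `T_*`.
  · obtain ⟨y, hy, rfl⟩ : ∃ y ∈ paritySpan k d 0 0, (asteriskPart k d).mkQ y = x := by
      rcases hx with hx | h
      · rw [T.evenPart_eq_map] at hx
        obtain ⟨y, hy, rfl⟩ := hx
        exact ⟨y, evenPart_le_paritySpan hy, rfl⟩
      · obtain ⟨y, rfl⟩ := (asteriskPart k d).mkQ_surjective x
        exact ⟨y, top_le h ⊤ Submodule.mem_top, rfl⟩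
    exact T.dividedPower_mem_range hl hy hr
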